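/- Let $\mathbb F$ be an algebraically closed field of characteristic $0$ and $n\ge 0$. Let $\mathcal Y_n=\mathcal C_n\rtimes\mathbb F S_n$ be the finite Hecke--Clifford superalgebra: it is generated by odd elements $c_1,\dots,c_n$ with $c_k^2=1$, $c_kc_l=-c_lc_k$ $(k\ne l)$, and by the (even) group $S_n$, with $wc_k=c_{w(k)}w$. Its Jucys--Murphy elements are $L_k=\sum_{j<k}(1+c_jc_k)(j\,k)$. Modules are $\mathbb Z/2$-graded left modules; homomorphisms are sums of an even and an odd map $f$ with $f(av)=(-1)^{\bar f\bar a}af(v)$ for homogeneous $a$ (so isomorphisms need not be even). A module is irreducible if it is nonzero and has no proper nonzero graded submodule, and completely splittable if all $L_k$ act semisimply on it; it has type $\mathtt M$ (resp. $\mathtt Q$) if its endomorphism algebra has dimension $1$ (resp. $2$). Put $q(i)=i(i+1)$, and for $\underline i\in\mathbb Z_{\ge0}^n$ let $M_{\underline i}=\{z\in M: (L_k^2-q(i_k))^Nz=0 \text{ for } N\gg0,\ 1\le k\le n\}$. A strict partition $\lambda$ of $n$ (distinct parts, $l(\lambda)$ of them) is identified with its shifted Young diagram, whose $k$-th row is shifted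 by $k-1$ to the right. The content of the box in row $r$ and column $s$ is $s-r$. Let $f^\lambda$ be the number of standard tableaux of this shifted shape (labels $1,\dots,n$ increasing along rows and down columns); for such a tableau $T$ let $c(T)\in\mathbb Z_{\ge 0}^n$ be the vector whose $k$-th entry is the content of the box labelled $k$. Then for every strict partition $\lambda$ of $n$ there is a $\mathcal Y_n$-module $D(\lambda)$ such that: (1) $D(\lambda)$ is irreducible, completely splittable and finite dimensional, $\dim D(\lambda)=2^{\,n-\lfloor l(\lambda)/2\rfloor}f^\lambda$, and $D(\lambda)$ is of type $\mathtt M$ if $l(\lambda)$ is even and of type $\mathtt Q$ if $l(\lambda)$ is odd. (2) The shifted Young diagrams with $n$ boxes parametrize the irreducible completely splittable $\mathcal Y_n$-modules: $D(\lambda)\not\cong D(\mu)$ for $\lambda\ne\mu$, and every irreducible completely splittable $\mathcal Y_n$-module is isomorphic to some $D(\lambda)$. (3) (Seminormal form.) $D(\lambda)=\bigoplus_T D(\lambda)_{c(T)}$ over the standard tableaux $T$ of shape $\lambda$; each $D(\lambda)_{c(T)}$ is nonzero and irreducible under the $L_k$ and $c_k$ (it has no proper nonzero graded subspace stable under all of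 them). There are even linear bijections $\theta_{T,S}:D(\lambda)_{c(T)}\to D(\lambda)_{c(S)}$ with $\theta_{T,T}=1$ and $\theta_{S,R}\theta_{T,S}=\theta_{T,R}$, such that $\theta_{T,S}c_j=c_{\tau(j)}\theta_{T,S}$ and $\theta_{T,S}L_j=L_{\tau(j)}\theta_{T,S}$ when $S=\tau T$, $\tau\in S_n$ (that is, $S$ arises from $T$ by applying $\tau$ to the labels). For $1\le k<n$ and $z\in D(\lambda)_{c(T)}$, $\underline i=c(T)$, the transposition $s_k=(k\,k{+}1)$ acts as follows. If $i_k\ne i_{k+1}\pm1$, then $s_kT$ is standard and $s_kz=\Xi_kz+\Omega_k\,\theta_{T,s_kT}z$; if $i_k=i_{k+1}\pm1$, then $s_kz=\Xi_kz$. Here, with fixed choices of square roots in $\mathbb F$, $$\Xi_kz=-\frac{(L_k+L_{k+1})z+c_kc_{k+1}(L_k-L_{k+1})z}{q(i_k)-q(i_{k+1})},\qquad \Omega_k=\sqrt{1-\frac{2\,(q(i_k)+q(i_{k+1}))}{(q(i_k)-q(i_{k+1}))^2}}.$$ -/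

import Mathlib

universe u v w w'

/-! # Superalgebras and their modules -/

/-- A `ℤ/2`-graded left module over a superalgebra `A = 𝒜 0 ⊕ 𝒜 1` over `F`. -/
structure SuperModule (F : Type u) [Field F] {A : Type v} [Ring A] [Algebra F A]
    (𝒜 : ZMod 2 → Submodule F A) [GradedAlgebra 𝒜] where
  carrier : Type w
  [addCommGroup : AddCommGroup carrier]
  [module : Module F carrier]
  [moduleAlg : Module A carrier]
  [isScalarTower : IsScalarTower F A carrier]
  /-- the even part `gr 0` and the odd part `gr 1` -/
  gr : ZMod 2 → Submodule F carrier
  isInternal : DirectSum.IsInternal gr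
  smul_mem : ∀ (d e : ZMod 2) (a : A) (z : carrier), a ∈ 𝒜 d → z ∈ gr e → a • z ∈ gr (d + e)

namespace SuperModule

attribute [instance] SuperModule.addCommGroup SuperModule.module SuperModule.moduleAlg
  SuperModule.isScalarTower

variable {F : Type u} [Field F] {A : Type v} [Ring A] [Algebra F A]
  {𝒜 : ZMod 2 → Submodule F A} [GradedAlgebra 𝒜]

/-- The `F`-linear operator by which `a ∈ A` acts on `M`. -/
def op (M : SuperModule.{u, v, w} F 𝒜) (a : A) : Module.End F M.carrier :=
  Algebra.lsmul F F M.carrier a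

/-- A subspace is graded (homogeneous) if it is the sum of its even and its odd part. -/
def IsGraded (M : SuperModule.{u, v, w} F 𝒜) (N : Submodule F M.carrier) : Prop :=
  N = (N ⊓ M.gr 0) ⊔ (N ⊓ M.gr 1)

/-- `N` is a nonzero graded subspace stable under `S ⊆ A`, and its only graded subspaces
stable under `S` are `0` and `N`: that is, `N` is an irreducible supermodule over the
subalgebra generated by `S` (for `S` consisting of homogeneous elements, or `S = A`). -/
def IsIrreducibleUnder (M : SuperModule.{u, v, w} F 𝒜) (S : Set A)
    (N : Submodule F M.carrier) : Prop :=
  M.IsGraded N ∧ (∀ a ∈ S, ∀ z ∈ N, a • z ∈ N) ∧ N ≠ ⊥ ∧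
    ∀ P : Submodule F M.carrier, P ≤ N → M.IsGraded P → (∀ a ∈ S, ∀ z ∈ P, a • z ∈ P) →
      P = ⊥ ∨ P = N

/-- Irreducible supermodules: nonzero, without proper nonzero graded submodules. -/
def IsIrreducible (M : SuperModule.{u, v, w} F 𝒜) : Prop :=
  M.IsIrreducibleUnder Set.univ ⊤

/-- Homogeneous homomorphisms `f : M → N` of parity `d`: `f` shifts the grading by `d`, and
`f (a z) = (-1)^(d e) a (f z)` for all `a` of parity `e`. -/
def homOfParity (M : SuperModule.{u, v, w} F 𝒜) (N : SuperModule.{u, v, w'} F 𝒜)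
    (d : ZMod 2) : Submodule F (M.carrier →ₗ[F] N.carrier) where
  carrier := {f | (∀ e, ∀ z ∈ M.gr e, f z ∈ N.gr (d + e)) ∧
    ∀ e, ∀ a ∈ 𝒜 e, ∀ z, f (a • z) = ((-1 : F) ^ (d.val * e.val)) • (a • f z)}
  add_mem' := by
    rintro f g ⟨hf, hf'⟩ ⟨hg, hg'⟩
    refine ⟨fun e z hz => add_mem (hf e z hz) (hg e z hz), fun e a ha z => ?_⟩
    simp only [LinearMap.add_apply, hf' e a ha z, hg' e a ha z, smul_add]
  zero_mem' := ⟨fun e z _ => zero_mem _, fun e a _ z => by simp⟩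
  smul_mem' := by
    rintro c f ⟨hf, hf'⟩
    refine ⟨fun e z hz => Submodule.smul_mem _ c (hf e z hz), fun e a ha z => ?_⟩
    simp only [LinearMap.smul_apply, hf' e a ha z]
    rw [smul_comm c, smul_comm c a]

/-- The space `Hom_A(M, N)` of all homomorphisms, i.e. sums of an even and an odd one. -/
def hom (M : SuperModule.{u, v, w} F 𝒜) (N : SuperModule.{u, v, w'} F 𝒜) :
    Submodule F (M.carrier →ₗ[F] N.carrier) :=
  homOfParity M N 0 ⊔ homOfParity M N 1

/-- Isomorphism of `A`-modules (not required to be even, so that `M ≅ Π M` always). -/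
def Isomorphic (M : SuperModule.{u, v, w} F 𝒜) (N : SuperModule.{u, v, w'} F 𝒜) : Prop :=
  ∃ f ∈ hom M N, Function.Bijective f

/-- Type `M`: the endomorphism algebra is one-dimensional. -/
def IsTypeM (M : SuperModule.{u, v, w} F 𝒜) : Prop := Module.finrank F (hom M M) = 1

/-- Type `Q`: the endomorphism algebra is two-dimensional. -/
def IsTypeQ (M : SuperModule.{u, v, w} F 𝒜) : Prop := Module.finrank F (hom M M) = 2

end SuperModule

/-! # The finite Hecke-Clifford algebra -/

namespace HeckeClifford

/-- Defining relations of `𝒞_n ⋊ F S_n` in the free algebra on letters `c_k` (`k : Fin n`) and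
letters for the elements of `S_n`: the Clifford relations, the multiplication table of `S_n`,
and `w c_k = c_{w k} w`. -/
inductive Rel (F : Type u) [Field F] (n : ℕ) :
    FreeAlgebra F (Fin n ⊕ Equiv.Perm (Fin n)) →
      FreeAlgebra F (Fin n ⊕ Equiv.Perm (Fin n)) → Prop
  | c_sq (k : Fin n) :
      Rel F n (FreeAlgebra.ι F (Sum.inl k) * FreeAlgebra.ι F (Sum.inl k)) 1
  | c_anticomm (k l : Fin n) (h : k ≠ l) :
      Rel F n (FreeAlgebra.ι F (Sum.inl k) * FreeAlgebra.ι F (Sum.inl l))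
        (-(FreeAlgebra.ι F (Sum.inl l) * FreeAlgebra.ι F (Sum.inl k)))
  | perm_one : Rel F n (FreeAlgebra.ι F (Sum.inr 1)) 1
  | perm_mul (s t : Equiv.Perm (Fin n)) :
      Rel F n (FreeAlgebra.ι F (Sum.inr s) * FreeAlgebra.ι F (Sum.inr t))
        (FreeAlgebra.ι F (Sum.inr (s * t)))
  | perm_c (s : Equiv.Perm (Fin n)) (k : Fin n) :
      Rel F n (FreeAlgebra.ι F (Sum.inr s) * FreeAlgebra.ι F (Sum.inl k))
        (FreeAlgebra.ι F (Sum.inl (s k)) * FreeAlgebra.ι F (Sum.inr s))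

/-- The finite Hecke-Clifford algebra `𝒴_n = 𝒞_n ⋊ F S_n`. -/
def Y (F : Type u) [Field F] (n : ℕ) : Type u := RingQuot (Rel F n)

noncomputable instance (F : Type u) [Field F] (n : ℕ) : Ring (Y F n) :=
  inferInstanceAs (Ring (RingQuot (Rel F n)))

noncomputable instance (F : Type u) [Field F] (n : ℕ) : Algebra F (Y F n) :=
  inferInstanceAs (Algebra F (RingQuot (Rel F n)))

/-- The quotient map from the free algebra. -/
noncomputable def mk (F : Type u) [Field F] (n : ℕ) :
    FreeAlgebra F (Fin n ⊕ Equiv.Perm (Fin n)) →ₐ[F] Y F n :=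
  RingQuot.mkAlgHom F (Rel F n)

theorem mk_rel {F : Type u} [Field F] {n : ℕ} {x y : FreeAlgebra F (Fin n ⊕ Equiv.Perm (Fin n))}
    (h : Rel F n x y) : mk F n x = mk F n y :=
  RingQuot.mkAlgHom_rel F h

/-- The universal property: a map of the letters into an algebra `B` that respects the defining
relations extends to `𝒴_n`. -/
noncomputable def lift {F : Type u} [Field F] {n : ℕ} {B : Type v} [Ring B] [Algebra F B]
    (f : FreeAlgebra F (Fin n ⊕ Equiv.Perm (Fin n)) →ₐ[F] B)
    (h : ∀ x y, Rel F n x y → f x = f y) : Y F n →ₐ[F] B :=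
  RingQuot.liftAlgHom F ⟨f, fun _ _ => h _ _⟩

theorem lift_mk {F : Type u} [Field F] {n : ℕ} {B : Type v} [Ring B] [Algebra F B]
    (f : FreeAlgebra F (Fin n ⊕ Equiv.Perm (Fin n)) →ₐ[F] B)
    (h : ∀ x y, Rel F n x y → f x = f y) (x) : lift f h (mk F n x) = f x :=
  RingQuot.liftAlgHom_mkAlgHom_apply F f (fun _ _ => h _ _) x

theorem algHom_ext {F : Type u} [Field F] {n : ℕ} {B : Type v} [Ring B] [Algebra F B]
    {f g : Y F n →ₐ[F] B} (h : f.comp (mk F n) = g.comp (mk F n)) : f = g :=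
  RingQuot.ringQuot_ext' F f g h

variable {F : Type u} [Field F] {n : ℕ}

/-- The Clifford generator `c_k`. -/
noncomputable def c (k : Fin n) : Y F n := mk F n (FreeAlgebra.ι F (Sum.inl k))

/-- The image in `𝒴_n` of the permutation `s`. -/
noncomputable def perm (s : Equiv.Perm (Fin n)) : Y F n :=
  mk F n (FreeAlgebra.ι F (Sum.inr s))

theorem c_mul_self (k : Fin n) : (c k * c k : Y F n) = 1 := by
  simpa [c] using mk_rel (Rel.c_sq (F := F) k)

theorem c_mul_c (k l : Fin n) (h : k ≠ l) : (c k * c l : Y F n) = -(c l * c k) := by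
  simpa [c] using mk_rel (Rel.c_anticomm (F := F) k l h)

theorem perm_one : (perm 1 : Y F n) = 1 := by
  simpa [perm] using mk_rel (Rel.perm_one (F := F) (n := n))

theorem perm_mul (s t : Equiv.Perm (Fin n)) : (perm s * perm t : Y F n) = perm (s * t) := by
  simpa [perm] using mk_rel (Rel.perm_mul (F := F) s t)

theorem perm_mul_c (s : Equiv.Perm (Fin n)) (k : Fin n) :
    (perm s * c k : Y F n) = c (s k) * perm s := by
  simpa [perm, c] using mk_rel (Rel.perm_c (F := F) s k)

/-- The parity automorphism of `𝒴_n`: `c_k ↦ -c_k`, `s ↦ s` for `s ∈ S_n`. -/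
noncomputable def parity (F : Type u) [Field F] (n : ℕ) : Y F n →ₐ[F] Y F n :=
  lift (FreeAlgebra.lift F (Sum.elim (fun k => -c k) perm)) (by
    intro x y h
    induction h with
    | c_sq k => simp [c_mul_self]
    | c_anticomm k l h => simpa using c_mul_c k l h
    | perm_one => simp [perm_one]
    | perm_mul s t => simp [perm_mul]
    | perm_c s k => simp [perm_mul_c])

theorem parity_c (k : Fin n) : parity F n (c k) = -c k := by
  simp [parity, c, lift_mk]

theorem parity_perm (s : Equiv.Perm (Fin n)) : parity F n (perm s) = perm s := by
  simp [parity, perm, lift_mk]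

theorem parity_parity (a : Y F n) : parity F n (parity F n a) = a := by
  have h : (parity F n).comp (parity F n) = AlgHom.id F (Y F n) := by
    apply algHom_ext
    apply FreeAlgebra.hom_ext
    funext x
    rcases x with k | s
    · change parity F n (parity F n (c k)) = c k
      simp [parity_c]
    · change parity F n (parity F n (perm s)) = perm s
      simp [parity_perm]
  exact DFunLike.congr_fun h a

/-- The `ℤ/2`-grading of `𝒴_n` for which the `c_k` are odd and the permutations are even:
`a` has parity `d` if the parity automorphism multiplies it by `(-1)^d`. -/
def grading (F : Type u) [Field F] (n : ℕ) (d : ZMod 2) : Submodule F (Y F n) where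
  carrier := {a | parity F n a = ((-1 : F) ^ d.val) • a}
  add_mem' := by
    intro a b (ha : parity F n a = _) (hb : parity F n b = _)
    change parity F n (a + b) = _
    rw [map_add, ha, hb, smul_add]
  zero_mem' := by
    change parity F n 0 = _
    simp
  smul_mem' := by
    intro r a (ha : parity F n a = _)
    change parity F n (r • a) = _
    rw [map_smul, ha, smul_comm]

theorem mem_grading {d : ZMod 2} {a : Y F n} :
    a ∈ grading F n d ↔ parity F n a = ((-1 : F) ^ d.val) • a := Iff.rfl

theorem mem_grading_zero {a : Y F n} : a ∈ grading F n 0 ↔ parity F n a = a := by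
  simp [mem_grading]

theorem mem_grading_one {a : Y F n} : a ∈ grading F n 1 ↔ parity F n a = -a := by
  rw [mem_grading, ZMod.val_one, pow_one, neg_one_smul]

theorem c_mem_grading (k : Fin n) : (c k : Y F n) ∈ grading F n 1 :=
  mem_grading_one.2 (parity_c k)

theorem perm_mem_grading (s : Equiv.Perm (Fin n)) : (perm s : Y F n) ∈ grading F n 0 :=
  mem_grading_zero.2 (parity_perm s)

theorem zmod_two_cases (d : ZMod 2) : d = 0 ∨ d = 1 := by
  revert d
  decide

/-- The even part `(a + parity a) / 2`. -/
noncomputable def evenPart (F : Type u) [Field F] (n : ℕ) : Y F n →+ grading F n 0 where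
  toFun a := ⟨(2 : F)⁻¹ • (a + parity F n a), by
    rw [mem_grading_zero, map_smul, map_add, parity_parity, add_comm]⟩
  map_zero' := by ext; simp
  map_add' a b := by
    ext
    simp only [map_add, Submodule.coe_add, ← smul_add]
    congr 1
    abel

/-- The odd part `(a - parity a) / 2`. -/
noncomputable def oddPart (F : Type u) [Field F] (n : ℕ) : Y F n →+ grading F n 1 where
  toFun a := ⟨(2 : F)⁻¹ • (a - parity F n a), by
    rw [mem_grading_one, map_smul, map_sub, parity_parity, ← smul_neg, neg_sub]⟩
  map_zero' := by ext; simp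
  map_add' a b := by
    ext
    simp only [map_add, Submodule.coe_add, ← smul_add]
    congr 1
    abel

noncomputable instance gradedAlgebra (F : Type u) [Field F] [NeZero (2 : F)] (n : ℕ) :
    GradedAlgebra (grading F n) where
  one_mem := by simp [mem_grading_zero]
  mul_mem := by
    intro d e a b ha hb
    rcases zmod_two_cases d with rfl | rfl <;> rcases zmod_two_cases e with rfl | rfl
    · rw [mem_grading_zero] at ha hb
      rw [add_zero, mem_grading_zero, map_mul, ha, hb]
    · rw [mem_grading_zero] at ha
      rw [mem_grading_one] at hb
      rw [zero_add, mem_grading_one, map_mul, ha, hb, mul_neg]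
    · rw [mem_grading_one] at ha
      rw [mem_grading_zero] at hb
      rw [add_zero, mem_grading_one, map_mul, ha, hb, neg_mul]
    · rw [mem_grading_one] at ha hb
      rw [show (1 : ZMod 2) + 1 = 0 from rfl, mem_grading_zero, map_mul, ha, hb, neg_mul_neg]
  decompose' a :=
    DirectSum.of (fun d => grading F n d) 0 (evenPart F n a) +
      DirectSum.of (fun d => grading F n d) 1 (oddPart F n a)
  left_inv a := by
    have h2 : (2 : F) ≠ 0 := NeZero.ne _
    simp only [map_add, DirectSum.coeAddMonoidHom_of, evenPart, oddPart, AddMonoidHom.coe_mk,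
      ZeroHom.coe_mk]
    rw [← smul_add, add_add_sub_cancel, ← two_smul F a, smul_smul, inv_mul_cancel₀ h2, one_smul]
  right_inv x := by
    have h2 : (2 : F) ≠ 0 := NeZero.ne _
    have key (a : Y F n) : (2 : F)⁻¹ • (a + a) = a := by
      rw [← two_smul F a, smul_smul, inv_mul_cancel₀ h2, one_smul]
    induction x using DirectSum.induction_on with
    | zero => simp only [map_zero, add_zero]
    | of d a =>
      obtain ⟨a, ha⟩ := a
      simp only [DirectSum.coeAddMonoidHom_of]
      rcases zmod_two_cases d with rfl | rfl
      · have h := mem_grading_zero.1 ha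
        have h0 : evenPart F n a = ⟨a, ha⟩ := by
          ext
          simpa [evenPart, h, smul_add] using key a
        have h1 : oddPart F n a = 0 := by ext; simp [oddPart, h]
        rw [h0, h1, map_zero, add_zero]
      · have h := mem_grading_one.1 ha
        have h0 : evenPart F n a = 0 := by ext; simp [evenPart, h]
        have h1 : oddPart F n a = ⟨a, ha⟩ := by ext; simp [oddPart, h, key]
        rw [h0, h1, map_zero, zero_add]
    | add x y hx hy =>
      simp only [map_add]
      rw [add_add_add_comm]
      exact congrArg₂ (· + ·) hx hy

/-- The transposition `(j k)` as an element of `𝒴_n`. -/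
noncomputable def transposition (j k : Fin n) : Y F n := perm (Equiv.swap j k)

/-- The Jucys-Murphy element `L_k = ∑_{j < k} (1 + c_j c_k) (j k)`. -/
noncomputable def jucysMurphy (k : Fin n) : Y F n :=
  ∑ j ∈ Finset.univ.filter (· < k), (1 + c j * c k) * transposition j k

/-- The category of `𝒴_n`-modules (`ℤ/2`-graded). -/
abbrev YModule (F : Type u) [Field F] [NeZero (2 : F)] (n : ℕ) : Type (max u (w + 1)) :=
  SuperModule.{u, u, w} F (grading F n)

variable [NeZero (2 : F)]

/-- Completely splittable: all Jucys-Murphy elements act semisimply. -/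
def IsCompletelySplittable (M : YModule.{u, w} F n) : Prop :=
  ∀ k : Fin n, (M.op (jucysMurphy k)).IsSemisimple

/-- `q(i) = i (i + 1)`. -/
noncomputable def q (F : Type u) [Field F] (i : ℕ) : F := (i : F) * ((i : F) + 1)

/-- The weight space `M_i`: all `z` such that, for every `k`, `(L_k² - q(i_k))^N z = 0` for
some `N`. -/
noncomputable def weightSpace (M : YModule.{u, w} F n) (i : Fin n → ℕ) : Submodule F M.carrier :=
  ⨅ k : Fin n, (M.op (jucysMurphy k ^ 2)).maxGenEigenspace (q F (i k))

end HeckeClifford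

/-! # Strict partitions, shifted diagrams and standard tableaux -/

/-- Partitions of `n` with pairwise distinct parts. -/
def StrictPartition (n : ℕ) : Type := {p : n.Partition // p.parts.Nodup}

namespace StrictPartition

variable {n : ℕ}

/-- The number `l(λ)` of parts. -/
def length (lam : StrictPartition n) : ℕ := lam.1.parts.card

/-- `part λ r` is the `(r+1)`-st largest part `λ_{r+1}`, and `0` for `r ≥ l(λ)`. -/
def part (lam : StrictPartition n) (r : ℕ) : ℕ :=
  (lam.1.parts.sort (· ≥ ·)).getD r 0

/-- Boxes `(row, column)` of the shifted Young diagram, both counted from `0`: row `r` has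
`λ_{r+1}` boxes and starts in column `r`. -/
def boxes (lam : StrictPartition n) : Set (ℕ × ℕ) :=
  {b | b.1 ≤ b.2 ∧ b.2 < b.1 + lam.part b.1}

end StrictPartition

/-- Standard tableaux of shifted shape `λ`: `box k` is the box that carries the label `k`; labels
strictly increase along rows and down columns. (Labels are `0, …, n - 1`.) -/
structure StandardTableau {n : ℕ} (lam : StrictPartition n) where
  box : Fin n ≃ lam.boxes
  row_increasing : ∀ k l : Fin n, (box k).1.1 = (box l).1.1 → (box k).1.2 < (box l).1.2 → k < l
  column_increasing : ∀ k l : Fin n,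
    (box k).1.2 = (box l).1.2 → (box k).1.1 < (box l).1.1 → k < l

namespace StandardTableau

variable {n : ℕ} {lam : StrictPartition n}

/-- The vector of contents `i_k = c(T(k))`: the content of a box is the number of its diagonal,
the main diagonal having number `0`. -/
def content (T : StandardTableau lam) (k : Fin n) : ℕ := (T.box k).1.2 - (T.box k).1.1

/-- The permutation `τ` with `S = τ T`, i.e. the label of a box in `S` is `τ` of its label
in `T`. -/
def transition (T S : StandardTableau lam) : Equiv.Perm (Fin n) := T.box.trans S.box.symm

end StandardTableau

/-- The number `f^λ` of standard tableaux of shifted shape `λ`. -/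
noncomputable def numStandardTableaux {n : ℕ} (lam : StrictPartition n) : ℕ :=
  Nat.card (StandardTableau lam)

/-! # The seminormal form -/

namespace HeckeClifford

/-- A choice of square root in an algebraically closed field. -/
noncomputable def squareRoot {F : Type u} [Field F] [IsAlgClosed F] (x : F) : F :=
  (IsAlgClosed.exists_pow_nat_eq x (n := 2) two_pos).choose

variable {F : Type u} [Field F] [NeZero (2 : F)] {n : ℕ}

/-- The operator `Ξ_k` on the weight space `M_i`, for adjacent labels `k`, `k'`:
`Ξ_k z = -((L_k + L_k') + c_k c_k' (L_k - L_k')) z / (q(i_k) - q(i_k'))`. -/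
noncomputable def xi (M : YModule.{u, w} F n) (i : Fin n → ℕ) (k k' : Fin n) :
    Module.End F M.carrier :=
  -((q F (i k) - q F (i k'))⁻¹ •
    M.op ((jucysMurphy k + jucysMurphy k') + c k * c k' * (jucysMurphy k - jucysMurphy k')))

/-- The scalar `Ω_k` on the weight space `M_i`, for adjacent labels `k`, `k'`:
`Ω_k = √(1 - 2 (q(i_k) + q(i_k')) / (q(i_k) - q(i_k'))²)`. -/
noncomputable def omega [IsAlgClosed F] (i : Fin n → ℕ) (k k' : Fin n) : F :=
  squareRoot (1 - 2 * (q F (i k) + q F (i k')) / (q F (i k) - q F (i k')) ^ 2)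

/-- `s_k = (k k')` is admissible for the weight `i` if `i_k ≠ i_k' ± 1`. -/
def Admissible (i : Fin n → ℕ) (k k' : Fin n) : Prop := i k ≠ i k' + 1 ∧ i k' ≠ i k + 1

/-- `M` has seminormal form of shifted shape `λ`. The module is the direct sum of the weight
spaces `M_T := M_{c(T)}` for the standard tableaux `T` of shape `λ`; each `M_T` is irreducible under
the `L_k` and the `c_k`; there is a compatible system of even bijections
`θ T S : M_T → M_S` that intertwine `c_j`, `L_j` with `c_{τ j}`, `L_{τ j}`, where `S = τ T`; and for
`z ∈ M_T` one has `s_k z = Ξ_k z + Ω_k θ z` with `θ : M_T → M_{s_k T}` if `s_k` is admissible, and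
`s_k z = Ξ_k z` otherwise. -/
def IsSeminormal [IsAlgClosed F] (lam : StrictPartition n) (M : YModule.{u, w} F n) : Prop :=
  iSupIndep (fun T : StandardTableau lam => weightSpace M T.content) ∧
  (⨆ T : StandardTableau lam, weightSpace M T.content) = ⊤ ∧
  (∀ T : StandardTableau lam,
    M.IsIrreducibleUnder (Set.range c ∪ Set.range jucysMurphy) (weightSpace M T.content)) ∧
  ∃ θ : StandardTableau lam → StandardTableau lam → (M.carrier →ₗ[F] M.carrier),
    (∀ T S, ∀ z ∈ weightSpace M T.content,
      θ T S z ∈ weightSpace M S.content ∧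
      θ T T z = z ∧
      (∀ R, θ S R (θ T S z) = θ T R z) ∧
      (∀ d, z ∈ M.gr d → θ T S z ∈ M.gr d) ∧
      ∀ j, θ T S (c (F := F) j • z) = c (F := F) (T.transition S j) • θ T S z ∧
        θ T S (jucysMurphy (F := F) j • z) =
          jucysMurphy (F := F) (T.transition S j) • θ T S z) ∧
    ∀ (T : StandardTableau lam) (k k' : Fin n), (k' : ℕ) = k + 1 →
      (Admissible T.content k k' →
        ∃ S : StandardTableau lam, T.transition S = Equiv.swap k k' ∧
          ∀ z ∈ weightSpace M T.content,
            transposition (F := F) k k' • z =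
              xi M T.content k k' z + omega (F := F) T.content k k' • θ T S z) ∧
      (¬ Admissible T.content k k' →
        ∀ z ∈ weightSpace M T.content,
          transposition (F := F) k k' • z = xi M T.content k k' z)

end HeckeClifford

-- Everything rests on the relation s_k L_k = L_{k+1} s_k - (1 + c_k c_{k+1}). On a joint eigenspace
-- of the squares L_j² with eigenvalues a_j, where a_k ≠ a_{k+1}, the operator Ξ_k, built from the
-- c's and L's alone, satisfies the same commutation relations with all c_j and L_j as s_k does.
-- Hence s_k - Ξ_k intertwines: it permutes c's and L's by s_k and carries the weight a to s_k a.
-- Going there and back is the scalar Ω_k² = 1 - Ξ_k², where Ξ_k² = 2(a_k + a_{k+1})/(a_k -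
-- a_{k+1})².
--
-- Construction. The weight space of a tableau is to be an irreducible module over Clifford
-- generators C_b and commuting operators X_b with X_b² = q(content of b), and X_b = 0 for b on the
-- diagonal. If these are indexed by boxes b instead of labels, one such module `R` serves all
-- tableaux of the shape. D(λ) is then the space of functions from tableaux to `R`, θ is the
-- identity of `R`, and s_k acts by Ξ_k plus Ω_k times the exchange of T and s_k T. The only Coxeter
-- relation that needs an argument is the braid relation (`braidDiff_eq_zero`). The difference of
-- its two sides intertwines the X's, so it can only connect T with a tableau whose contents are
-- those of T with entries k and k+2 exchanged. There both sides give the same product of three Ω's,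
-- unless the contents are 0, 1, 0, where both sides consist of Ξ's and `xi_braid` applies.
--
-- Contents determine a tableau, so polynomials in the L_k² project to the weight spaces. Admissible
-- transpositions have Ω ≠ 0 and connect all tableaux. This reduces submodules and endomorphisms of
-- D(λ) to those of `R`. In `R`, two Clifford generators C, C' with X = X' = 0 are equivalent to one
-- generator C with X = √-1 C C'. Pairing off the l(λ) diagonal boxes thus leaves the regular module
-- of a Clifford algebra on n - ⌊l(λ)/2⌋ generators, at most one of which has X = 0. This explains
-- the dimension; the leftover generator, present if l(λ) is odd, gives the odd endomorphism.
--
-- Classification. In a completely splittable module with weight a, semisimplicity forces a_k ≠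
-- a_{k+1} (`eq_zero_of_weight_eq`). If a_k = a_{k+2}, both intertwiners vanish, and the braid
-- relation for the Ξ's forces a_k = 0 or a_k + 3a_{k+1} = 0 (`weight_eq_of_eq`). Together with
-- exchanges of neighbours for which Ω ≠ 0, these rules allow exactly the content vectors of
-- standard tableaux (`exists_tableau`). On an irreducible module containing the weight of T, the
-- permutation taking T to S acts on the weight space of T as a product of intertwiners plus terms
-- in weight spaces of tableaux closer to T. Its leading term depends on the permutation only, so
-- the products of intertwiners along different paths agree. Normalized by the scalars that occur in
-- the model, these leading terms embed a copy of `R` in every weight space (`exists_family`), and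
-- together they form an isomorphism with the model.

universe v'

/-! ### Commutation relations and finite dimension of the Hecke-Clifford algebra -/

namespace HeckeClifford

section Relations

variable {F : Type u} [Field F] {n : ℕ}

theorem transposition_mul_self (j k : Fin n) :
    (transposition j k * transposition j k : Y F n) = 1 := by
  rw [transposition, perm_mul, Equiv.swap_mul_self, perm_one]

theorem perm_mul_transposition (s : Equiv.Perm (Fin n)) (j k : Fin n) :
    (perm s * transposition j k : Y F n) = transposition (s j) (s k) * perm s := by
  rw [transposition, transposition, perm_mul, perm_mul, Equiv.mul_swap_eq_swap_mul]

theorem transposition_mul_c_left (j k : Fin n) :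
    (transposition j k * c j : Y F n) = c k * transposition j k := by
  rw [transposition, perm_mul_c, Equiv.swap_apply_left]

theorem transposition_mul_c_right (j k : Fin n) :
    (transposition j k * c k : Y F n) = c j * transposition j k := by
  rw [transposition, perm_mul_c, Equiv.swap_apply_right]

theorem transposition_mul_c_of_ne {j k l : Fin n} (hj : l ≠ j) (hk : l ≠ k) :
    (transposition j k * c l : Y F n) = c l * transposition j k := by
  rw [transposition, perm_mul_c, Equiv.swap_apply_of_ne_of_ne hj hk]

theorem c_mul_c_mul_c (k l : Fin n) (h : k ≠ l) (a : Y F n) : c k * (c l * a) = -(c l * (c k * a)) := by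
  rw [← mul_assoc, c_mul_c k l h, neg_mul, mul_assoc]

theorem c_mul_self_mul (k : Fin n) (a : Y F n) : c k * (c k * a) = a := by
  rw [← mul_assoc, c_mul_self, one_mul]

/-- This holds summand by summand: `c k` passes through `(j k)` as `c j`, and c_k (1 + c_j c_k) =
c_k - c_j = -(1 + c_j c_k) c_j. -/
theorem c_mul_jucysMurphy_self (k : Fin n) :
    (c k * jucysMurphy k : Y F n) = -(jucysMurphy k * c k) := by
  rw [jucysMurphy, Finset.mul_sum, Finset.sum_mul, ← Finset.sum_neg_distrib]
  refine Finset.sum_congr rfl fun j hj => ?_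
  have hj : j ≠ k := (Finset.mem_filter.1 hj).2.ne
  rw [mul_assoc _ (transposition j k), transposition_mul_c_right, ← mul_assoc, ← mul_assoc,
    ← neg_mul]
  congr 1
  rw [mul_add, add_mul, mul_one, one_mul, c_mul_c_mul_c k j hj.symm, c_mul_self, mul_assoc,
    c_mul_c k j hj.symm, mul_neg, c_mul_self_mul, mul_one]
  abel

theorem c_mul_jucysMurphy_of_ne {l k : Fin n} (h : l ≠ k) :
    (c l * jucysMurphy k : Y F n) = jucysMurphy k * c l := by
  rw [jucysMurphy, Finset.mul_sum, Finset.sum_mul]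
  refine Finset.sum_congr rfl fun j hj => ?_
  have hj : j ≠ k := (Finset.mem_filter.1 hj).2.ne
  rcases eq_or_ne l j with rfl | hl
  · rw [mul_assoc _ (transposition l k), transposition_mul_c_left, ← mul_assoc, ← mul_assoc]
    congr 1
    rw [mul_add, add_mul, mul_one, one_mul, c_mul_self_mul, mul_assoc, c_mul_self, mul_one,
      add_comm]
  · rw [mul_assoc _ (transposition j k), transposition_mul_c_of_ne hl h, ← mul_assoc, ← mul_assoc]
    congr 1
    rw [mul_add, add_mul, mul_one, one_mul, c_mul_c_mul_c l j hl, c_mul_c l k h, mul_neg, neg_neg,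
      mul_assoc]

theorem perm_mul_jucysMurphy (s : Equiv.Perm (Fin n)) (k : Fin n) :
    (perm s * jucysMurphy k : Y F n) =
      (∑ j ∈ Finset.univ.filter (· < k), (1 + c (s j) * c (s k)) * transposition (s j) (s k)) *
        perm s := by
  rw [jucysMurphy, Finset.mul_sum, Finset.sum_mul]
  refine Finset.sum_congr rfl fun j _ => ?_
  rw [mul_assoc _ (transposition _ _), ← perm_mul_transposition, ← mul_assoc, ← mul_assoc]
  congr 1
  rw [mul_add, add_mul, mul_one, one_mul, ← mul_assoc, perm_mul_c, mul_assoc, perm_mul_c, mul_assoc]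

theorem perm_mul_jucysMurphy_of_fix (s : Equiv.Perm (Fin n)) (k : Fin n) (hk : s k = k)
    (h : ∀ j, s j < k ↔ j < k) : (perm s * jucysMurphy k : Y F n) = jucysMurphy k * perm s := by
  rw [perm_mul_jucysMurphy, jucysMurphy]
  congr 1
  refine Finset.sum_equiv s (fun j => by simp [h]) fun j _ => by rw [hk]

theorem transposition_mul_jucysMurphy_of_ne {k k' j : Fin n} (hk : (k' : ℕ) = k + 1) (h : j ≠ k)
    (h' : j ≠ k') :
    (transposition k k' * jucysMurphy j : Y F n) = jucysMurphy j * transposition k k' := by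
  refine perm_mul_jucysMurphy_of_fix _ _ (Equiv.swap_apply_of_ne_of_ne h h') fun i => ?_
  rw [Equiv.swap_apply_def]
  split_ifs with h1 h2
  · subst h1; simp only [Fin.lt_def, ne_eq, Fin.ext_iff] at *; omega
  · subst h2; simp only [Fin.lt_def, ne_eq, Fin.ext_iff] at *; omega
  · rfl

theorem transposition_mul_jucysMurphy_of_lt {i j k : Fin n} (hi : i < k) (hj : j < k) :
    (transposition i j * jucysMurphy k : Y F n) = jucysMurphy k * transposition i j := by
  refine perm_mul_jucysMurphy_of_fix _ _ (Equiv.swap_apply_of_ne_of_ne hi.ne' hj.ne') fun l => ?_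
  rw [Equiv.swap_apply_def]
  split_ifs with h1 h2
  · subst h1; simp [hi, hj]
  · subst h2; simp [hi, hj]
  · rfl

/-- Conjugation by `(k k')` turns the sum for `L_k` into the part `j < k` of the sum for `L_k'`; the
remaining summand `j = k` produces the correction. All properties of the intertwiners come from this
relation. -/
theorem transposition_mul_jucysMurphy {k k' : Fin n} (hk : (k' : ℕ) = k + 1) :
    (transposition k k' * jucysMurphy k : Y F n) =
      jucysMurphy k' * transposition k k' - (1 + c k * c k') := by
  have h1 : (transposition k k' * jucysMurphy k : Y F n) =
      (∑ j ∈ Finset.univ.filter (· < k), (1 + c j * c k') * transposition j k') *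
        transposition k k' := by
    rw [transposition, perm_mul_jucysMurphy, Equiv.swap_apply_left]
    congr 1
    refine Finset.sum_congr rfl fun j hj => ?_
    have hj : j < k := (Finset.mem_filter.1 hj).2
    rw [Equiv.swap_apply_of_ne_of_ne hj.ne]
    rw [ne_eq, Fin.ext_iff]
    rw [Fin.lt_def] at hj
    omega
  have h2 : Finset.univ.filter (· < k') = insert k (Finset.univ.filter (· < k)) := by
    ext j
    simp only [Finset.mem_filter, Finset.mem_univ, true_and, Finset.mem_insert, Fin.lt_def,
      Fin.ext_iff]
    omega
  have h3 : (jucysMurphy k' : Y F n) = (1 + c k * c k') * transposition k k' +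
      ∑ j ∈ Finset.univ.filter (· < k), (1 + c j * c k') * transposition j k' := by
    rw [jucysMurphy, h2, Finset.sum_insert (by simp)]
  rw [h1, h3, add_mul, mul_assoc _ (transposition k k'), transposition_mul_self, mul_one]
  abel

theorem transposition_mul_jucysMurphy' {k k' : Fin n} (hk : (k' : ℕ) = k + 1) :
    (transposition k k' * jucysMurphy k' : Y F n) =
      jucysMurphy k * transposition k k' + (1 - c k * c k') := by
  have hne : k ≠ k' := by rw [ne_eq, Fin.ext_iff]; omega
  have h := congrArg (fun a => transposition k k' * a * transposition k k')
    (transposition_mul_jucysMurphy (F := F) hk)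
  rw [← mul_assoc, transposition_mul_self, one_mul, mul_sub, sub_mul, mul_assoc _ _ (transposition k k'),
    mul_assoc (jucysMurphy k'), transposition_mul_self, mul_one] at h
  have h2 : (transposition k k' * (1 + c k * c k') * transposition k k' : Y F n) = 1 - c k * c k' := by
    rw [mul_add, mul_one, add_mul, transposition_mul_self, ← mul_assoc, transposition_mul_c_left,
      mul_assoc (c k'), transposition_mul_c_right, mul_assoc, mul_assoc, transposition_mul_self,
      mul_one, c_mul_c k' k hne.symm, sub_eq_add_neg]
  rw [h2] at h
  rw [h]
  abel

/-- With `jucysMurphy_zero` this recursion determines how all Jucys-Murphy elements act once the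
generators are known; it identifies their action on the seminormal model. -/
theorem jucysMurphy_succ {k k' : Fin n} (hk : (k' : ℕ) = k + 1) :
    (jucysMurphy k' : Y F n) = transposition k k' * jucysMurphy k * transposition k k' +
      (1 + c k * c k') * transposition k k' := by
  rw [transposition_mul_jucysMurphy hk, sub_mul, mul_assoc, transposition_mul_self, mul_one]
  abel

theorem jucysMurphy_zero {k : Fin n} (hk : (k : ℕ) = 0) : (jucysMurphy k : Y F n) = 0 := by
  rw [jucysMurphy]
  refine Finset.sum_eq_zero fun j hj => ?_
  have hj := (Finset.mem_filter.1 hj).2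
  rw [Fin.lt_def] at hj
  omega

/-- For `j < k` the element `L_j` is built from `c_i`, `c_j` and `(i j)` with `i < j`, and each of
these commutes with `L_k`. -/
theorem jucysMurphy_commute (j k : Fin n) : Commute (jucysMurphy j : Y F n) (jucysMurphy k) := by
  wlog hjk : j < k generalizing j k
  · rcases (not_lt.1 hjk).eq_or_lt with rfl | h
    · exact Commute.refl _
    · exact (this k j h).symm
  rw [jucysMurphy]
  refine Commute.sum_left _ _ _ fun i hi => ?_
  have hi : i < j := (Finset.mem_filter.1 hi).2
  have hik := hi.trans hjk
  refine Commute.mul_left (Commute.add_left (Commute.one_left _) (Commute.mul_left ?_ ?_)) ?_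
  · exact c_mul_jucysMurphy_of_ne hik.ne
  · exact c_mul_jucysMurphy_of_ne hjk.ne
  · exact transposition_mul_jucysMurphy_of_lt hik hjk

theorem parity_jucysMurphy (k : Fin n) : parity F n (jucysMurphy k) = jucysMurphy k := by
  simp [jucysMurphy, transposition, map_sum, parity_c, parity_perm]

/-- An induction principle: `𝒴_n` is generated by the `c_k` and the permutations. -/
theorem induction_on {p : Y F n → Prop} (a : Y F n) (hr : ∀ r : F, p (algebraMap F _ r))
    (hc : ∀ k, p (c k)) (hs : ∀ s, p (perm s)) (hadd : ∀ a b, p a → p b → p (a + b))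
    (hmul : ∀ a b, p a → p b → p (a * b)) : p a := by
  obtain ⟨x, rfl⟩ := RingQuot.mkAlgHom_surjective F (Rel F n) a
  change p (mk F n x)
  induction x using FreeAlgebra.induction with
  | grade0 r => rw [AlgHom.commutes]; exact hr r
  | grade1 x =>
    rcases x with k | s
    · exact hc k
    · exact hs s
  | mul a b ha hb => rw [map_mul]; exact hmul _ _ ha hb
  | add a b ha hb => rw [map_add]; exact hadd _ _ ha hb

/-- A subspace of a module stable under the generators is stable under `𝒴_n`. -/
theorem smul_mem_of_generators {M : Type*} [AddCommGroup M] [Module F M] [Module (Y F n) M]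
    [IsScalarTower F (Y F n) M] (N : Submodule F M)
    (hc : ∀ k, ∀ z ∈ N, (c k : Y F n) • z ∈ N) (hs : ∀ s, ∀ z ∈ N, (perm s : Y F n) • z ∈ N)
    (a : Y F n) : ∀ z ∈ N, a • z ∈ N := by
  induction a using induction_on with
  | hr r => intro z hz; rw [algebraMap_smul]; exact N.smul_mem r hz
  | hc k => exact hc k
  | hs s => exact hs s
  | hadd a b ha hb => intro z hz; rw [add_smul]; exact N.add_mem (ha z hz) (hb z hz)
  | hmul a b ha hb => intro z hz; rw [mul_smul]; exact ha _ (hb z hz)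

variable (F n) in
/-- The subspaces spanned by the products `c_{k_1} ⋯ c_{k_r} s` with `m > k_1 > ⋯ > k_r`. -/
noncomputable def cliffordFiltration : ℕ → Submodule F (Y F n)
  | 0 => Submodule.span F (Set.range perm)
  | m + 1 => if h : m < n then cliffordFiltration m ⊔
      (cliffordFiltration m).map (LinearMap.mulLeft F (c ⟨m, h⟩)) else cliffordFiltration m

theorem cliffordFiltration_finite (m : ℕ) : Module.Finite F (cliffordFiltration F n m) := by
  induction m with
  | zero => exact FiniteDimensional.span_of_finite F (Set.finite_range _)
  | succ m ih =>
    by_cases h : m < n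
    · rw [cliffordFiltration, dif_pos h]
      infer_instance
    · rw [cliffordFiltration, dif_neg h]
      exact ih

theorem cliffordFiltration_le_succ (m : ℕ) :
    cliffordFiltration F n m ≤ cliffordFiltration F n (m + 1) := by
  conv_rhs => rw [cliffordFiltration]
  split_ifs
  · exact le_sup_left
  · exact le_rfl

theorem cliffordFiltration_mono : Monotone (cliffordFiltration F n) :=
  monotone_nat_of_le_succ cliffordFiltration_le_succ

theorem c_mul_mem_cliffordFiltration (k : Fin n) (m : ℕ) (hk : (k : ℕ) < m) :
    ∀ a ∈ cliffordFiltration F n m, c k * a ∈ cliffordFiltration F n m := by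
  induction m with
  | zero => omega
  | succ m ih =>
    have hle := cliffordFiltration_le_succ (F := F) (n := n) m
    by_cases h : m < n
    · have hdef : cliffordFiltration F n (m + 1) = cliffordFiltration F n m ⊔
        (cliffordFiltration F n m).map (LinearMap.mulLeft F (c ⟨m, h⟩)) := by
        rw [cliffordFiltration, dif_pos h]
      have hcm : ∀ a ∈ cliffordFiltration F n m,
          c ⟨m, h⟩ * a ∈ cliffordFiltration F n (m + 1) := fun a ha => by
        rw [hdef]
        exact Submodule.mem_sup_right (Submodule.mem_map_of_mem ha)
      intro a ha
      rw [hdef] at ha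
      obtain ⟨d, hd, b', hb', rfl⟩ := Submodule.mem_sup.1 ha
      obtain ⟨b, hb, rfl⟩ := Submodule.mem_map.1 hb'
      rw [mul_add, LinearMap.mulLeft_apply]
      rcases (Nat.lt_succ_iff.1 hk).eq_or_lt with hkm | hkm
      · have hkm : k = ⟨m, h⟩ := Fin.ext hkm
        subst hkm
        rw [c_mul_self_mul]
        exact add_mem (hcm d hd) (hle hb)
      · rw [c_mul_c_mul_c _ _ (by rw [ne_eq, Fin.ext_iff]; exact hkm.ne)]
        exact add_mem (hle (ih hkm d hd)) (neg_mem (hcm _ (ih hkm b hb)))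
    · intro a ha
      have hdef : cliffordFiltration F n (m + 1) = cliffordFiltration F n m := by
        rw [cliffordFiltration, dif_neg h]
      rw [hdef] at ha ⊢
      exact ih (by have := k.2; omega) a ha

/-- The image lies in the last step of the filtration rather than in step `m`, because a permutation
may turn `c_m` into a generator with a larger index. -/
theorem perm_mul_mem_cliffordFiltration (s : Equiv.Perm (Fin n)) (m : ℕ) (hm : m ≤ n) :
    ∀ a ∈ cliffordFiltration F n m, perm s * a ∈ cliffordFiltration F n n := by
  induction m with
  | zero =>
    intro a ha
    apply cliffordFiltration_mono (Nat.zero_le n)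
    induction ha using Submodule.span_induction with
    | mem x hx =>
      obtain ⟨t, rfl⟩ := hx
      rw [perm_mul]
      exact Submodule.subset_span ⟨_, rfl⟩
    | zero => simp
    | add x y _ _ hx hy => rw [mul_add]; exact add_mem hx hy
    | smul r x _ hx => rw [mul_smul_comm]; exact Submodule.smul_mem _ r hx
  | succ m ih =>
    intro a ha
    rw [cliffordFiltration, dif_pos (by omega)] at ha
    obtain ⟨d, hd, b', hb', rfl⟩ := Submodule.mem_sup.1 ha
    obtain ⟨b, hb, rfl⟩ := Submodule.mem_map.1 hb'
    rw [mul_add, LinearMap.mulLeft_apply, ← mul_assoc, perm_mul_c, mul_assoc]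
    exact add_mem (ih (by omega) d hd)
      (c_mul_mem_cliffordFiltration _ n (s _).2 _ (ih (by omega) b hb))

/-- The last step of the filtration contains 1 and is stable under left multiplication by the
generators. Only a finite spanning set is needed, to make irreducible modules finite dimensional;
its linear independence plays no role. -/
instance Y.finite : Module.Finite F (Y F n) := by
  have h : cliffordFiltration F n n = ⊤ := by
    rw [eq_top_iff]
    intro a _
    have h1 : (1 : Y F n) ∈ cliffordFiltration F n n :=
      cliffordFiltration_mono (Nat.zero_le n) (Submodule.subset_span ⟨1, perm_one⟩)
    have := smul_mem_of_generators (cliffordFiltration F n n)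
      (fun k z hz => c_mul_mem_cliffordFiltration k n k.2 z hz)
      (fun s z hz => perm_mul_mem_cliffordFiltration s n le_rfl z hz) a 1 h1
    rwa [smul_eq_mul, mul_one] at this
  have := cliffordFiltration_finite (F := F) (n := n) n
  rw [h] at this
  exact Module.Finite.equiv (Submodule.topEquiv (R := F) (M := Y F n))

end Relations

end HeckeClifford

/-! ### The Coxeter presentation of the symmetric group -/

section Coxeter

variable {G : Type*} [Group G]

/-- The relations between the Coxeter generators `σ 0, …, σ (n - 1)` of the symmetric group on
`n + 1` letters. -/
structure IsCoxeterFamily (σ : ℕ → G) (n : ℕ) : Prop where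
  mul_self : ∀ i < n, σ i * σ i = 1
  comm : ∀ i j, j < n → i + 1 < j → σ i * σ j = σ j * σ i
  braid : ∀ i, i + 1 < n → σ i * σ (i + 1) * σ i = σ (i + 1) * σ i * σ (i + 1)

theorem IsCoxeterFamily.mono {σ : ℕ → G} {m n : ℕ} (h : IsCoxeterFamily σ n) (hmn : m ≤ n) :
    IsCoxeterFamily σ m :=
  ⟨fun i hi => h.mul_self i (by omega), fun i j hj hij => h.comm i j (by omega) hij,
    fun i hi => h.braid i (by omega)⟩

/-- The products `σ (n - 1) σ (n - 2) ⋯ σ (n - p)`, in reverse order. -/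
def descendingProd (σ : ℕ → G) (n : ℕ) : ℕ → G
  | 0 => 1
  | p + 1 => σ (n - (p + 1)) * descendingProd σ n p

theorem descendingProd_comm {σ : ℕ → G} {n : ℕ} (h : IsCoxeterFamily σ n) (k p : ℕ)
    (hkp : k + 1 + p < n) : σ k * descendingProd σ n p = descendingProd σ n p * σ k := by
  induction p with
  | zero => simp [descendingProd]
  | succ p ih =>
    rw [descendingProd, ← mul_assoc, h.comm k (n - (p + 1)) (by omega) (by omega), mul_assoc,
      ih (by omega), mul_assoc]

/-- The letter `σ k` commutes with the factors of index below `k - 1`, becomes `σ (k - 1)` by the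
braid relation, and then commutes with the rest. -/
theorem descendingProd_shift {σ : ℕ → G} {n : ℕ} (h : IsCoxeterFamily σ n) (k p : ℕ) (hp : p ≤ n)
    (hk : n - p < k) (hkn : k < n) :
    σ k * descendingProd σ n p = descendingProd σ n p * σ (k - 1) := by
  induction p with
  | zero => omega
  | succ p ih =>
    rcases Nat.lt_or_ge (n - p) k with hlt | hge
    · rw [descendingProd, ← mul_assoc, ← h.comm (n - (p + 1)) k hkn (by omega), mul_assoc,
        ih (by omega) hlt, mul_assoc]
    · obtain ⟨p, rfl⟩ : ∃ q, p = q + 1 := ⟨p - 1, by omega⟩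
      have e1 : n - (p + 1) = k := by omega
      have e2 : n - (p + 1 + 1) = k - 1 := by omega
      have hb := h.braid (k - 1) (by omega)
      rw [show k - 1 + 1 = k by omega] at hb
      rw [descendingProd, descendingProd, e1, e2, ← mul_assoc, ← mul_assoc, ← hb, mul_assoc,
        descendingProd_comm h (k - 1) p (by omega)]
      simp only [mul_assoc]

/-- Descending products serve as coset representatives: a generator multiplied from the left
lengthens the product, shortens it, or passes through it into the group on fewer generators. -/
theorem exists_descendingProd_mul {σ : ℕ → G} {n : ℕ} (h : IsCoxeterFamily σ (n + 1)) (x : G)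
    (hx : x ∈ Submonoid.closure (σ '' Set.Iio (n + 1))) :
    ∃ p ≤ n + 1, ∃ y ∈ Submonoid.closure (σ '' Set.Iio n), x = descendingProd σ (n + 1) p * y := by
  induction hx using Submonoid.closure_induction_left with
  | one => exact ⟨0, by omega, 1, one_mem _, by simp [descendingProd]⟩
  | mul_left s hs x _ ih =>
    obtain ⟨k, hk, rfl⟩ := hs
    rw [Set.mem_Iio] at hk
    obtain ⟨p, hp, y, hy, rfl⟩ := ih
    have hgen : ∀ j < n, σ j ∈ Submonoid.closure (σ '' Set.Iio n) := fun j hj =>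
      Submonoid.subset_closure ⟨j, hj, rfl⟩
    rcases lt_trichotomy (k + p) n with hlt | heq | hgt
    · exact ⟨p, hp, σ k * y, mul_mem (hgen k (by omega)) hy, by
        rw [← mul_assoc, descendingProd_comm h k p (by omega), mul_assoc]⟩
    · refine ⟨p + 1, by omega, y, hy, ?_⟩
      rw [descendingProd, show n + 1 - (p + 1) = k by omega, mul_assoc]
    · rcases Nat.lt_or_ge (n + 1 - p) k with h1 | h1
      · exact ⟨p, hp, σ (k - 1) * y, mul_mem (hgen _ (by omega)) hy, by
          rw [← mul_assoc, descendingProd_shift h k p hp h1 hk, mul_assoc]⟩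
      · obtain ⟨p, rfl⟩ : ∃ q, p = q + 1 := ⟨p - 1, by omega⟩
        refine ⟨p, by omega, y, hy, ?_⟩
        rw [descendingProd, show n + 1 - (p + 1) = k by omega, ← mul_assoc, ← mul_assoc,
          h.mul_self k hk, one_mul]

/-- The passage from `n` to `n + 1` generators multiplies the order by at most `n + 2`, the number
of descending products. -/
theorem encard_closure_le_factorial {σ : ℕ → G} {n : ℕ} (h : IsCoxeterFamily σ n) :
    (Submonoid.closure (σ '' Set.Iio n) : Set G).encard ≤ (n + 1).factorial := by
  induction n with
  | zero => simp
  | succ n ih =>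
    have ih := ih (h.mono (Nat.le_succ n))
    set H : Set G := (Submonoid.closure (σ '' Set.Iio n) : Set G) with hH
    have hfin : H.Finite := Set.finite_of_encard_le_coe ih
    have hsub : (Submonoid.closure (σ '' Set.Iio (n + 1)) : Set G) ⊆
        (fun x : ℕ × G => descendingProd σ (n + 1) x.1 * x.2) ''
          ((Finset.range (n + 2) : Set ℕ) ×ˢ H) := by
      intro x hx
      obtain ⟨p, hp, y, hy, rfl⟩ := exists_descendingProd_mul h x hx
      exact ⟨(p, y), ⟨by simp; omega, hy⟩, rfl⟩
    refine (Set.encard_le_encard hsub).trans ((Set.encard_image_le _ _).trans ?_)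
    rw [Set.encard_prod, Set.encard_coe_eq_coe_finsetCard, Finset.card_range,
      Nat.factorial_succ (n + 1), Nat.cast_mul]
    gcongr

theorem adjacentSwap_isCoxeterFamily (n : ℕ) (τ : ℕ → Equiv.Perm (Fin (n + 1)))
    (hτ : ∀ i (h : i < n), τ i = Equiv.swap (Fin.castSucc ⟨i, h⟩) (Fin.succ ⟨i, h⟩)) :
    IsCoxeterFamily τ n where
  mul_self i hi := by rw [hτ i hi, Equiv.swap_mul_self]
  comm i j hj hij := by
    rw [hτ i (by omega), hτ j hj]
    refine (Equiv.Perm.disjoint_swap_swap ?_).commute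
    simp [Fin.ext_iff]
    omega
  braid i hi := by
    rw [hτ i (by omega), hτ (i + 1) hi]
    have e : Fin.succ (⟨i, by omega⟩ : Fin n) = Fin.castSucc ⟨i + 1, hi⟩ := by ext; simp
    rw [e]
    set a : Fin (n + 1) := Fin.castSucc ⟨i, by omega⟩
    set b : Fin (n + 1) := Fin.castSucc ⟨i + 1, hi⟩
    set d : Fin (n + 1) := Fin.succ ⟨i + 1, hi⟩
    have hab : a ≠ b := by simp [a, b, Fin.ext_iff]
    have had : a ≠ d := by simp [a, d, Fin.ext_iff]; omega
    have hbd : b ≠ d := by simp [b, d, Fin.ext_iff]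
    rw [Equiv.swap_mul_swap_mul_swap hab had, Equiv.swap_comm a b, Equiv.swap_comm b d,
      Equiv.swap_mul_swap_mul_swap hbd.symm had.symm, Equiv.swap_comm]

/-- The symmetric group is presented by the Coxeter relations. -/
theorem exists_perm_hom_of_isCoxeterFamily {n : ℕ} (σ : ℕ → G) (h : IsCoxeterFamily σ n) :
    ∃ f : Equiv.Perm (Fin (n + 1)) →* G,
      ∀ i : Fin n, f (Equiv.swap i.castSucc i.succ) = σ i := by
  classical
  let τ : ℕ → Equiv.Perm (Fin (n + 1)) := fun i =>
    if h : i < n then Equiv.swap (Fin.castSucc ⟨i, h⟩) (Fin.succ ⟨i, h⟩) else 1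
  have hτ : IsCoxeterFamily τ n := adjacentSwap_isCoxeterFamily n τ fun i h => dif_pos h
  have hτi : ∀ i : Fin n, τ i = Equiv.swap i.castSucc i.succ := fun i => dif_pos i.2
  -- The pairs `(τ i, σ i)` form a Coxeter family too, so they generate at most `(n + 1)!` elements.
  -- Since these project onto the symmetric group, the projection is bijective, and the submonoid is
  -- the graph of the desired homomorphism.
  let ρ : ℕ → Equiv.Perm (Fin (n + 1)) × G := fun i => (τ i, σ i)
  have hρ : IsCoxeterFamily ρ n :=
    ⟨fun i hi => Prod.ext (hτ.mul_self i hi) (h.mul_self i hi),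
      fun i j hj hij => Prod.ext (hτ.comm i j hj hij) (h.comm i j hj hij),
      fun i hi => Prod.ext (hτ.braid i hi) (h.braid i hi)⟩
  let H := Submonoid.closure (ρ '' Set.Iio n)
  have hcard := encard_closure_le_factorial hρ
  have hfin : Finite H := Set.finite_of_encard_le_coe hcard
  let pr : H →* Equiv.Perm (Fin (n + 1)) := (MonoidHom.fst _ _).comp H.subtype
  have hsurj : Function.Surjective pr := by
    have : MonoidHom.mrange pr = ⊤ := by
      rw [eq_top_iff, ← Equiv.Perm.mclosure_swap_castSucc_succ, Submonoid.closure_le]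
      rintro _ ⟨i, rfl⟩
      exact ⟨⟨ρ i, Submonoid.subset_closure ⟨i, i.2, rfl⟩⟩, by simp [pr, ρ, hτi]⟩
    exact MonoidHom.mrange_eq_top.1 this
  have hcard' : Nat.card H ≤ Nat.card (Equiv.Perm (Fin (n + 1))) := by
    rw [Nat.card_eq_fintype_card (α := Equiv.Perm _), Fintype.card_perm, Fintype.card_fin]
    have := ENat.toNat_le_toNat hcard (by simp)
    rw [ENat.toNat_natCast] at this
    exact this
  have hbij : Function.Bijective pr :=
    (Nat.bijective_iff_surjective_and_card pr).2
      ⟨hsurj, le_antisymm hcard' (Nat.card_le_card_of_surjective pr hsurj)⟩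
  let e : H ≃* Equiv.Perm (Fin (n + 1)) := MulEquiv.ofBijective pr hbij
  refine ⟨(MonoidHom.snd _ _).comp (H.subtype.comp e.symm.toMonoidHom), fun i => ?_⟩
  have : e.symm (Equiv.swap i.castSucc i.succ) =
      ⟨ρ i, Submonoid.subset_closure ⟨i, i.2, rfl⟩⟩ := by
    rw [MulEquiv.symm_apply_eq]
    simp [e, pr, ρ, hτi]
  change (e.symm (Equiv.swap i.castSucc i.succ)).1.2 = σ i
  rw [this]

end Coxeter

/-! ### Clifford generators together with operators of prescribed squares -/

set_option linter.unusedSimpArgs false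

/-- A `ℤ/2`-graded vector space (with parity operator `P`), odd Clifford operators `C b` and even
operators `X b` that satisfy the relations of `c_k` and `L_k` on the weight space of weight `a`. -/
structure WeightRep (F : Type u) [Field F] (ι : Type v) (a : ι → F) where
  V : Type w
  [addCommGroup : AddCommGroup V]
  [module : Module F V]
  P : Module.End F V
  C : ι → Module.End F V
  X : ι → Module.End F V
  P_mul_self : P * P = 1
  P_mul_C : ∀ b, P * C b = -(C b * P)
  P_mul_X : ∀ b, P * X b = X b * P
  C_mul_self : ∀ b, C b * C b = 1
  C_mul_C : ∀ b b', b ≠ b' → C b * C b' = -(C b' * C b)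
  C_mul_X_self : ∀ b, C b * X b = -(X b * C b)
  C_mul_X : ∀ b b', b ≠ b' → C b * X b' = X b' * C b
  X_mul_X : ∀ b b', X b * X b' = X b' * X b
  X_mul_self : ∀ b, X b * X b = a b • 1
  X_eq_zero : ∀ b, a b = 0 → X b = 0

namespace WeightRep

attribute [instance] WeightRep.addCommGroup WeightRep.module

variable {F : Type u} [Field F] {ι : Type v} {a : ι → F}

/-- `f` commutes with the operators `C b` and `X b`. -/
structure IsHom (R : WeightRep.{u, v, w} F ι a) (R' : WeightRep.{u, v, w'} F ι a)
    (f : R.V →ₗ[F] R'.V) : Prop where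
  C : ∀ b v, f (R.C b v) = R'.C b (f v)
  X : ∀ b v, f (R.X b v) = R'.X b (f v)

/-- A subspace stable under all operators. -/
structure IsStable (R : WeightRep.{u, v, w} F ι a) (N : Submodule F R.V) : Prop where
  P : ∀ v ∈ N, R.P v ∈ N
  C : ∀ b, ∀ v ∈ N, R.C b v ∈ N
  X : ∀ b, ∀ v ∈ N, R.X b v ∈ N

variable (R : WeightRep.{u, v, w} F ι a)

theorem C_C_self (b : ι) (m : Module.End F R.V) : R.C b * (R.C b * m) = m := by
  rw [← mul_assoc, R.C_mul_self, one_mul]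

theorem C_C {b b' : ι} (h : b ≠ b') (m : Module.End F R.V) :
    R.C b * (R.C b' * m) = -(R.C b' * (R.C b * m)) := by
  rw [← mul_assoc, R.C_mul_C b b' h, neg_mul, mul_assoc]

theorem C_X_self (b : ι) (m : Module.End F R.V) :
    R.C b * (R.X b * m) = -(R.X b * (R.C b * m)) := by
  rw [← mul_assoc, R.C_mul_X_self b, neg_mul, mul_assoc]

theorem C_X {b b' : ι} (h : b ≠ b') (m : Module.End F R.V) :
    R.C b * (R.X b' * m) = R.X b' * (R.C b * m) := by
  rw [← mul_assoc, R.C_mul_X b b' h, mul_assoc]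

theorem X_X (b b' : ι) (m : Module.End F R.V) : R.X b * (R.X b' * m) = R.X b' * (R.X b * m) := by
  rw [← mul_assoc, R.X_mul_X b b', mul_assoc]

theorem X_X_self (b : ι) (m : Module.End F R.V) : R.X b * (R.X b * m) = a b • m := by
  rw [← mul_assoc, R.X_mul_self, smul_mul_assoc, one_mul]

theorem P_C (b : ι) (m : Module.End F R.V) : R.P * (R.C b * m) = -(R.C b * (R.P * m)) := by
  rw [← mul_assoc, R.P_mul_C b, neg_mul, mul_assoc]

/-- The numerator `X b + X b' + C b C b' (X b - X b')` of `-xi b b'`. -/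
def xiNum (b b' : ι) : Module.End F R.V :=
  R.X b + R.X b' + R.C b * (R.C b' * (R.X b - R.X b'))

/-- The operator `Ξ` for the labels `b`, `b'`. -/
def xi (b b' : ι) : Module.End F R.V := -((a b - a b')⁻¹ • R.xiNum b b')

variable {R} {b b' d : ι}

theorem xiNum_mul_C_left (h : b ≠ b') : R.xiNum b b' * R.C b = R.C b' * R.xiNum b b' := by
  simp only [xiNum, mul_add, add_mul, mul_sub, sub_mul, mul_assoc, R.C_mul_X_self, R.C_C_self,
    R.C_mul_X b b' h, R.C_mul_X b' b h.symm, R.C_C h.symm, mul_neg, neg_mul, R.C_X h,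
    R.C_X h.symm, R.C_X_self, neg_neg, R.C_mul_C b' b h.symm, R.C_mul_self, mul_one]
  abel

theorem xiNum_mul_C_right (h : b ≠ b') : R.xiNum b b' * R.C b' = R.C b * R.xiNum b b' := by
  simp only [xiNum, mul_add, add_mul, mul_sub, sub_mul, mul_assoc, R.C_mul_X_self, R.C_C_self,
    R.C_mul_X b b' h, R.C_mul_X b' b h.symm, R.C_C h.symm, mul_neg, neg_mul, R.C_X h,
    R.C_X h.symm, R.C_X_self, neg_neg, R.C_mul_C b' b h.symm, R.C_mul_self, mul_one]
  abel

theorem xiNum_mul_C (h : d ≠ b) (h' : d ≠ b') : R.xiNum b b' * R.C d = R.C d * R.xiNum b b' := by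
  simp only [xiNum, mul_add, add_mul, mul_sub, sub_mul, mul_assoc, R.C_mul_X d b h,
    R.C_mul_X d b' h', R.C_C h, R.C_C h', mul_neg, neg_neg, R.C_X h,
    R.C_X h']

/-- Divided by `-(a b - a b')`, this is the relation between `s_k` and `L_k`. It is the reason why
subtracting `Ξ_k` from `s_k` leaves an intertwiner. -/
theorem xiNum_mul_X_left (h : b ≠ b') :
    R.xiNum b b' * R.X b - R.X b' * R.xiNum b b' = (a b - a b') • (1 + R.C b * R.C b') := by
  simp only [xiNum, mul_add, add_mul, mul_sub, sub_mul, mul_assoc, R.X_mul_self,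
    R.C_mul_X b b' h, R.C_mul_X b' b h.symm, R.C_mul_X_self, R.X_mul_X b' b,
    mul_neg, neg_mul, R.C_X h, R.C_X h.symm, R.C_X_self, neg_neg, R.X_X_self, R.X_X b' b,
    sub_smul, mul_smul_comm, smul_add, mul_one]
  module

theorem xiNum_mul_X_right (h : b ≠ b') :
    R.xiNum b b' * R.X b' - R.X b * R.xiNum b b' = -((a b - a b') • (1 - R.C b * R.C b')) := by
  simp only [xiNum, mul_add, add_mul, mul_sub, sub_mul, mul_assoc, R.X_mul_self,
    R.C_mul_X b b' h, R.C_mul_X b' b h.symm, R.C_mul_X_self, R.X_mul_X b' b,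
    mul_neg, neg_mul, R.C_X h, R.C_X h.symm, R.C_X_self, neg_neg, R.X_X_self, R.X_X b' b,
    sub_smul, mul_smul_comm, smul_sub, mul_one]
  module

theorem xiNum_mul_X (h : d ≠ b) (h' : d ≠ b') : R.xiNum b b' * R.X d = R.X d * R.xiNum b b' := by
  simp only [xiNum, mul_add, add_mul, mul_sub, sub_mul, mul_assoc, R.X_mul_X b d, R.X_mul_X b' d,
    R.C_X h.symm, R.C_X h'.symm]

theorem P_mul_xiNum : R.P * R.xiNum b b' = R.xiNum b b' * R.P := by
  simp only [xiNum, mul_add, add_mul, mul_sub, sub_mul, mul_assoc, R.P_mul_X, R.P_C,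
    mul_neg, neg_neg]

theorem xiNum_swap (h : b ≠ b') : R.xiNum b' b = R.xiNum b b' := by
  simp only [xiNum, mul_sub, R.C_C h.symm]
  abel

/-- This is the origin of `Ω`: the square of `Ξ` is a scalar, and `Ω²` is what it lacks to 1. -/
theorem xiNum_mul_self (h : b ≠ b') :
    R.xiNum b b' * R.xiNum b b' = (2 * (a b + a b')) • 1 := by
  simp only [xiNum, mul_add, add_mul, mul_sub, sub_mul, mul_assoc, R.X_mul_self, R.C_C_self,
    R.C_mul_X b b' h, R.C_mul_X b' b h.symm, R.C_mul_X_self, R.X_mul_X b' b, R.C_C h.symm,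
    mul_neg, neg_mul, R.C_X h, R.C_X h.symm, R.C_X_self, neg_neg, R.X_X_self, R.X_X b' b,
    R.C_mul_C b' b h.symm, R.C_mul_self, mul_smul_comm, mul_one]
  module

variable {b₁ b₂ b₃ b₄ : ι}

theorem xiNum_commute (h13 : b₁ ≠ b₃) (h14 : b₁ ≠ b₄) (h23 : b₂ ≠ b₃) (h24 : b₂ ≠ b₄) :
    R.xiNum b₁ b₂ * R.xiNum b₃ b₄ = R.xiNum b₃ b₄ * R.xiNum b₁ b₂ := by
  have hX3 := R.xiNum_mul_X (b := b₁) (b' := b₂) h13.symm h23.symm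
  have hX4 := R.xiNum_mul_X (b := b₁) (b' := b₂) h14.symm h24.symm
  have hC3 := R.xiNum_mul_C (b := b₁) (b' := b₂) h13.symm h23.symm
  have hC4 := R.xiNum_mul_C (b := b₁) (b' := b₂) h14.symm h24.symm
  have c1 : Commute (R.xiNum b₁ b₂) (R.xiNum b₃ b₄) :=
    (Commute.add_right (Commute.add_right hX3 hX4)
      (Commute.mul_right hC3 (Commute.mul_right hC4 (Commute.sub_right hX3 hX4))))
  exact c1

/-- The braid anomaly of the operators `xiNum` when the first and third weight agree. -/
theorem xiNum_braid (h12 : b₁ ≠ b₂) (h13 : b₁ ≠ b₃) (h23 : b₂ ≠ b₃) (ha : a b₃ = a b₁) :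
    R.xiNum b₁ b₂ * R.xiNum b₂ b₃ * R.xiNum b₁ b₂ + R.xiNum b₂ b₃ * R.xiNum b₁ b₂ * R.xiNum b₂ b₃ =
      (2 * a b₁ + 6 * a b₂) • (R.X b₃ + R.X b₁ + R.C b₁ * (R.C b₃ * (R.X b₁ - R.X b₃))) := by
  -- All monomials are brought to a normal form with the `X` to the left of the `C` and the indices
  -- in the order `b₁`, `b₂`, `b₃`; the two sides are then compared as linear combinations.
  simp only [xiNum, mul_add, add_mul, mul_sub, sub_mul, mul_assoc, R.X_mul_self, R.C_C_self,
    R.C_mul_X _ _ h12, R.C_mul_X _ _ h12.symm, R.C_mul_X _ _ h13, R.C_mul_X _ _ h13.symm,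
    R.C_mul_X _ _ h23, R.C_mul_X _ _ h23.symm, R.C_mul_X_self, R.X_mul_X b₂ b₁, R.X_mul_X b₃ b₁,
    R.X_mul_X b₃ b₂, neg_mul, R.C_mul_C _ _ h12.symm,
    R.C_mul_C _ _ h13.symm, R.C_mul_C _ _ h23.symm, R.C_mul_self, smul_mul_assoc, R.C_C h12.symm, R.C_C h13.symm, R.C_C h23.symm,
    mul_neg, R.C_X h12, R.C_X h12.symm, R.C_X h13, R.C_X h13.symm, R.C_X h23, R.C_X h23.symm,
    R.C_X_self, neg_neg, R.X_X_self, R.X_X b₂ b₁, R.X_X b₃ b₁, R.X_X b₃ b₂,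
    mul_smul_comm, mul_one, ha]
  module

end WeightRep

/-! ### The regular module of a Clifford algebra -/

open scoped symmDiff

section Signs

variable {F : Type u} [Field F] {K : Type v} [DecidableEq K]

theorem neg_one_pow_card_symmDiff_singleton (S : Finset K) (l : K) :
    (-1 : F) ^ (S ∆ {l}).card = -(-1) ^ S.card := by
  by_cases h : l ∈ S
  · have e : S ∆ {l} = S.erase l := by
      ext x
      simp only [Finset.mem_symmDiff, Finset.mem_singleton, Finset.mem_erase]
      by_cases hx : x = l <;> simp [hx, h]
    rw [e, ← Finset.card_erase_add_one h, pow_succ]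
    ring
  · have e : S ∆ {l} = insert l S := by
      ext x
      simp only [Finset.mem_symmDiff, Finset.mem_singleton, Finset.mem_insert]
      by_cases hx : x = l <;> simp [hx, h]
    rw [e, Finset.card_insert_of_notMem h, pow_succ]
    ring

end Signs

namespace CliffordModel

variable {F : Type u} [Field F] {K : Type v} [LinearOrder K]

variable (F) in
/-- The sign `(-1) ^ #{j ∈ S | j < k}`. -/
def sgn (k : K) (S : Finset K) : F := (-1) ^ (S.filter (· < k)).card

theorem sgn_symmDiff_of_lt {k l : K} (h : l < k) (S : Finset K) :
    sgn F k (S ∆ {l}) = -sgn F k S := by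
  have e : (S ∆ {l}).filter (· < k) = (S.filter (· < k)) ∆ {l} := by
    ext x
    simp only [Finset.mem_filter, Finset.mem_symmDiff, Finset.mem_singleton]
    by_cases hx : x = l
    · subst hx; simp [h]
    · simp [hx]
  rw [sgn, e, neg_one_pow_card_symmDiff_singleton, sgn]

theorem sgn_symmDiff_of_le {k l : K} (h : k ≤ l) (S : Finset K) :
    sgn F k (S ∆ {l}) = sgn F k S := by
  have e : (S ∆ {l}).filter (· < k) = S.filter (· < k) := by
    ext x
    simp only [Finset.mem_filter, Finset.mem_symmDiff, Finset.mem_singleton]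
    by_cases hx : x = l
    · subst hx; simp [h]
    · simp [hx]
  rw [sgn, e, sgn]

theorem sgn_mul_self (k : K) (S : Finset K) : sgn F k S * sgn F k S = 1 := by
  rw [sgn, ← pow_add, ← two_mul, pow_mul, neg_one_sq, one_pow]

theorem symmDiff_singleton_self (S : Finset K) (k : K) : S ∆ {k} ∆ {k} = S := by
  rw [symmDiff_assoc, symmDiff_self, symmDiff_bot]

theorem symmDiff_singleton_comm (S : Finset K) (k l : K) : S ∆ {k} ∆ {l} = S ∆ {l} ∆ {k} :=
  symmDiff_right_comm _ _ _

theorem mem_symmDiff_singleton_self (S : Finset K) (k : K) : k ∈ S ∆ {k} ↔ k ∉ S := by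
  simp [Finset.mem_symmDiff]

theorem mem_symmDiff_singleton_of_ne {S : Finset K} {j k : K} (h : j ≠ k) :
    j ∈ S ∆ {k} ↔ j ∈ S := by
  simp [Finset.mem_symmDiff, h]

/-- Clifford generators acting on functions on the power set. -/
def cliff (k : K) : Module.End F (Finset K → F) where
  toFun v S := sgn F k S * v (S ∆ {k})
  map_add' v w := by ext; simp [mul_add]
  map_smul' r v := by ext; simp [mul_left_comm]

/-- The diagonal operator `±1` according to whether `k ∈ S`. -/
def diag (k : K) : Module.End F (Finset K → F) where
  toFun v S := if k ∈ S then -v S else v S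
  map_add' v w := by ext S; by_cases h : k ∈ S <;> simp [h, add_comm]
  map_smul' r v := by ext S; by_cases h : k ∈ S <;> simp [h]

/-- The parity operator. -/
def par : Module.End F (Finset K → F) where
  toFun v S := (-1) ^ S.card * v S
  map_add' v w := by ext; simp [mul_add]
  map_smul' r v := by ext; simp [mul_left_comm]

theorem cliff_apply (k : K) (v : Finset K → F) (S : Finset K) :
    cliff k v S = sgn F k S * v (S ∆ {k}) := rfl

theorem diag_apply (k : K) (v : Finset K → F) (S : Finset K) :
    diag k v S = if k ∈ S then -v S else v S := rfl

omit [LinearOrder K] in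
theorem par_apply (v : Finset K → F) (S : Finset K) : par v S = (-1) ^ S.card * v S := rfl

theorem cliff_mul_cliff_apply (k l : K) (h : k < l) (v : Finset K → F) (S : Finset K) :
    cliff k (cliff l v) S = -cliff l (cliff k v) S := by
  simp only [cliff_apply]
  rw [sgn_symmDiff_of_lt h, sgn_symmDiff_of_le h.le, symmDiff_singleton_comm]
  ring

theorem cliff_mul_cliff (k l : K) (h : k ≠ l) :
    (cliff k * cliff l : Module.End F (Finset K → F)) = -(cliff l * cliff k) := by
  ext1 v
  funext S
  rw [LinearMap.neg_apply, Pi.neg_apply, Module.End.mul_apply, Module.End.mul_apply]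
  rcases h.lt_or_gt with h | h
  · exact cliff_mul_cliff_apply k l h v S
  · rw [cliff_mul_cliff_apply l k h v S, neg_neg]

/-- The regular module of the Clifford algebra on `K`, with the diagonal operators for the
indices in `J`. -/
def model (F : Type u) [Field F] {K : Type v} [LinearOrder K] (J : Set K) [DecidablePred (· ∈ J)] :
    WeightRep.{u, v, max u v} F K (fun k => if k ∈ J then 1 else 0) where
  V := Finset K → F
  P := par
  C := cliff
  X k := if k ∈ J then diag k else 0
  P_mul_self := by
    ext1 v
    funext S
    simp only [Module.End.mul_apply, par_apply, Module.End.one_apply]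
    rw [← mul_assoc, ← pow_add, ← two_mul, pow_mul, neg_one_sq, one_pow, one_mul]
  P_mul_C b := by
    ext1 v
    funext S
    simp only [Module.End.mul_apply, par_apply, cliff_apply, LinearMap.neg_apply, Pi.neg_apply,
      neg_one_pow_card_symmDiff_singleton]
    ring
  P_mul_X b := by
    split_ifs
    · ext1 v
      funext S
      simp only [Module.End.mul_apply, par_apply, diag_apply]
      split_ifs <;> ring
    · simp
  C_mul_self b := by
    ext1 v
    funext S
    simp only [Module.End.mul_apply, cliff_apply, Module.End.one_apply]
    rw [sgn_symmDiff_of_le le_rfl, symmDiff_singleton_self, ← mul_assoc, sgn_mul_self, one_mul]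
  C_mul_C := cliff_mul_cliff
  C_mul_X_self b := by
    split_ifs
    · ext1 v
      funext S
      simp only [Module.End.mul_apply, cliff_apply, diag_apply, LinearMap.neg_apply, Pi.neg_apply,
        mem_symmDiff_singleton_self]
      by_cases h : b ∈ S <;> simp [h]
    · simp
  C_mul_X b b' hb := by
    split_ifs
    · ext1 v
      funext S
      simp only [Module.End.mul_apply, cliff_apply, diag_apply,
        mem_symmDiff_singleton_of_ne hb.symm]
      by_cases h : b' ∈ S <;> simp [h]
    · simp
  X_mul_X b b' := by
    split_ifs
    · ext1 v
      funext S
      simp only [Module.End.mul_apply, diag_apply]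
      split_ifs <;> rfl
    all_goals simp
  X_mul_self b := by
    split_ifs
    · ext1 v
      funext S
      simp only [Module.End.mul_apply, diag_apply, one_smul, Module.End.one_apply]
      split_ifs <;> simp
    · simp
  X_eq_zero b hb := by
    split_ifs at hb ⊢
    · exact absurd hb one_ne_zero
    · rfl

section Products

variable {A : Type*} [Ring A] (C : K → A)

/-- The product of the `C k`, `k ∈ S`, in increasing order. -/
def cliffProd (S : Finset K) : A := ((S.sort (· ≤ ·)).map C).prod

theorem cliffProd_empty : cliffProd C ∅ = 1 := by simp [cliffProd]

theorem cliffProd_insert {m : K} {S : Finset K} (h : ∀ x ∈ S, m < x) :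
    cliffProd C (insert m S) = C m * cliffProd C S := by
  rw [cliffProd, Finset.sort_insert (r := (· ≤ ·)) (fun b hb => (h b hb).le) fun hm => lt_irrefl m (h m hm),
    List.map_cons, List.prod_cons, cliffProd]

theorem symmDiff_singleton_of_notMem {k : K} {S : Finset K} (h : k ∉ S) : S ∆ {k} = insert k S := by
  ext x
  simp only [Finset.mem_symmDiff, Finset.mem_singleton, Finset.mem_insert]
  by_cases hx : x = k <;> simp [hx, h]

variable {C}

/-- The sign counts the factors of the ordered product that `C k` has to pass. The induction removes
the smallest element of `S`, so that only the position of `k` relative to it matters. -/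
theorem mul_cliffProd [Algebra F A] (h1 : ∀ k, C k * C k = 1)
    (h2 : ∀ k l, k ≠ l → C k * C l = -(C l * C k)) (S : Finset K) :
    ∀ k, C k * cliffProd C S = sgn F k S • cliffProd C (S ∆ {k}) := by
  induction S using Finset.induction_on_min with
  | empty =>
    intro k
    rw [symmDiff_singleton_of_notMem (by simp), cliffProd_insert C (by simp)]
    simp [sgn]
  | insert m S hm ih =>
    intro k
    have hmS : m ∉ S := fun h => lt_irrefl m (hm m h)
    have key : (insert m S : Finset K) = S ∆ {m} := (symmDiff_singleton_of_notMem hmS).symm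
    rcases lt_trichotomy k m with h | rfl | h
    · have hk : ∀ x ∈ insert m S, k < x := by
        intro x hx
        rcases Finset.mem_insert.1 hx with rfl | hx
        · exact h
        · exact h.trans (hm x hx)
      have hs : (insert m S).filter (· < k) = ∅ :=
        Finset.filter_false_of_mem fun x hx => (hk x hx).not_gt
      rw [symmDiff_singleton_of_notMem fun h => lt_irrefl k (hk k h), cliffProd_insert C hk, sgn, hs]
      simp
    · have hs : (insert k S).filter (· < k) = ∅ :=
        Finset.filter_false_of_mem fun x hx => by
          rcases Finset.mem_insert.1 hx with rfl | hx
          · exact lt_irrefl _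
          · exact (hm x hx).not_gt
      rw [cliffProd_insert C hm, ← mul_assoc, h1, one_mul, sgn, hs, key, symmDiff_singleton_self]
      simp
    · have hm' : ∀ x ∈ S ∆ {k}, m < x := by
        intro x hx
        rcases Finset.mem_symmDiff.1 hx with hx | hx
        · exact hm x hx.1
        · rw [Finset.mem_singleton.1 hx.1]; exact h
      have key' : (insert m S : Finset K) ∆ {k} = insert m (S ∆ {k}) := by
        rw [key, symmDiff_singleton_comm, symmDiff_singleton_of_notMem]
        exact fun h => lt_irrefl m (hm' m h)
      rw [cliffProd_insert C hm, ← mul_assoc, h2 k m h.ne', neg_mul, mul_assoc, ih k, key',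
        cliffProd_insert C hm', key, sgn_symmDiff_of_lt h, mul_smul_comm, neg_smul]

/-- The set `T` records which generators anticommute with `x`. It is a singleton when `x` is one of
the operators `X k`, and the whole index set when `x` is the parity operator. -/
theorem cliffProd_anticomm [Algebra F A] {x : A} {T : Finset K} (S : Finset K)
    (h : ∀ k ∈ S, x * C k = if k ∈ T then -(C k * x) else C k * x) :
    x * cliffProd C S = ((-1 : F) ^ (S ∩ T).card) • (cliffProd C S * x) := by
  induction S using Finset.induction_on_min with
  | empty => simp [cliffProd_empty]
  | insert m S hm ih =>
    have hmS : m ∉ S := fun h => lt_irrefl m (hm m h)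
    have ih := ih fun k hk => h k (Finset.mem_insert_of_mem hk)
    rw [cliffProd_insert C hm, ← mul_assoc, h m (by simp)]
    by_cases hT : m ∈ T
    · rw [if_pos hT, Finset.insert_inter_of_mem hT, Finset.card_insert_of_notMem (by simp [hmS]),
        neg_mul, mul_assoc, ih, mul_smul_comm, pow_succ, mul_neg_one, neg_smul, mul_assoc]
    · rw [if_neg hT, Finset.insert_inter_of_notMem hT, mul_assoc, ih, mul_smul_comm, mul_assoc]

end Products

variable {J : Set K} [DecidablePred (· ∈ J)] [Fintype K]

/-- The homomorphism from the model to another module defined by a highest vector `u`. -/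
noncomputable def ofHighest (R : WeightRep.{u, v, w} F K (fun k => if k ∈ J then 1 else 0))
    (u : R.V) : (Finset K → F) →ₗ[F] R.V :=
  ∑ S : Finset K, (LinearMap.proj S).smulRight (cliffProd R.C S u)

theorem ofHighest_apply (R : WeightRep.{u, v, w} F K (fun k => if k ∈ J then 1 else 0))
    (u : R.V) (v : Finset K → F) :
    ofHighest R u v = ∑ S : Finset K, v S • cliffProd R.C S u := by
  simp [ofHighest, LinearMap.sum_apply]

theorem ofHighest_single (R : WeightRep.{u, v, w} F K (fun k => if k ∈ J then 1 else 0))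
    (u : R.V) (S : Finset K) :
    ofHighest R u (Pi.single S 1) = cliffProd R.C S u := by
  rw [ofHighest_apply, Finset.sum_eq_single S]
  · simp
  · intro T _ hT; simp [hT]
  · simp

theorem ofHighest_cliff (R : WeightRep.{u, v, w} F K (fun k => if k ∈ J then 1 else 0))
    (u : R.V) (k : K) (v : Finset K → F) :
    ofHighest R u (cliff k v) = R.C k (ofHighest R u v) := by
  rw [ofHighest_apply, ofHighest_apply, map_sum]
  refine Finset.sum_equiv ⟨fun S => S ∆ {k}, fun S => S ∆ {k}, fun S => symmDiff_singleton_self S k,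
    fun S => symmDiff_singleton_self S k⟩ (by simp) fun S _ => ?_
  rw [map_smul, ← Module.End.mul_apply, Equiv.coe_fn_mk,
    mul_cliffProd (F := F) R.C_mul_self R.C_mul_C, LinearMap.smul_apply, symmDiff_singleton_self,
    sgn_symmDiff_of_le le_rfl, cliff_apply, smul_smul, mul_comm]

theorem ofHighest_diag (R : WeightRep.{u, v, w} F K (fun k => if k ∈ J then 1 else 0))
    (u : R.V) (k : K) (hu : R.X k u = u) (v : Finset K → F) :
    ofHighest R u (diag k v) = R.X k (ofHighest R u v) := by
  rw [ofHighest_apply, ofHighest_apply, map_sum]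
  refine Finset.sum_congr rfl fun S _ => ?_
  have h := cliffProd_anticomm (F := F) (C := R.C) (x := R.X k) (T := {k}) S fun l _ => by
    by_cases hl : l = k
    · subst hl; simp [R.C_mul_X_self]
    · simp [hl, R.C_mul_X l k hl]
  rw [map_smul, ← Module.End.mul_apply, h, LinearMap.smul_apply, Module.End.mul_apply, hu,
    diag_apply]
  by_cases hk : k ∈ S <;> simp [hk]

theorem ofHighest_par (R : WeightRep.{u, v, w} F K (fun k => if k ∈ J then 1 else 0))
    (u : R.V) (ε : F) (hu : R.P u = ε • u) (v : Finset K → F) :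
    R.P (ofHighest R u v) = ε • ofHighest R u (par v) := by
  rw [ofHighest_apply, ofHighest_apply, map_sum, Finset.smul_sum]
  refine Finset.sum_congr rfl fun S _ => ?_
  have h := cliffProd_anticomm (F := F) (C := R.C) (x := R.P) (T := Finset.univ) S fun l _ => by
    simp [R.P_mul_C]
  rw [map_smul, ← Module.End.mul_apply, h, LinearMap.smul_apply, Module.End.mul_apply, hu,
    par_apply, map_smul, smul_smul, smul_smul, smul_smul, Finset.inter_univ]
  congr 1
  ring

end CliffordModel

/-! ### Highest vectors and Schur's lemma for the Clifford model -/

set_option linter.unusedSectionVars false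

open scoped symmDiff

namespace WeightRep

variable {F : Type u} [Field F]

/-- The irreducible weight modules with their Schur lemma; `odd` tells whether there are odd
endomorphisms. -/
structure IsUniversal {ι : Type v} {a : ι → F} (R : WeightRep.{u, v, w} F ι a) (odd : Prop) :
    Prop where
  nontrivial : Nontrivial R.V
  irreducible : ∀ N, R.IsStable N → N = ⊥ ∨ N = ⊤
  even_hom : ∀ g, IsHom R R g → R.P * g = g * R.P → ∃ r : F, g = r • 1
  odd_hom_eq_zero : ¬ odd → ∀ g, IsHom R R g → R.P * g = -(g * R.P) → g = 0
  odd_hom : odd → ∃ η, η ≠ 0 ∧ IsHom R R η ∧ R.P * η = -(η * R.P) ∧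
    ∀ g, IsHom R R g → R.P * g = -(g * R.P) → ∃ r : F, g = r • η
  exists_hom : ∀ U : WeightRep.{u, v, w'} F ι a, Nontrivial U.V →
    ∃ f : R.V →ₗ[F] U.V, f ≠ 0 ∧ IsHom R U f ∧
      ∃ ε : F, (ε = 1 ∨ ε = -1) ∧ ∀ v, U.P (f v) = ε • f (R.P v)

/-- The vector is improved one index at a time. Either `u + X k u` is nonzero and fixed by the
involution `X k`, or `X k u = -u` and then `C k u` is fixed, as `C k` anticommutes with `X k`. Both
changes keep the earlier fixed-point conditions and keep a parity eigenvector. -/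
theorem exists_highest [NeZero (2 : F)] {K : Type v} {J : Set K} [DecidablePred (· ∈ J)]
    (R : WeightRep.{u, v, w} F K (fun k => if k ∈ J then 1 else 0)) {N : Submodule F R.V}
    (hN : R.IsStable N) (h0 : N ≠ ⊥) (s : Finset K) (hs : ↑s ⊆ J) :
    ∃ u ∈ N, u ≠ 0 ∧ (∃ ε : F, (ε = 1 ∨ ε = -1) ∧ R.P u = ε • u) ∧ ∀ k ∈ s, R.X k u = u := by
  classical
  have h2 : (2 : F) ≠ 0 := NeZero.ne _
  have hPP : ∀ v, R.P (R.P v) = v := fun v => LinearMap.congr_fun R.P_mul_self v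
  induction s using Finset.induction_on with
  | empty =>
    obtain ⟨v, hv, hv0⟩ := N.ne_bot_iff.1 h0
    by_cases h : v + R.P v = 0
    · refine ⟨v, hv, hv0, ⟨-1, Or.inr rfl, ?_⟩, by simp⟩
      rw [neg_one_smul]
      exact (neg_eq_of_add_eq_zero_right h).symm
    · exact ⟨v + R.P v, add_mem hv (hN.P v hv), h, ⟨1, Or.inl rfl, by
        rw [map_add, hPP, one_smul, add_comm]⟩, by simp⟩
  | insert k s hk ih =>
    obtain ⟨u, hu, hu0, ⟨ε, hε, hP⟩, hX⟩ := ih fun x hx => hs (by simp at hx ⊢; exact Or.inr hx)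
    have hkJ : k ∈ J := hs (by simp)
    have hXX : ∀ v, R.X k (R.X k v) = v := fun v => by
      have := LinearMap.congr_fun (R.X_mul_self k) v
      rw [if_pos hkJ, one_smul] at this
      exact this
    by_cases h : u + R.X k u = 0
    · have hu' : R.X k u = -u := (neg_eq_of_add_eq_zero_right h).symm
      refine ⟨R.C k u, hN.C k u hu, fun hc => hu0 ?_, ⟨-ε, by rcases hε with rfl | rfl <;> simp, ?_⟩,
        fun l hl => ?_⟩
      · have := LinearMap.congr_fun (R.C_mul_self k) u
        rw [Module.End.mul_apply, hc, map_zero] at this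
        exact this.symm
      · have := LinearMap.congr_fun (R.P_mul_C k) u
        rw [Module.End.mul_apply, LinearMap.neg_apply, Module.End.mul_apply, hP, map_smul] at this
        rw [this, neg_smul]
      · rcases eq_or_ne l k with rfl | hlk
        · have := LinearMap.congr_fun (R.C_mul_X_self l) u
          rw [Module.End.mul_apply, LinearMap.neg_apply, Module.End.mul_apply, hu', map_neg] at this
          exact (neg_injective this).symm
        · have := LinearMap.congr_fun (R.C_mul_X k l hlk.symm) u
          rw [Module.End.mul_apply, Module.End.mul_apply,
            hX l ((Finset.mem_insert.1 hl).resolve_left hlk)] at this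
          exact this.symm
    · refine ⟨_, add_mem hu (hN.X k u hu), h, ⟨ε, hε, ?_⟩, fun l hl => ?_⟩
      · have := LinearMap.congr_fun (R.P_mul_X k) u
        rw [Module.End.mul_apply, Module.End.mul_apply, hP, map_smul] at this
        rw [map_add, hP, this, smul_add]
      · rcases eq_or_ne l k with rfl | hlk
        · rw [map_add, hXX, add_comm]
        · have := LinearMap.congr_fun (R.X_mul_X l k) u
          rw [Module.End.mul_apply, Module.End.mul_apply,
            hX l ((Finset.mem_insert.1 hl).resolve_left hlk)] at this
          rw [map_add, hX l ((Finset.mem_insert.1 hl).resolve_left hlk), this]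

end WeightRep

namespace CliffordModel

open WeightRep

variable {F : Type u} [Field F] {K : Type v} [LinearOrder K]

theorem cliff_single {m : K} {S : Finset K} (h : ∀ x ∈ S, m < x) :
    cliff m (Pi.single S 1 : Finset K → F) = Pi.single (insert m S) 1 := by
  have hm : m ∉ S := fun hm => lt_irrefl m (h m hm)
  funext T
  rw [cliff_apply]
  by_cases hT : T = insert m S
  · subst hT
    have hs : (insert m S).filter (· < m) = ∅ :=
      Finset.filter_false_of_mem fun x hx => by
        rcases Finset.mem_insert.1 hx with rfl | hx
        · exact lt_irrefl _
        · exact (h x hx).not_gt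
    rw [sgn, hs, ← symmDiff_singleton_of_notMem hm, symmDiff_singleton_self]
    simp
  · have : T ∆ {m} ≠ S := by
      rintro rfl
      apply hT
      rw [← symmDiff_singleton_of_notMem hm, symmDiff_singleton_self]
    simp [this, hT]

theorem cliffProd_cliff_single (S : Finset K) :
    cliffProd (cliff (F := F)) S (Pi.single ∅ 1) = Pi.single S 1 := by
  induction S using Finset.induction_on_min with
  | empty => simp [cliffProd_empty]
  | insert m S hm ih =>
    rw [cliffProd_insert _ hm, Module.End.mul_apply, ih, cliff_single hm]

variable [Fintype K]

theorem eq_sum_cliffProd (v : Finset K → F) :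
    v = ∑ S, v S • cliffProd (cliff (F := F)) S (Pi.single ∅ 1) := by
  simp only [cliffProd_cliff_single]
  exact pi_eq_sum_univ' v

theorem cliffProd_mem {V : Type*} [AddCommGroup V] [Module F V] {C : K → Module.End F V}
    {N : Submodule F V} (hN : ∀ k, ∀ v ∈ N, C k v ∈ N) (S : Finset K) :
    ∀ v ∈ N, cliffProd C S v ∈ N := by
  induction S using Finset.induction_on_min with
  | empty => intro v hv; simpa [cliffProd_empty] using hv
  | insert m S hm ih =>
    intro v hv
    rw [cliffProd_insert _ hm, Module.End.mul_apply]
    exact hN m _ (ih v hv)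

theorem apply_cliffProd {V V' : Type*} [AddCommGroup V] [Module F V] [AddCommGroup V'] [Module F V']
    {C : K → Module.End F V} {C' : K → Module.End F V'} {f : V →ₗ[F] V'}
    (h : ∀ k v, f (C k v) = C' k (f v)) (S : Finset K) (v : V) :
    f (cliffProd C S v) = cliffProd C' S (f v) := by
  induction S using Finset.induction_on_min with
  | empty => simp [cliffProd_empty]
  | insert m S hm ih =>
    rw [cliffProd_insert _ hm, cliffProd_insert _ hm, Module.End.mul_apply, h, ih,
      Module.End.mul_apply]

variable {J : Set K} [DecidablePred (· ∈ J)]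

theorem apply_eq_zero_of_highest [NeZero (2 : F)] {v : Finset K → F}
    (hv : ∀ k ∈ J, (model F J).X k v = v) {S : Finset K} {k : K} (hk : k ∈ J) (hS : k ∈ S) :
    v S = 0 := by
  have := congrFun (hv k hk) S
  change (if k ∈ J then diag k else 0 : Module.End F (Finset K → F)) v S = v S at this
  rw [if_pos hk, diag_apply, if_pos hS] at this
  have h2 : (2 : F) * v S = 0 := by linear_combination -this
  exact (mul_eq_zero.1 h2).resolve_left (NeZero.ne _)

/-- A highest vector vanishes on every set that meets `J`. The complement of `J` has at most one
element, so only `∅` and one singleton remain; parity selects one of the two. -/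
theorem eq_of_highest_even [NeZero (2 : F)] (hJ : Jᶜ.Subsingleton) {v : Finset K → F}
    (hv : ∀ k ∈ J, (model F J).X k v = v) (hP : par v = v) : v = v ∅ • Pi.single ∅ 1 := by
  funext S
  by_cases hS : S = ∅
  · subst hS; simp
  simp only [Pi.smul_apply, Pi.single_apply, hS, if_false, smul_zero]
  by_cases hex : ∃ k ∈ S, k ∈ J
  · obtain ⟨k, hk, hkJ⟩ := hex
    exact apply_eq_zero_of_highest hv hkJ hk
  · push Not at hex
    have hc : S.card = 1 := le_antisymm
      (Finset.card_le_one.2 fun a ha b hb => hJ (hex a ha) (hex b hb))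
      (Finset.card_pos.2 (Finset.nonempty_iff_ne_empty.2 hS))
    have := congrFun hP S
    rw [par_apply, hc] at this
    have h2 : (2 : F) * v S = 0 := by linear_combination -this
    exact (mul_eq_zero.1 h2).resolve_left (NeZero.ne _)

theorem eq_zero_of_highest_odd [NeZero (2 : F)] (hJ : J = Set.univ) {v : Finset K → F}
    (hv : ∀ k ∈ J, (model F J).X k v = v) (hP : par v = -v) : v = 0 := by
  funext S
  by_cases hS : S = ∅
  · subst hS
    have := congrFun hP ∅
    rw [par_apply, Finset.card_empty, pow_zero, one_mul, Pi.neg_apply] at this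
    have h2 : (2 : F) * v ∅ = 0 := by linear_combination this
    exact (mul_eq_zero.1 h2).resolve_left (NeZero.ne _)
  · obtain ⟨k, hk⟩ := Finset.nonempty_iff_ne_empty.2 hS
    exact apply_eq_zero_of_highest hv (hJ ▸ Set.mem_univ k) hk

theorem eq_of_highest_odd [NeZero (2 : F)] (hJ : Jᶜ.Subsingleton) {κ : K} (hκ : κ ∉ J)
    {v : Finset K → F} (hv : ∀ k ∈ J, (model F J).X k v = v) (hP : par v = -v) :
    v = v {κ} • Pi.single {κ} 1 := by
  funext S
  by_cases hS : S = {κ}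
  · subst hS; simp
  simp only [Pi.smul_apply, Pi.single_apply, hS, if_false, smul_zero]
  rcases S.eq_empty_or_nonempty with rfl | ⟨k, hk⟩
  · have := congrFun hP ∅
    rw [par_apply, Finset.card_empty, pow_zero, one_mul, Pi.neg_apply] at this
    have h2 : (2 : F) * v ∅ = 0 := by linear_combination this
    exact (mul_eq_zero.1 h2).resolve_left (NeZero.ne _)
  · by_cases hex : ∃ k ∈ S, k ∈ J
    · obtain ⟨k, hk, hkJ⟩ := hex
      exact apply_eq_zero_of_highest hv hkJ hk
    · push Not at hex
      exact absurd (Finset.eq_singleton_iff_unique_mem.2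
        ⟨hJ (hex k hk) hκ ▸ hk, fun x hx => hJ (hex x hx) hκ⟩) hS

theorem par_single_empty : par (Pi.single ∅ 1 : Finset K → F) = Pi.single ∅ 1 := by
  funext S
  rw [par_apply]
  by_cases hS : S = ∅
  · subst hS; simp
  · simp [hS]

theorem par_single_singleton (κ : K) :
    par (Pi.single {κ} 1 : Finset K → F) = -Pi.single {κ} 1 := by
  funext S
  rw [par_apply]
  by_cases hS : S = {κ}
  · subst hS; simp
  · simp [hS]

theorem X_single_empty (k : K) (hk : k ∈ J) :
    (model F J).X k (Pi.single ∅ 1 : Finset K → F) = (Pi.single ∅ 1 : Finset K → F) := by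
  change (if k ∈ J then diag k else 0 : Module.End F (Finset K → F)) _ = _
  rw [if_pos hk]
  funext S
  rw [diag_apply]
  by_cases hS : S = ∅
  · subst hS; simp
  · simp [hS]

theorem X_single_singleton (k κ : K) (hk : k ∈ J) (hκ : κ ∉ J) :
    (model F J).X k (Pi.single {κ} 1 : Finset K → F) = (Pi.single {κ} 1 : Finset K → F) := by
  change (if k ∈ J then diag k else 0 : Module.End F (Finset K → F)) _ = _
  rw [if_pos hk]
  funext S
  rw [diag_apply]
  by_cases hS : S = {κ}
  · subst hS
    have : k ≠ κ := fun h => hκ (h ▸ hk)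
    simp [this]
  · simp [hS]

theorem isHom_ofHighest (R : WeightRep.{u, v, w} F K (fun k => if k ∈ J then 1 else 0)) (u : R.V)
    (hu : ∀ k ∈ J, R.X k u = u) : IsHom (model F J) R (ofHighest R u) where
  C b v := ofHighest_cliff R u b v
  X b v := by
    by_cases hb : b ∈ J
    · have : (model F J).X b = diag b := if_pos hb
      rw [this]
      exact ofHighest_diag R u b (hu b hb) v
    · rw [(model F J).X_eq_zero b (if_neg hb), R.X_eq_zero b (if_neg hb), LinearMap.zero_apply,
        LinearMap.zero_apply]
      exact map_zero (ofHighest R u)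

/-- The indicator of `∅` generates the model under the Clifford generators, so a homomorphism is
determined by its value there. -/
theorem eq_ofHighest {R : WeightRep.{u, v, w} F K (fun k => if k ∈ J then 1 else 0)}
    {g : (Finset K → F) →ₗ[F] R.V} (hg : IsHom (model F J) R g) :
    g = ofHighest R (g (Pi.single ∅ 1)) := by
  refine LinearMap.ext fun v => ?_
  rw [ofHighest_apply]
  conv_lhs => rw [eq_sum_cliffProd v]
  rw [map_sum]
  refine Finset.sum_congr rfl fun S _ => ?_
  rw [map_smul]
  exact congrArg (v S • ·) (apply_cliffProd (C := cliff) (C' := R.C) hg.C S _)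

theorem ofHighest_smul (R : WeightRep.{u, v, w} F K (fun k => if k ∈ J then 1 else 0)) (r : F)
    (u : R.V) : ofHighest R (r • u) = r • ofHighest R u := by
  refine LinearMap.ext fun v => ?_
  rw [LinearMap.smul_apply, ofHighest_apply, ofHighest_apply, Finset.smul_sum]
  exact Finset.sum_congr rfl fun S _ => by rw [map_smul, smul_comm]

theorem ofHighest_zero (R : WeightRep.{u, v, w} F K (fun k => if k ∈ J then 1 else 0)) :
    ofHighest R 0 = 0 := by
  rw [← zero_smul F (0 : R.V), ofHighest_smul, zero_smul]

theorem ofHighest_model_single_empty :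
    ofHighest (model F J) (Pi.single ∅ 1 : Finset K → F) = LinearMap.id := by
  symm
  exact eq_ofHighest (R := model F J) (g := LinearMap.id) ⟨fun _ _ => rfl, fun _ _ => rfl⟩

theorem ofHighest_single_empty (R : WeightRep.{u, v, w} F K (fun k => if k ∈ J then 1 else 0))
    (u : R.V) : ofHighest R u (Pi.single ∅ 1) = u := by
  rw [ofHighest_single, cliffProd_empty, Module.End.one_apply]

/-- A nonzero stable subspace contains a highest vector, which is, possibly after applying the `C κ`
without `X`, a multiple of the generator. Homomorphisms out of the model correspond to highest
vectors; in the model itself there is one even line of these, and one odd line exactly if such a `κ`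
exists. -/
theorem isUniversal_model [NeZero (2 : F)] (hJ : Jᶜ.Subsingleton) :
    IsUniversal.{u, v, max u v, w} (model F J) (Jᶜ.Nonempty) where
  nontrivial := inferInstanceAs (Nontrivial (Finset K → F))
  irreducible N hN := by
    by_contra! h
    obtain ⟨u, hu, hu0, ⟨ε, hε, hP⟩, hX⟩ := exists_highest (model F J) hN h.1 (Finset.univ.filter (· ∈ J))
      (by intro x; simp)
    have hX : ∀ k ∈ J, (model F J).X k u = u := fun k hk => hX k (by simpa using hk)
    have h1 : (Pi.single ∅ 1 : Finset K → F) ∈ N := by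
      rcases hε with rfl | rfl
      · rw [one_smul] at hP
        have he := eq_of_highest_even hJ hX hP
        have hne : (u : Finset K → F) ∅ ≠ 0 := fun h0 => hu0 (by rw [he, h0, zero_smul]; rfl)
        rw [he] at hu
        exact (N.smul_mem_iff hne).1 hu
      · rw [neg_one_smul] at hP
        by_cases hu' : J = Set.univ
        · exact absurd (eq_zero_of_highest_odd hu' hX hP) hu0
        · obtain ⟨κ, hκ⟩ := (Set.ne_univ_iff_exists_notMem J).1 hu'
          have he := eq_of_highest_odd hJ hκ hX hP
          have hne : (u : Finset K → F) {κ} ≠ 0 := fun h0 => hu0 (by rw [he, h0, zero_smul]; rfl)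
          rw [he] at hu
          have h2 := hN.C κ _ ((N.smul_mem_iff hne).1 hu)
          have h3 : (model F J).C κ (Pi.single {κ} 1 : Finset K → F) = (Pi.single ∅ 1 : Finset K → F) := by
            have : (model F J).C κ ((model F J).C κ (Pi.single ∅ 1 : Finset K → F)) =
              (Pi.single ∅ 1 : Finset K → F) :=
                LinearMap.congr_fun ((model F J).C_mul_self κ) (Pi.single ∅ 1 : Finset K → F)
            have h4 : (model F J).C κ (Pi.single ∅ 1 : Finset K → F) = (Pi.single {κ} 1 : Finset K → F) :=
              (cliff_single (by simp)).trans (by rw [insert_empty_eq])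
            rw [h4] at this
            exact this
          rwa [h3] at h2
    refine h.2 (eq_top_iff.2 fun v _ => ?_)
    have hv := eq_sum_cliffProd (F := F) v
    rw [hv]
    exact sum_mem fun S _ => N.smul_mem _ (cliffProd_mem hN.C S _ h1)
  even_hom g hg hP := by
    have hX : ∀ k ∈ J, (model F J).X k (g (Pi.single ∅ 1 : Finset K → F)) =
        g (Pi.single ∅ 1 : Finset K → F) := fun k hk =>
          (hg.X k _).symm.trans (congrArg g (X_single_empty k hk))
    have hp : par (g (Pi.single ∅ 1 : Finset K → F)) = g (Pi.single ∅ 1 : Finset K → F) := by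
      have := LinearMap.congr_fun hP (Pi.single ∅ 1 : Finset K → F)
      exact this.trans (congrArg g par_single_empty)
    have he := eq_of_highest_even hJ hX hp
    exact ⟨(g (Pi.single ∅ 1 : Finset K → F) : Finset K → F) ∅, (eq_ofHighest hg).trans
      ((congrArg (ofHighest (model F J)) he).trans ((ofHighest_smul _ _ _).trans
        (congrArg (_ • ·) ofHighest_model_single_empty)))⟩
  odd_hom_eq_zero hodd g hg hP := by
    have hX : ∀ k ∈ J, (model F J).X k (g (Pi.single ∅ 1 : Finset K → F)) =
        g (Pi.single ∅ 1 : Finset K → F) := fun k hk =>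
          (hg.X k _).symm.trans (congrArg g (X_single_empty k hk))
    have hp : par (g (Pi.single ∅ 1 : Finset K → F)) = -g (Pi.single ∅ 1 : Finset K → F) := by
      have := LinearMap.congr_fun hP (Pi.single ∅ 1 : Finset K → F)
      exact this.trans (congrArg (fun x => -g x) par_single_empty)
    rw [Set.not_nonempty_iff_eq_empty, Set.compl_empty_iff] at hodd
    have he := eq_zero_of_highest_odd hodd hX hp
    exact (eq_ofHighest hg).trans ((congrArg (ofHighest (model F J)) he).trans (ofHighest_zero _))
  odd_hom := by
    rintro ⟨κ, hκ⟩
    have hκX : ∀ k ∈ J, (model F J).X k (Pi.single {κ} 1 : Finset K → F) =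
      (Pi.single {κ} 1 : Finset K → F) := fun k hk => X_single_singleton k κ hk hκ
    refine ⟨ofHighest (model F J) (Pi.single {κ} 1 : Finset K → F), fun h0 => ?_,
      isHom_ofHighest _ _ hκX, ?_, fun g hg hP => ?_⟩
    · have := LinearMap.congr_fun h0 (Pi.single ∅ 1 : Finset K → F)
      have := (ofHighest_single_empty (model F J) (Pi.single {κ} 1 : Finset K → F)).symm.trans this
      have : (Pi.single {κ} 1 : Finset K → F) {κ} = 0 := congrFun this {κ}
      simp at this
    · ext1 v
      have := ofHighest_par (model F J) (Pi.single {κ} 1 : Finset K → F) (-1)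
        ((par_single_singleton κ).trans (neg_one_smul F _).symm) v
      exact this.trans (neg_one_smul F _)
    · have hX : ∀ k ∈ J, (model F J).X k (g (Pi.single ∅ 1 : Finset K → F)) =
          g (Pi.single ∅ 1 : Finset K → F) := fun k hk =>
          (hg.X k _).symm.trans (congrArg g (X_single_empty k hk))
      have hp : par (g (Pi.single ∅ 1 : Finset K → F)) = -g (Pi.single ∅ 1 : Finset K → F) := by
        have := LinearMap.congr_fun hP (Pi.single ∅ 1 : Finset K → F)
        exact this.trans (congrArg (fun x => -g x) par_single_empty)
      have he := eq_of_highest_odd hJ hκ hX hp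
      exact ⟨(g (Pi.single ∅ 1 : Finset K → F) : Finset K → F) {κ}, (eq_ofHighest hg).trans
        ((congrArg (ofHighest (model F J)) he).trans (ofHighest_smul _ _ _))⟩
  exists_hom U hU := by
    obtain ⟨u, -, hu0, ⟨ε, hε, hP⟩, hX⟩ := exists_highest U (N := ⊤)
      ⟨fun _ _ => trivial, fun _ _ _ => trivial, fun _ _ _ => trivial⟩ top_ne_bot
      (Finset.univ.filter (· ∈ J)) (by intro x; simp)
    refine ⟨ofHighest U u, fun h0 => hu0 ?_, isHom_ofHighest U u fun k hk => hX k (by simpa using hk),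
      ε, hε, fun v => ofHighest_par U u ε hP v⟩
    rw [← ofHighest_single_empty U u]
    exact LinearMap.congr_fun h0 _

end CliffordModel

/-! ### Pairing off Clifford generators of weight zero -/

namespace WeightRep

section Commute

variable {F : Type u} [Field F] {ι : Type v} {a : ι → F} (R : WeightRep.{u, v, w} F ι a)

theorem commute_C_CC {b b₁ b₂ : ι} (h₁ : b ≠ b₁) (h₂ : b ≠ b₂) :
    Commute (R.C b) (R.C b₁ * R.C b₂) := by
  rw [Commute, SemiconjBy, R.C_C h₁, R.C_mul_C b b₂ h₂, mul_neg, neg_neg, mul_assoc]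

theorem commute_X_CC {b b₁ b₂ : ι} (h₁ : b₁ ≠ b) (h₂ : b₂ ≠ b) :
    Commute (R.X b) (R.C b₁ * R.C b₂) :=
  Commute.mul_right (R.C_mul_X b₁ b h₁).symm (R.C_mul_X b₂ b h₂).symm

theorem commute_P_CC (b₁ b₂ : ι) : Commute R.P (R.C b₁ * R.C b₂) := by
  rw [Commute, SemiconjBy, R.P_C, R.P_mul_C, mul_neg, neg_neg, mul_assoc]

end Commute

section Pairing

variable {F : Type u} [Field F] {ι : Type v} {a : ι → F} {N Q : Type v'}
  (e : (N ⊕ Q) ⊕ Q ≃ ι) (s : N → F) (i : F)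

/-- The indices that carry a nonzero operator `X` after pairing. -/
def pairedSet (N Q : Type v') (s : N → F) : Set (N ⊕ Q) :=
  {x | Sum.elim (fun k => s k ≠ 0) (fun _ => True) x}

open Classical in
theorem pairedSet_inl {s : N → F} {k : N} :
    (if (Sum.inl k : N ⊕ Q) ∈ pairedSet N Q s then (1 : F) else 0) = if s k = 0 then 0 else 1 := by
  by_cases h : s k = 0 <;> simp [pairedSet, h]

open Classical in
theorem pairedSet_inr {s : N → F} {q : Q} :
    (if (Sum.inr q : N ⊕ Q) ∈ pairedSet N Q s then (1 : F) else 0) = 1 := by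
  simp [pairedSet]

variable {e s i}

open Classical in
/-- Pairs of Clifford generators `C, C'` with vanishing `X, X'` are turned into a single generator
`C` with `X = √-1 C C'`; the other `X` are normalized. -/
noncomputable def pair (U : WeightRep.{u, v, w} F ι a) (hs : ∀ k, a (e (.inl (.inl k))) = s k * s k)
    (hi : i * i = -1) :
    WeightRep.{u, v', w} F (N ⊕ Q) (fun k => if k ∈ pairedSet N Q s then 1 else 0) where
  V := U.V
  P := U.P
  C x := U.C (e (.inl x))
  X x := Sum.elim (fun k => (s k)⁻¹ • U.X (e (.inl (.inl k))))
    (fun q => i • (U.C (e (.inl (.inr q))) * U.C (e (.inr q)))) x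
  P_mul_self := U.P_mul_self
  P_mul_C b := U.P_mul_C _
  P_mul_X b := by
    rcases b with k | q
    · simp [U.P_mul_X]
    · simp only [Sum.elim_inr, mul_smul_comm, smul_mul_assoc, (U.commute_P_CC _ _).eq]
  C_mul_self b := U.C_mul_self _
  C_mul_C b b' h := U.C_mul_C _ _ (by simpa using h)
  C_mul_X_self b := by
    rcases b with k | q
    · simp [U.C_mul_X_self]
    · simp only [Sum.elim_inr, mul_smul_comm, smul_mul_assoc, U.C_C_self, mul_assoc,
        U.C_mul_C (e (.inr q)) (e (.inl (.inr q))) (by simp), mul_neg, smul_neg, neg_neg]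
  C_mul_X b b' h := by
    rcases b' with k | q
    · simp only [Sum.elim_inl, mul_smul_comm, smul_mul_assoc]
      rw [U.C_mul_X _ _ (by simpa using h)]
    · simp only [Sum.elim_inr, mul_smul_comm, smul_mul_assoc]
      rw [(U.commute_C_CC (by simpa using h) (by simp)).eq]
  X_mul_X b b' := by
    rcases b with k | q <;> rcases b' with k' | q'
    · simp only [Sum.elim_inl, mul_smul_comm, smul_mul_assoc, U.X_mul_X (e (.inl (.inl k)))]
      rw [smul_comm]
    · simp only [Sum.elim_inl, Sum.elim_inr, mul_smul_comm, smul_mul_assoc]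
      rw [(U.commute_X_CC (by simp) (by simp)).eq, smul_comm]
    · simp only [Sum.elim_inl, Sum.elim_inr, mul_smul_comm, smul_mul_assoc]
      rw [(U.commute_X_CC (by simp) (by simp)).eq, smul_comm]
    · rcases eq_or_ne q q' with rfl | h
      · rfl
      · simp only [Sum.elim_inr, mul_smul_comm, smul_mul_assoc]
        rw [(Commute.mul_left (U.commute_C_CC (by simpa using h) (by simp))
          (U.commute_C_CC (by simp) (by simpa using h)) :
          Commute (U.C (e (.inl (.inr q))) * U.C (e (.inr q)))
            (U.C (e (.inl (.inr q'))) * U.C (e (.inr q')))).eq]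
  X_mul_self b := by
    rcases b with k | q
    · rw [pairedSet_inl]
      simp only [Sum.elim_inl, mul_smul_comm, smul_mul_assoc, U.X_mul_self, hs, smul_smul]
      by_cases h : s k = 0
      · simp [h]
      · simp only [h, if_false]
        congr 1
        field_simp
    · rw [pairedSet_inr]
      simp only [Sum.elim_inr, mul_smul_comm, smul_mul_assoc, smul_smul, hi, mul_assoc,
        U.C_C (b := e (.inr q)) (b' := e (.inl (.inr q))) (by simp), U.C_mul_self, mul_neg,
        mul_one]
      simp
  X_eq_zero b hb := by
    rcases b with k | q
    · rw [pairedSet_inl] at hb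
      by_cases h : s k = 0
      · simp [h]
      · simp [h] at hb
    · rw [pairedSet_inr] at hb
      exact absurd hb one_ne_zero

open Classical in
/-- The inverse construction to `pair`. -/
noncomputable def unpair
    (R : WeightRep.{u, v', w} F (N ⊕ Q) (fun k => if k ∈ pairedSet N Q s then 1 else 0))
    (e : (N ⊕ Q) ⊕ Q ≃ ι) (hs : ∀ k, a (e (.inl (.inl k))) = s k * s k)
    (h1 : ∀ q, a (e (.inl (.inr q))) = 0) (h2 : ∀ q, a (e (.inr q)) = 0) (hi : i * i = -1) :
    WeightRep.{u, v, w} F ι a where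
  V := R.V
  P := R.P
  C b := Sum.elim (fun x => R.C x) (fun q => -(i • (R.C (.inr q) * R.X (.inr q)))) (e.symm b)
  X b := Sum.elim (Sum.elim (fun k => s k • R.X (.inl k)) (fun _ => 0)) (fun _ => 0) (e.symm b)
  P_mul_self := R.P_mul_self
  P_mul_C b := by
    obtain ⟨x | q, rfl⟩ := e.surjective b
    · simp [R.P_mul_C]
    · simp [mul_assoc, R.P_C, R.P_mul_X]
  P_mul_X b := by
    obtain ⟨(k | q) | q, rfl⟩ := e.surjective b <;> simp [R.P_mul_X]
  C_mul_self b := by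
    obtain ⟨x | q, rfl⟩ := e.surjective b
    · simp [R.C_mul_self]
    · simp only [Equiv.symm_apply_apply, Sum.elim_inr, neg_mul_neg, mul_smul_comm, smul_mul_assoc,
        smul_smul, hi, mul_assoc]
      rw [R.C_X_self]
      simp only [R.C_C_self, R.X_mul_self, pairedSet_inr]
      simp
  C_mul_C b b' h := by
    obtain ⟨x, rfl⟩ := e.surjective b
    obtain ⟨x', rfl⟩ := e.surjective b'
    have h : x ≠ x' := fun hx => h (by rw [hx])
    -- At the index `q` itself `C` commutes with the factor `C` and anticommutes with `X`; at any
    -- other index it is the other way round. Either way exactly one sign arises.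
    have key : ∀ (x : N ⊕ Q) (q : Q), R.C x * (R.C (.inr q) * R.X (.inr q)) =
        -(R.C (.inr q) * R.X (.inr q) * R.C x) := by
      intro x q
      by_cases hx : x = .inr q
      · subst hx
        rw [R.C_C_self, mul_assoc, ← neg_eq_iff_eq_neg.2 (R.C_mul_X_self (.inr q)), mul_neg,
          R.C_C_self, neg_neg]
      · rw [R.C_C hx, R.C_mul_X _ _ hx, mul_assoc]
    rcases x with x | q <;> rcases x' with x' | q'
    · simp only [Equiv.symm_apply_apply, Sum.elim_inl]
      exact R.C_mul_C _ _ (by simpa using h)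
    · simp only [Equiv.symm_apply_apply, Sum.elim_inl, Sum.elim_inr, mul_neg, neg_mul,
        mul_smul_comm, smul_mul_assoc, key, smul_neg, neg_neg]
    · simp only [Equiv.symm_apply_apply, Sum.elim_inl, Sum.elim_inr, mul_neg, neg_mul,
        mul_smul_comm, smul_mul_assoc, key, smul_neg, neg_neg]
    · have hq : (.inr q : N ⊕ Q) ≠ .inr q' := by simpa using h
      simp only [Equiv.symm_apply_apply, Sum.elim_inr, neg_mul_neg, mul_smul_comm, smul_mul_assoc,
        mul_assoc]
      rw [← mul_assoc (R.X (.inr q)), ← R.C_mul_X _ _ hq.symm, ← mul_assoc (R.X (.inr q')),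
        ← R.C_mul_X _ _ hq]
      simp only [mul_assoc, R.C_C hq, smul_neg, R.X_mul_X (.inr q) (.inr q')]
  C_mul_X_self b := by
    obtain ⟨(k | q) | q, rfl⟩ := e.surjective b <;> simp [R.C_mul_X_self]
  C_mul_X b b' h := by
    obtain ⟨x, rfl⟩ := e.surjective b
    obtain ⟨(k | q) | q, rfl⟩ := e.surjective b'
    · have h : x ≠ .inl (.inl k) := fun hx => h (by rw [hx])
      rcases x with x | q
      · simp [R.C_mul_X x (.inl k) (by simpa using h)]
      · simp [mul_assoc, R.X_mul_X (.inr q) (.inl k), R.C_X (b := .inr q) (b' := .inl k) (by simp),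
          smul_comm (s k) i]
    · simp
    · simp
  X_mul_X b b' := by
    obtain ⟨(k | q) | q, rfl⟩ := e.surjective b <;> obtain ⟨(k' | q') | q', rfl⟩ := e.surjective b'
    all_goals simp
    rw [R.X_mul_X, smul_comm]
  X_mul_self b := by
    obtain ⟨(k | q) | q, rfl⟩ := e.surjective b
    · simp only [Equiv.symm_apply_apply, Sum.elim_inl, mul_smul_comm, smul_mul_assoc, smul_smul,
        R.X_mul_self, pairedSet_inl, hs]
      by_cases h : s k = 0 <;> simp [h]
    · simp [h1]
    · simp [h2]
  X_eq_zero b hb := by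
    obtain ⟨(k | q) | q, rfl⟩ := e.surjective b
    · rw [hs, mul_self_eq_zero] at hb
      simp [hb]
    · simp
    · simp

open Classical in
-- The operators before and after pairing are expressible through each other, so stable subspaces
-- and endomorphisms are the same. A homomorphism into `U` is obtained from one into `pair U`. Where
-- `s k = 0`, the `X` vanish on both sides, so dividing by `s k` is harmless.
theorem isUniversal_unpair {odd : Prop}
    (R : WeightRep.{u, v', w} F (N ⊕ Q) (fun k => if k ∈ pairedSet N Q s then 1 else 0))
    (hs : ∀ k, a (e (.inl (.inl k))) = s k * s k)
    (h1 : ∀ q, a (e (.inl (.inr q))) = 0) (h2 : ∀ q, a (e (.inr q)) = 0) (hi : i * i = -1)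
    (hR : IsUniversal.{u, v', w, w'} R odd) :
    IsUniversal.{u, v, w, w'} (unpair R e hs h1 h2 hi) odd := by
  have hCl : ∀ x, (unpair R e hs h1 h2 hi).C (e (.inl x)) = R.C x := fun x => by simp [unpair]; rfl
  have hCr : ∀ q, (unpair R e hs h1 h2 hi).C (e (.inr q)) = -(i • (R.C (.inr q) * R.X (.inr q))) :=
    fun q => by simp [unpair]; rfl
  have hXl : ∀ k, (unpair R e hs h1 h2 hi).X (e (.inl (.inl k))) = s k • R.X (.inl k) :=
    fun x => by simp [unpair]; rfl
  have hXm : ∀ q, (unpair R e hs h1 h2 hi).X (e (.inl (.inr q))) = 0 :=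
    fun x => by simp [unpair]; rfl
  have hXr : ∀ q, (unpair R e hs h1 h2 hi).X (e (.inr q)) = 0 := fun x => by simp [unpair]; rfl
  have hRl : ∀ k, R.X (.inl k) = (s k)⁻¹ • (unpair R e hs h1 h2 hi).X (e (.inl (.inl k))) := by
    intro k
    by_cases h : s k = 0
    · have h0 : R.X (.inl k) = 0 := R.X_eq_zero _ (by rw [pairedSet_inl, if_pos h])
      refine h0.trans ?_
      rw [h, inv_zero]
      exact (zero_smul F _).symm
    · rw [hXl]
      exact (inv_smul_smul₀ h _).symm
  have hRr : ∀ q, R.X (.inr q) = i • ((unpair R e hs h1 h2 hi).C (e (.inl (.inr q))) *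
      (unpair R e hs h1 h2 hi).C (e (.inr q))) := by
    intro q
    have aux : i • (R.C (.inr q) * -(i • (R.C (.inr q) * R.X (.inr q)))) = R.X (.inr q) := by
      rw [mul_neg, mul_smul_comm, R.C_C_self, smul_neg, smul_smul, hi, neg_smul, one_smul, neg_neg]
    rw [hCl, hCr]
    exact aux.symm
  have hom : ∀ g, IsHom (unpair R e hs h1 h2 hi) (unpair R e hs h1 h2 hi) g ↔ IsHom R R g := by
    intro g
    refine ⟨fun hg => ⟨fun x v => ?_, fun x v => ?_⟩, fun hg => ⟨fun b v => ?_, fun b v => ?_⟩⟩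
    · rw [← hCl]; exact hg.C _ v
    · rcases x with k | q
      · rw [hRl]
        exact (map_smul g _ _).trans (congrArg (_ • ·) (hg.X _ v))
      · rw [hRr]
        exact (map_smul g _ _).trans (congrArg (_ • ·) ((hg.C _ _).trans (congrArg _ (hg.C _ v))))
    · obtain ⟨x | q, rfl⟩ := e.surjective b
      · rw [hCl]; exact hg.C _ v
      · rw [hCr]
        exact (map_neg g _).trans (congrArg Neg.neg ((map_smul g _ _).trans
          (congrArg (_ • ·) ((hg.C _ _).trans (congrArg _ (hg.X _ v))))))
    · obtain ⟨(k | q) | q, rfl⟩ := e.surjective b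
      · rw [hXl]
        exact (map_smul g _ _).trans (congrArg (_ • ·) (hg.X _ v))
      · rw [hXm]; exact map_zero g
      · rw [hXr]; exact map_zero g
  exact
    { nontrivial := hR.nontrivial
      irreducible := fun N hN => hR.irreducible N
        { P := hN.P
          C := fun x v hv => by rw [← hCl]; exact hN.C _ v hv
          X := fun x v hv => by
            rcases x with k | q
            · rw [hRl]; exact N.smul_mem _ (hN.X _ v hv)
            · rw [hRr]; exact N.smul_mem _ (hN.C _ _ (hN.C _ v hv)) }
      even_hom := fun g hg hP => hR.even_hom g ((hom g).1 hg) hP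
      odd_hom_eq_zero := fun ho g hg hP => hR.odd_hom_eq_zero ho g ((hom g).1 hg) hP
      odd_hom := fun ho => by
        obtain ⟨η, h0, hη, hP, hu⟩ := hR.odd_hom ho
        exact ⟨η, h0, (hom η).2 hη, hP, fun g hg => hu g ((hom g).1 hg)⟩
      exists_hom := fun U hU => by
        obtain ⟨f, hf0, hf, hP⟩ := hR.exists_hom (pair (e := e) U hs hi) hU
        refine ⟨f, hf0, ⟨fun b v => ?_, fun b v => ?_⟩, hP⟩
        · obtain ⟨x | q, rfl⟩ := e.surjective b
          · rw [hCl]; exact hf.C x v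
          · rw [hCr]
            have h3 := (hf.C (.inr q) (R.X (.inr q) v)).trans (congrArg _ (hf.X (.inr q) v))
            have h4 : ∀ z : U.V, U.C (e (.inl (.inr q)))
                ((i • (U.C (e (.inl (.inr q))) * U.C (e (.inr q)))) z) =
                i • U.C (e (.inr q)) z := by
              intro z
              rw [LinearMap.smul_apply, map_smul, ← Module.End.mul_apply, U.C_C_self]
            have h5 := h3.trans (h4 (f v))
            refine (map_neg f _).trans ?_
            refine (congrArg Neg.neg ((map_smul f i _).trans (congrArg (i • ·) h5))).trans ?_
            have h6 : ∀ z : U.V, -(i • i • z) = z := fun z => by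
              rw [smul_smul, hi, neg_one_smul, neg_neg]
            exact h6 _
        · obtain ⟨(k | q) | q, rfl⟩ := e.surjective b
          · rw [hXl]
            refine (map_smul f _ _).trans ((congrArg (_ • ·) (hf.X _ v)).trans ?_)
            have h6 : ∀ z : U.V, s k • ((s k)⁻¹ • U.X (e (.inl (.inl k)))) z =
                U.X (e (.inl (.inl k))) z := fun z => by
              by_cases h : s k = 0
              · rw [h, zero_smul, U.X_eq_zero _ (by rw [hs, h, mul_zero]), LinearMap.zero_apply]
              · rw [LinearMap.smul_apply, smul_inv_smul₀ h]
            exact h6 _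
          · rw [hXm, U.X_eq_zero _ (h1 q)]; exact map_zero f
          · rw [hXr, U.X_eq_zero _ (h2 q)]; exact map_zero f }

end Pairing

/-- If `l` weights vanish, `l / 2` pairs are formed and `l % 2` generators stay unpaired. The model
then has `card ι - l + l % 2 + l / 2` Clifford generators, and an odd endomorphism exists exactly if
one of them is left over. -/
theorem exists_isUniversal {F : Type u} [Field F] [IsAlgClosed F] [NeZero (2 : F)] {ι : Type}
    [Finite ι] (a : ι → F) :
    ∃ R : WeightRep.{u, 0, u} F ι a, Module.Finite F R.V ∧
      Module.finrank F R.V = 2 ^ (Nat.card ι - Nat.card {b // a b = 0} / 2) ∧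
      IsUniversal.{u, 0, u, w} R (Odd (Nat.card {b // a b = 0})) := by
  classical
  have := Fintype.ofFinite ι
  set l := Nat.card {b // a b = 0} with hl
  let N : Type := {b // a b ≠ 0} ⊕ Fin (l % 2)
  let Q : Type := Fin (l / 2)
  let eZ : Fin (l % 2) ⊕ (Q ⊕ Q) ≃ {b // a b = 0} := Fintype.equivOfCardEq (by
    rw [Fintype.card_sum, Fintype.card_sum, Fintype.card_fin, Fintype.card_fin,
      ← Nat.card_eq_fintype_card (α := {b // a b = 0}), ← hl]
    omega)
  let e1 : (N ⊕ Q) ⊕ Q ≃ {b // a b ≠ 0} ⊕ {b // a b = 0} :=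
    (Equiv.sumAssoc N Q Q).trans ((Equiv.sumAssoc _ _ _).trans (Equiv.sumCongr (Equiv.refl _) eZ))
  let e : (N ⊕ Q) ⊕ Q ≃ ι := e1.trans ((Equiv.sumComm _ _).trans (Equiv.sumCompl (fun b => a b = 0)))
  have hZ : ∀ x, a (e (e1.symm (.inr x))) = 0 := fun x => by simp [e, x.2]
  choose s hs using fun k : N => IsAlgClosed.exists_eq_mul_self (a (e (.inl (.inl k))))
  obtain ⟨i, hi⟩ := IsAlgClosed.exists_eq_mul_self (-1 : F)
  have hN2 : ∀ x : Fin (l % 2), a (e (.inl (.inl (.inr x)))) = 0 := fun x => (eZ (.inl x)).2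
  have hN1 : ∀ x : {b // a b ≠ 0}, a (e (.inl (.inl (.inl x)))) ≠ 0 := fun x => x.2
  have h1 : ∀ q, a (e (.inl (.inr q))) = 0 := fun q => (eZ (.inr (.inl q))).2
  have h2 : ∀ q, a (e (.inr q)) = 0 := fun q => (eZ (.inr (.inr q))).2
  let lo : LinearOrder (N ⊕ Q) := LinearOrder.lift' (Fintype.equivFin (N ⊕ Q))
    (Fintype.equivFin (N ⊕ Q)).injective
  have hJc : ∀ x, x ∈ (pairedSet N Q s)ᶜ ↔ ∃ y : Fin (l % 2), x = .inl (.inr y) := by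
    rintro ((x | x) | x)
    · have : s (.inl x) ≠ 0 := fun h => hN1 x (by rw [hs, h, mul_zero])
      simpa [pairedSet] using this
    · have : s (.inr x) = 0 := mul_self_eq_zero.1 ((hs _).symm.trans (hN2 x))
      simpa [pairedSet] using this
    · simp [pairedSet]
  have hJ : (pairedSet N Q s)ᶜ.Subsingleton := by
    intro x hx y hy
    obtain ⟨x, rfl⟩ := (hJc x).1 hx
    obtain ⟨y, rfl⟩ := (hJc y).1 hy
    have : x = y := by
      have := x.2
      have := y.2
      ext
      omega
    rw [this]
  have hodd : (pairedSet N Q s)ᶜ.Nonempty = Odd l := by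
    rw [eq_iff_iff]
    constructor
    · rintro ⟨x, hx⟩
      obtain ⟨y, -⟩ := (hJc x).1 hx
      have := y.2
      rw [Nat.odd_iff]
      omega
    · intro h
      exact ⟨_, (hJc _).2 ⟨⟨0, by rw [Nat.odd_iff] at h; omega⟩, rfl⟩⟩
  have hR := CliffordModel.isUniversal_model.{u, 0, w} (F := F) hJ
  rw [hodd] at hR
  refine ⟨unpair (CliffordModel.model F (pairedSet N Q s)) e hs h1 h2 hi.symm, ?_, ?_,
    isUniversal_unpair _ hs h1 h2 hi.symm hR⟩
  · exact inferInstanceAs (Module.Finite F (Finset (N ⊕ Q) → F))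
  · refine (Module.finrank_pi F (ι := Finset (N ⊕ Q))).trans ?_
    rw [Fintype.card_finset, Fintype.card_sum, Fintype.card_sum, Fintype.card_fin, Fintype.card_fin]
    congr 1
    have hc : Fintype.card {b // a b ≠ 0} = Nat.card ι - l := by
      rw [Fintype.card_subtype_compl, Nat.card_eq_fintype_card, hl, Nat.card_eq_fintype_card]
    have hle : l ≤ Nat.card ι := by
      rw [hl]; exact Nat.card_le_card_of_injective _ Subtype.val_injective
    omega

end WeightRep

/-! ### Strict partitions and shifted diagrams -/

namespace StrictPartition

variable {n : ℕ} (lam : StrictPartition n)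

/-- The parts in decreasing order. -/
def partList : List ℕ := lam.1.parts.sort (· ≥ ·)

theorem coe_partList : (lam.partList : Multiset ℕ) = lam.1.parts := Multiset.sort_eq _ _

theorem length_partList : lam.partList.length = lam.length := Multiset.length_sort _

theorem partList_pairwise : lam.partList.Pairwise (· > ·) := by
  have h1 : lam.partList.Pairwise (· ≥ ·) := Multiset.pairwise_sort _ _
  have h2 : lam.partList.Nodup := by
    rw [← Multiset.coe_nodup, coe_partList]
    exact lam.2
  exact h1.imp₂ (fun _ _ h h' => lt_of_le_of_ne h (Ne.symm h')) h2

theorem part_eq (r : ℕ) : lam.part r = lam.partList.getD r 0 := rfl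

theorem part_eq_getElem {r : ℕ} (h : r < lam.partList.length) : lam.part r = lam.partList[r] := by
  rw [part_eq, List.getD_eq_getElem _ _ h]

theorem part_pos_iff {r : ℕ} : 0 < lam.part r ↔ r < lam.length := by
  constructor
  · intro h
    by_contra hr
    rw [part_eq, List.getD_eq_default _ _ (by rw [length_partList]; omega)] at h
    exact lt_irrefl _ h
  · intro h
    have h' : r < lam.partList.length := by rwa [length_partList]
    rw [part_eq_getElem _ h']
    apply lam.1.parts_pos
    rw [← coe_partList, Multiset.mem_coe]
    exact List.getElem_mem h'

theorem part_lt_part {r r' : ℕ} (h : r < r') (hr : r' < lam.length) : lam.part r' < lam.part r := by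
  have h' : r' < lam.partList.length := by rwa [length_partList]
  rw [part_eq_getElem _ h', part_eq_getElem _ (h.trans h')]
  exact List.pairwise_iff_getElem.1 lam.partList_pairwise r r' (h.trans h') h' h

/-- Distinct parts drop by at least one from row to row, which makes up for the shift; so the right
ends of the rows never move outwards. This is why a shifted diagram is a lower set. -/
theorem part_add_le {r r' : ℕ} (h : r ≤ r') (hr : 0 < lam.part r') :
    r' + lam.part r' ≤ r + lam.part r := by
  induction r', h using Nat.le_induction with
  | base => exact le_rfl
  | succ m hm ih =>
    rw [part_pos_iff] at hr
    have h1 := lam.part_lt_part (r := m) (r' := m + 1) (by omega) hr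
    have := ih (by omega)
    omega

theorem mem_boxes {b : ℕ × ℕ} : b ∈ lam.boxes ↔ b.1 ≤ b.2 ∧ b.2 < b.1 + lam.part b.1 := Iff.rfl

theorem mem_boxes_of_le {b b' : ℕ × ℕ} (hb : b ∈ lam.boxes) (h : b'.1 ≤ b'.2) (hle : b' ≤ b) :
    b' ∈ lam.boxes := by
  rw [mem_boxes] at hb ⊢
  have h1 := lam.part_add_le hle.1 (by omega)
  have := hle.2
  exact ⟨h, by omega⟩

/-- Boxes are given by a row and a position in the row. -/
def boxesEquiv : lam.boxes ≃ Σ r : Fin lam.length, Fin (lam.part r) where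
  toFun b := ⟨⟨b.1.1, lam.part_pos_iff.1 (by have := lam.mem_boxes.1 b.2; omega)⟩,
    ⟨b.1.2 - b.1.1, by have := lam.mem_boxes.1 b.2; simp only; omega⟩⟩
  invFun x := ⟨(x.1, x.1 + x.2), by
    have := x.2.2
    rw [mem_boxes]
    simp only
    omega⟩
  left_inv b := by
    have := lam.mem_boxes.1 b.2
    ext <;> simp
    omega
  right_inv x := by
    obtain ⟨r, j⟩ := x
    ext <;> simp

instance : Finite lam.boxes := Finite.of_equiv _ lam.boxesEquiv.symm

theorem card_boxes : Nat.card lam.boxes = n := by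
  rw [Nat.card_congr lam.boxesEquiv, Nat.card_eq_fintype_card, Fintype.card_sigma]
  simp only [Fintype.card_fin]
  have h1 : lam.partList.sum = n := by
    rw [← Multiset.sum_coe, coe_partList, lam.1.parts_sum]
  have h2 : ∑ r : Fin lam.partList.length, lam.part r = lam.partList.sum := by
    rw [← Fin.sum_univ_getElem]
    exact Finset.sum_congr rfl fun r _ => part_eq_getElem _ r.2
  rw [← length_partList]
  exact h2.trans h1

/-- Every row starts on the main diagonal. The diagonal boxes are those of weight zero, which
determine the dimension and the type of the module. -/
theorem card_diagonal (a : lam.boxes → Prop) (ha : ∀ b, a b ↔ b.1.2 - b.1.1 = 0) :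
    Nat.card {b // a b} = lam.length := by
  have e : {b // a b} ≃ Fin lam.length :=
    { toFun := fun b => ⟨b.1.1.1, lam.part_pos_iff.1 (by have := lam.mem_boxes.1 b.1.2; omega)⟩
      invFun := fun r => ⟨⟨(r, r), by
        have := lam.part_pos_iff.2 r.2
        rw [mem_boxes]
        simp only
        omega⟩, by rw [ha]; simp⟩
      left_inv := fun b => by
        have h1 := (ha b.1).1 b.2
        have h2 := lam.mem_boxes.1 b.1.2
        ext <;> simp
        omega
      right_inv := fun r => rfl }
  rw [Nat.card_congr e, Nat.card_eq_fintype_card, Fintype.card_fin]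

theorem ext_boxes {lam mu : StrictPartition n} (h : lam.boxes = mu.boxes) : lam = mu := by
  have hpart : ∀ r, lam.part r = mu.part r := by
    intro r
    have key : ∀ j, j < lam.part r ↔ j < mu.part r := fun j => by
      have : (r, r + j) ∈ lam.boxes ↔ (r, r + j) ∈ mu.boxes := by rw [h]
      rw [mem_boxes, mem_boxes] at this
      simpa using this
    rcases lt_trichotomy (lam.part r) (mu.part r) with h | h | h
    · exact absurd ((key _).2 h) (lt_irrefl _)
    · exact h
    · exact absurd ((key _).1 h) (lt_irrefl _)
  have hlen : lam.length = mu.length := by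
    have key : ∀ r, r < lam.length ↔ r < mu.length := fun r => by
      rw [← part_pos_iff, ← part_pos_iff, hpart]
    rcases lt_trichotomy lam.length mu.length with h | h | h
    · exact absurd ((key _).2 h) (lt_irrefl _)
    · exact h
    · exact absurd ((key _).1 h) (lt_irrefl _)
  have hlist : lam.partList = mu.partList := by
    apply List.ext_getElem
    · rw [length_partList, length_partList, hlen]
    · intro r h1 h2
      rw [← part_eq_getElem _ h1, ← part_eq_getElem _ h2, hpart]
  apply Subtype.ext
  apply Nat.Partition.ext
  rw [← coe_partList, ← coe_partList, hlist]

/-- A finite lower set of boxes is a shifted Young diagram. -/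
theorem exists_boxes_eq (D : Finset (ℕ × ℕ)) (hcard : D.card = n) (hD : ∀ b ∈ D, b.1 ≤ b.2)
    (hlow : ∀ b ∈ D, ∀ b' : ℕ × ℕ, b'.1 ≤ b'.2 → b' ≤ b → b' ∈ D) :
    ∃ lam : StrictPartition n, lam.boxes = D := by
  classical
  let row : ℕ → Finset ℕ := fun r => (D.filter (fun b => b.1 = r)).image (fun b => b.2 - b.1)
  have hrow : ∀ r j, j ∈ row r ↔ (r, r + j) ∈ D := by
    intro r j
    simp only [row, Finset.mem_image, Finset.mem_filter]
    constructor
    · rintro ⟨⟨x, y⟩, ⟨hb, rfl⟩, rfl⟩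
      have := hD _ hb
      simp only at this ⊢
      rwa [Nat.add_sub_cancel' this]
    · intro h
      exact ⟨_, ⟨h, rfl⟩, by simp⟩
  let len : ℕ → ℕ := fun r => (row r).card
  have hrange : ∀ r, row r = Finset.range (len r) := by
    intro r
    symm
    apply Finset.eq_of_subset_of_card_le _ (by simp [len])
    intro j hj
    by_contra hjr
    have hsub : row r ⊆ Finset.range j := by
      intro i hi
      rw [Finset.mem_range]
      by_contra hij
      refine hjr ((hrow r j).2 (hlow _ ((hrow r i).1 hi) _ (by simp) ?_))
      exact ⟨le_rfl, by simp only; omega⟩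
    have := Finset.card_le_card hsub
    rw [Finset.card_range] at this
    rw [Finset.mem_range] at hj
    simp only [len] at hj
    omega
  have hmem : ∀ r j, (r, r + j) ∈ D ↔ j < len r := fun r j => by
    rw [← hrow, hrange, Finset.mem_range]
  -- The box above the last box of row `r + 1` has position `len (r + 1)` in row `r`, counted from
  -- 0.
  have hdec : ∀ r, 0 < len (r + 1) → len (r + 1) < len r := by
    intro r h
    rw [← hmem]
    refine hlow (r + 1, r + 1 + (len (r + 1) - 1)) ((hmem _ _).2 (by omega)) _ (by simp) ?_
    exact ⟨by simp, by simp only; omega⟩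
  have hex : ∃ r, len r = 0 := by
    by_contra! hne
    have : ∀ r, len r + r ≤ len 0 := by
      intro r
      induction r with
      | zero => simp
      | succ r ih =>
        have := hdec r (Nat.pos_of_ne_zero (hne _))
        omega
    have h1 := this (len 0)
    have := hne (len 0)
    omega
  let l := Nat.find hex
  have hl0 : len l = 0 := Nat.find_spec hex
  have hlpos : ∀ r < l, 0 < len r := fun r hr => Nat.pos_of_ne_zero (Nat.find_min hex hr)
  have hlge : ∀ r, l ≤ r → len r = 0 := by
    intro r hr
    induction r, hr using Nat.le_induction with
    | base => exact hl0
    | succ m _ ih =>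
      by_contra hne
      have := hdec m (Nat.pos_of_ne_zero hne)
      omega
  have hlt : ∀ r r', r < r' → r' < l → len r' < len r := by
    intro r r' hrr' hr'
    induction r', hrr' using Nat.le_induction with
    | base => exact hdec r (hlpos _ hr')
    | succ m hm ih => exact (hdec m (hlpos _ hr')).trans (ih (by omega))
  let L : List ℕ := (List.range l).map len
  have hLlen : L.length = l := by simp [L]
  have hLget : ∀ r (h : r < L.length), L[r] = len r := fun r h => by simp [L]
  have hsorted : L.Pairwise (· > ·) := by
    rw [List.pairwise_iff_getElem]
    intro i j hi hj hij
    rw [hLget, hLget]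
    exact hlt i j hij (by rwa [hLlen] at hj)
  have hDcard : D.card = ∑ r ∈ Finset.range l, len r := by
    have hmaps : ∀ b ∈ D, b.1 ∈ Finset.range l := by
      rintro ⟨x, y⟩ hb
      have hxy := hD _ hb
      simp only at hxy
      rw [Finset.mem_range]
      by_contra hx
      have h1 : (x, x + (y - x)) ∈ D := by rwa [Nat.add_sub_cancel' hxy]
      rw [hmem, hlge x (by simpa using hx)] at h1
      omega
    rw [Finset.card_eq_sum_card_fiberwise hmaps]
    refine Finset.sum_congr rfl fun r _ => ?_
    refine (Finset.card_image_of_injOn ?_).symm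
    rintro ⟨x, y⟩ hb ⟨x', y'⟩ hb' heq
    simp only [Finset.coe_filter, Set.mem_ofPred_eq] at hb hb' heq
    have h1 := hD _ hb.1
    have h2 := hD _ hb'.1
    simp only at h1 h2
    ext <;> simp only <;> omega
  have hLsum : L.sum = n := by
    rw [← hcard, hDcard]
    rfl
  let p : n.Partition :=
    { parts := L
      parts_pos := by
        intro i hi
        obtain ⟨r, hr, rfl⟩ := List.mem_map.1 (Multiset.mem_coe.1 hi)
        exact hlpos r (List.mem_range.1 hr)
      parts_sum := by rw [Multiset.sum_coe, hLsum] }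
  let lam : StrictPartition n := ⟨p, Multiset.coe_nodup.2 (hsorted.imp fun h => ne_of_gt h)⟩
  have hpl : lam.partList = L := by
    apply List.Perm.eq_of_pairwise (le := (· > ·)) _ lam.partList_pairwise hsorted
    · rw [← Multiset.coe_eq_coe, coe_partList]
    · intro a b _ _ h1 h2
      exact absurd h1 h2.not_gt
  have hpart : ∀ r, lam.part r = len r := by
    intro r
    rw [part_eq, hpl]
    by_cases hr : r < l
    · rw [List.getD_eq_getElem _ _ (by rwa [hLlen]), hLget]
    · rw [List.getD_eq_default _ _ (by rw [hLlen]; omega), hlge r (by omega)]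
  refine ⟨lam, ?_⟩
  ext ⟨x, y⟩
  rw [mem_boxes, hpart, Finset.mem_coe]
  simp only
  constructor
  · rintro ⟨h1, h2⟩
    have := (hmem x (y - x)).2 (by omega)
    rwa [Nat.add_sub_cancel' h1] at this
  · intro h
    have h1 := hD _ h
    simp only at h1
    refine ⟨h1, ?_⟩
    have := (hmem x (y - x)).1 (by rwa [Nat.add_sub_cancel' h1])
    omega

end StrictPartition

/-! ### Diagrams built up by adding boxes -/

/-- The content of a box of the shifted quadrant. -/
def boxContent (b : ℕ × ℕ) : ℕ := b.2 - b.1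

/-- The box `b` can be added to the lower set `D`. -/
def IsAddable (D : Set (ℕ × ℕ)) (b : ℕ × ℕ) : Prop :=
  b.1 ≤ b.2 ∧ b ∉ D ∧ ∀ b' : ℕ × ℕ, b'.1 ≤ b'.2 → b' ≤ b → b' ≠ b → b' ∈ D

/-- The boxes `β 0, …, β (m - 1)` can be added successively, starting from the empty diagram. -/
def IsBoxSeq (m : ℕ) (β : ℕ → ℕ × ℕ) : Prop :=
  ∀ k < m, IsAddable (β '' Set.Iio k) (β k)

namespace IsAddable

variable {D : Set (ℕ × ℕ)} {b b' : ℕ × ℕ}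

theorem not_le (hb : IsAddable D b) (hb' : IsAddable D b') (hne : b ≠ b') : ¬ b ≤ b' :=
  fun h => hb.2.1 (hb'.2.2 b hb.1 h hne)

/-- Boxes on the same diagonal are comparable, while distinct addable boxes are not. -/
theorem eq_of_content_eq (hb : IsAddable D b) (hb' : IsAddable D b')
    (h : boxContent b = boxContent b') : b = b' := by
  by_contra hne
  have h1 := hb.not_le hb' hne
  have h2 := hb'.not_le hb (Ne.symm hne)
  have h3 := hb.1
  have h4 := hb'.1
  rw [Prod.le_def] at h1 h2
  simp only [boxContent] at h
  omega

/-- Boxes on neighbouring diagonals are comparable as well. -/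
theorem content_ne_succ (hb : IsAddable D b) (hb' : IsAddable D b') :
    boxContent b ≠ boxContent b' + 1 := by
  intro h
  have hne : b ≠ b' := by rintro rfl; omega
  have h1 := hb.not_le hb' hne
  have h2 := hb'.not_le hb (Ne.symm hne)
  have h3 := hb.1
  have h4 := hb'.1
  rw [Prod.le_def] at h1 h2
  simp only [boxContent] at h
  omega

theorem insert_of_ne (hb' : IsAddable D b') (hne : b ≠ b') :
    IsAddable (insert b D) b' :=
  ⟨hb'.1, fun h => h.elim (fun h => hne h.symm) hb'.2.1,
    fun x h1 h2 h3 => Or.inr (hb'.2.2 x h1 h2 h3)⟩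

end IsAddable

theorem image_Iio_succ {α : Type*} (β : ℕ → α) (k : ℕ) :
    β '' Set.Iio (k + 1) = insert (β k) (β '' Set.Iio k) := by
  rw [← Order.succ_eq_add_one, Order.Iio_succ_eq_insert, Set.image_insert_eq]

namespace IsBoxSeq

variable {m : ℕ} {β γ : ℕ → ℕ × ℕ}

theorem mono (h : IsBoxSeq m β) {k : ℕ} (hk : k ≤ m) : IsBoxSeq k β :=
  fun j hj => h j (hj.trans_le hk)

theorem succ (h : IsBoxSeq m β) {b : ℕ × ℕ} (hb : IsAddable (β '' Set.Iio m) b) :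
    IsBoxSeq (m + 1) (Function.update β m b) := by
  have h0 : ∀ k ≤ m, Function.update β m b '' Set.Iio k = β '' Set.Iio k := fun k hk =>
    Set.image_congr fun j hj => Function.update_of_ne (ne_of_lt ((Set.mem_Iio.1 hj).trans_le hk)) _ _
  intro k hk
  rw [h0 k (by omega)]
  by_cases hkm : k = m
  · subst hkm
    rwa [Function.update_self]
  · rw [Function.update_of_ne hkm]
    exact h k (by omega)

theorem ne (h : IsBoxSeq m β) {j k : ℕ} (hjk : j < k) (hk : k < m) : β j ≠ β k :=
  fun he => (h k hk).2.1 ⟨j, hjk, he⟩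

theorem injOn (h : IsBoxSeq m β) : Set.InjOn β (Set.Iio m) := by
  intro j hj k hk hjk
  rcases lt_trichotomy j k with hlt | he | hlt
  · exact absurd hjk (h.ne hlt hk)
  · exact he
  · exact absurd hjk.symm (h.ne hlt hj)

theorem lower (h : IsBoxSeq m β) {k : ℕ} (hk : k ≤ m) {b b' : ℕ × ℕ} (hb : b ∈ β '' Set.Iio k)
    (hb' : b'.1 ≤ b'.2) (hle : b' ≤ b) : b' ∈ β '' Set.Iio k := by
  by_cases he : b' = b
  · rwa [he]
  · obtain ⟨j, hj, rfl⟩ := hb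
    obtain ⟨i, hi, rfl⟩ := (h j ((Set.mem_Iio.1 hj).trans_le hk)).2.2 b' hb' hle he
    exact ⟨i, (Set.mem_Iio.1 hi).trans hj, rfl⟩

/-- Inductively both sequences have reached the same diagram, and at most one box of a given content
can be added to it. -/
theorem eq_of_content_eq (hβ : IsBoxSeq m β) (hγ : IsBoxSeq m γ)
    (h : ∀ k < m, boxContent (β k) = boxContent (γ k)) : ∀ k < m, β k = γ k := by
  intro k
  induction k using Nat.strong_induction_on with
  | _ k ih =>
    intro hk
    have h1 : γ '' Set.Iio k = β '' Set.Iio k :=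
      Set.image_congr fun j hj => (ih j hj ((Set.mem_Iio.1 hj).trans hk)).symm
    have h2 := hγ k hk
    rw [h1] at h2
    exact (hβ k hk).eq_of_content_eq h2 (h k hk)

theorem isAddable_succ (h : IsBoxSeq m β) {k : ℕ} (hk : k + 1 < m) (hle : ¬ β k ≤ β (k + 1)) :
    IsAddable (β '' Set.Iio k) (β (k + 1)) := by
  obtain ⟨h1, h2, h3⟩ := h (k + 1) hk
  rw [image_Iio_succ] at h2 h3
  refine ⟨h1, fun h => h2 (Or.inr h), fun b hb hb' hne => (h3 b hb hb' hne).resolve_left ?_⟩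
  rintro rfl
  exact hle hb'

/-- Boxes between `β k` and a later box `β l` are added after `β k`. -/
theorem not_mem_of_le (h : IsBoxSeq m β) {k : ℕ} (hk : k < m) {b : ℕ × ℕ} (hb : β k ≤ b) :
    b ∉ β '' Set.Iio k :=
  fun hmem => (h k hk).2.1 (h.lower hk.le hmem (h k hk).1 hb)

/-- A box between `β k` and `β (k + 1)` would have to be added between the two; hence the box above
or to the left of `β (k + 1)` is already `β k`. -/
theorem content_of_le (h : IsBoxSeq m β) {k : ℕ} (hk : k + 1 < m) (hle : β k ≤ β (k + 1)) :
    boxContent (β k) = boxContent (β (k + 1)) + 1 ∨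
      boxContent (β (k + 1)) = boxContent (β k) + 1 := by
  have hv := (h k (by omega)).1
  obtain ⟨hv', -, hlow⟩ := h (k + 1) hk
  have hne := h.ne (Nat.lt_succ_self k) hk
  have key : ∀ b : ℕ × ℕ, b.1 ≤ b.2 → b ≤ β (k + 1) → b ≠ β (k + 1) → β k ≤ b → b = β k := by
    intro b h1 h2 h3 h4
    have := hlow b h1 h2 h3
    rw [image_Iio_succ] at this
    exact this.resolve_right (h.not_mem_of_le (by omega) h4)
  generalize β k = B at *
  obtain ⟨x, y⟩ := B
  generalize β (k + 1) = B' at *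
  obtain ⟨x', y'⟩ := B'
  simp only [boxContent, Prod.mk_le_mk, ne_eq, Prod.mk.injEq] at *
  by_cases hx : x < x'
  · have h1 := key (x' - 1, y') (by simp only; omega) (by rw [Prod.mk_le_mk]; omega)
      (by simp; omega) (by rw [Prod.mk_le_mk]; omega)
    simp only [Prod.mk.injEq] at h1
    omega
  · have h1 := key (x', y' - 1) (by simp only; omega) (by rw [Prod.mk_le_mk]; omega)
      (by simp; omega) (by rw [Prod.mk_le_mk]; omega)
    simp only [Prod.mk.injEq] at h1
    omega

theorem content_ne (h : IsBoxSeq m β) {k : ℕ} (hk : k + 1 < m) :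
    boxContent (β k) ≠ boxContent (β (k + 1)) := by
  intro he
  by_cases hle : β k ≤ β (k + 1)
  · have := h.content_of_le hk hle
    omega
  · exact h.ne (Nat.lt_succ_self k) hk
      ((h k (by omega)).eq_of_content_eq (h.isAddable_succ hk hle) he)

/-- If the two boxes are incomparable, `β (k + 1)` was addable together with `β k`, and the contents
of two addable boxes never differ by one. -/
theorem le_iff (h : IsBoxSeq m β) {k : ℕ} (hk : k + 1 < m) :
    β k ≤ β (k + 1) ↔ boxContent (β k) = boxContent (β (k + 1)) + 1 ∨
      boxContent (β (k + 1)) = boxContent (β k) + 1 := by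
  refine ⟨h.content_of_le hk, fun hc => ?_⟩
  by_contra hle
  have h1 := h k (by omega)
  have h2 := h.isAddable_succ hk hle
  exact hc.elim (h1.content_ne_succ h2) (h2.content_ne_succ h1)

/-- Only `β (k + 1)` may lie strictly between two boxes of the same diagonal added two steps apart.
The boxes above and to the left of `β (k + 2)` both qualify, unless the latter falls outside the
shifted quadrant, which happens only on the main diagonal. -/
theorem content_eq_zero (h : IsBoxSeq m β) {k : ℕ} (hk : k + 2 < m)
    (he : boxContent (β k) = boxContent (β (k + 2))) :
    boxContent (β k) = 0 ∧ boxContent (β (k + 1)) = 1 := by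
  have hv := (h k (by omega)).1
  obtain ⟨hv', -, hlow⟩ := h (k + 2) hk
  have hne := h.ne (show k < k + 2 by omega) hk
  have key : ∀ b : ℕ × ℕ, b.1 ≤ b.2 → b ≤ β (k + 2) → b ≠ β (k + 2) → β k ≤ b → b ≠ β k →
      b = β (k + 1) := by
    intro b h1 h2 h3 h4 h5
    have := hlow b h1 h2 h3
    rw [image_Iio_succ, image_Iio_succ] at this
    exact this.resolve_right fun h' => h'.elim h5 (h.not_mem_of_le (by omega) h4)
  have hnle : ¬ β (k + 2) ≤ β k := fun hle => by
    obtain ⟨j, hj, he⟩ := h.lower (k := k + 1) (by omega) ⟨k, by simp, rfl⟩ hv' hle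
    exact h.ne (show j < k + 2 from (Set.mem_Iio.1 hj).trans (by omega)) hk he
  generalize β k = B at *
  obtain ⟨x, y⟩ := B
  generalize β (k + 2) = B' at *
  obtain ⟨x', y'⟩ := B'
  generalize β (k + 1) = B'' at *
  obtain ⟨x'', y''⟩ := B''
  simp only [boxContent, Prod.mk_le_mk, ne_eq, Prod.mk.injEq] at *
  have h1 := key (x' - 1, y') (by simp only; omega) (by rw [Prod.mk_le_mk]; omega)
    (by simp; omega) (by rw [Prod.mk_le_mk]; omega) (by simp; omega)
  simp only [Prod.mk.injEq] at h1
  suffices h0 : y - x = 0 from ⟨h0, by omega⟩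
  by_contra h0
  have h2 := key (x', y' - 1) (by simp only; omega) (by rw [Prod.mk_le_mk]; omega)
    (by simp; omega) (by rw [Prod.mk_le_mk]; omega) (by simp; omega)
  simp only [Prod.mk.injEq] at h2
  omega

theorem swap (h : IsBoxSeq m β) {k : ℕ} (hk : k + 1 < m) (hle : ¬ β k ≤ β (k + 1)) :
    IsBoxSeq m (β ∘ Equiv.swap k (k + 1)) := by
  intro j hj
  have h1 : ∀ j, j ≠ k + 1 → (β ∘ Equiv.swap k (k + 1)) '' Set.Iio j = β '' Set.Iio j := by
    intro j hj
    rw [Set.image_comp]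
    congr 1
    ext i
    rw [Equiv.image_eq_preimage_symm, Equiv.symm_swap, Set.mem_preimage, Set.mem_Iio, Set.mem_Iio]
    by_cases hi : i = k
    · subst hi
      rw [Equiv.swap_apply_left]
      omega
    · by_cases hi' : i = k + 1
      · subst hi'
        rw [Equiv.swap_apply_right]
        omega
      · rw [Equiv.swap_apply_of_ne_of_ne hi hi']
  by_cases hjk : j = k + 1
  · subst hjk
    rw [image_Iio_succ, h1 k (by omega)]
    simp only [Function.comp, Equiv.swap_apply_left, Equiv.swap_apply_right]
    exact (h k (by omega)).insert_of_ne (h.ne (Nat.lt_succ_self k) hk).symm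
  · rw [h1 j hjk]
    by_cases hj' : j = k
    · subst hj'
      simp only [Function.comp, Equiv.swap_apply_left]
      exact h.isAddable_succ hk hle
    · simp only [Function.comp, Equiv.swap_apply_of_ne_of_ne hj' hjk]
      exact h j hj

/-- If the contents of the last box and of a box to be added differ by one, then the box can be
added to the diagram, or a box of the same content was removable before the last step. -/
theorem exists_isAddable_or (h : IsBoxSeq (m + 1) β) {j : ℕ}
    (hj : j = boxContent (β m) + 1 ∨ boxContent (β m) = j + 1) :
    (∃ r, IsAddable (β '' Set.Iio (m + 1)) r ∧ boxContent r = j) ∨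
      j ≠ 0 ∧ ∃ p < m, boxContent (β p) = j ∧ ∀ k < m, p < k → ¬ β p ≤ β k := by
  have hv := (h m (Nat.lt_succ_self m)).1
  have hlow : ∀ b : ℕ × ℕ, b.1 ≤ b.2 → b ≤ β m → b ∈ β '' Set.Iio (m + 1) := fun b h1 h2 =>
    h.lower le_rfl ⟨m, by simp, rfl⟩ h1 h2
  have hlow' := (h m (Nat.lt_succ_self m)).2.2
  have hnot : ∀ b, β m ≤ b → b ≠ β m → b ∉ β '' Set.Iio (m + 1) := fun b h1 h2 h3 => by
    rw [image_Iio_succ] at h3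
    exact h3.elim h2 (h.not_mem_of_le (Nat.lt_succ_self m) h1)
  have hle : ∀ k < m, ¬ β m ≤ β k := fun k hk hle =>
    h.not_mem_of_le (Nat.lt_succ_self m) hle ⟨k, hk, rfl⟩
  have hmem : ∀ k < m, β k ∈ β '' Set.Iio (m + 1) := fun k hk =>
    ⟨k, hk.trans (Nat.lt_succ_self m), rfl⟩
  have hvk : ∀ k < m, (β k).1 ≤ (β k).2 := fun k hk => (h k (by omega)).1
  have hneq := fun (k : ℕ) (hk : k < m) (p : ℕ) (hp : p < k) => h.ne hp (by omega : k < m + 1)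
  generalize β m = B at *
  obtain ⟨x, y⟩ := B
  simp only [boxContent] at hj hv
  rcases hj with hj | hj
  -- The candidate is the right neighbour `(x, y + 1)`, which can fail to be addable only because
  -- the box above it is missing. In that case `(x - 1, y)`, which has content `j`, had no box to
  -- its right or below before the last step.
  · by_cases hadd : x = 0 ∨ (x - 1, y + 1) ∈ β '' Set.Iio (m + 1)
    · left
      refine ⟨(x, y + 1), ⟨by simp only; omega, ?_, ?_⟩, by simp only [boxContent]; omega⟩
      · exact hnot _ (by rw [Prod.mk_le_mk]; omega) (by simp)
      · rintro ⟨x', y'⟩ h1 h2 h3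
        simp only [Prod.mk_le_mk, ne_eq, Prod.mk.injEq] at h1 h2 h3
        by_cases hy : y' ≤ y
        · exact hlow _ h1 (by rw [Prod.mk_le_mk]; omega)
        · rcases hadd with hadd | hadd
          · omega
          · exact h.lower le_rfl hadd h1 (by rw [Prod.mk_le_mk]; omega)
    · right
      push Not at hadd
      refine ⟨by omega, ?_⟩
      obtain ⟨p, hp, hd⟩ := hlow' (x - 1, y) (by simp only; omega) (by rw [Prod.mk_le_mk]; omega)
        (by simp; omega)
      refine ⟨p, hp, by rw [hd, boxContent]; simp only; omega, fun k hk hpk hle' => ?_⟩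
      have h1 := hle k hk
      have h2 := hneq k hk p hpk
      have h3 : ¬ ((x - 1, y + 1) : ℕ × ℕ) ≤ β k := fun h3 =>
        hadd.2 (h.lower le_rfl (hmem k hk) (by simp only; omega) h3)
      generalize β k = Bk at *
      obtain ⟨x', y'⟩ := Bk
      rw [hd] at h2 hle'
      simp only [Prod.mk_le_mk, ne_eq, Prod.mk.injEq] at *
      omega
  -- Here the candidate is the lower neighbour `(x + 1, y)`, and the removable box is `(x, y - 1)`.
  -- If `y = x + 1`, the candidate lies on the main diagonal and needs no box on its left.
  · by_cases hadd : y = x + 1 ∨ (x + 1, y - 1) ∈ β '' Set.Iio (m + 1)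
    · left
      refine ⟨(x + 1, y), ⟨by simp only; omega, ?_, ?_⟩, by simp only [boxContent]; omega⟩
      · exact hnot _ (by rw [Prod.mk_le_mk]; omega) (by simp)
      · rintro ⟨x', y'⟩ h1 h2 h3
        simp only [Prod.mk_le_mk, ne_eq, Prod.mk.injEq] at h1 h2 h3
        by_cases hx : x' ≤ x
        · exact hlow _ h1 (by rw [Prod.mk_le_mk]; omega)
        · rcases hadd with hadd | hadd
          · omega
          · exact h.lower le_rfl hadd h1 (by rw [Prod.mk_le_mk]; omega)
    · right
      push Not at hadd
      refine ⟨by omega, ?_⟩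
      obtain ⟨p, hp, hd⟩ := hlow' (x, y - 1) (by simp only; omega) (by rw [Prod.mk_le_mk]; omega)
        (by simp; omega)
      refine ⟨p, hp, by rw [hd, boxContent]; simp only; omega, fun k hk hpk hle' => ?_⟩
      have h1 := hle k hk
      have h2 := hneq k hk p hpk
      have h3 : ¬ ((x + 1, y - 1) : ℕ × ℕ) ≤ β k := fun h3 =>
        hadd.2 (h.lower le_rfl (hmem k hk) (by simp only; omega) h3)
      generalize β k = Bk at *
      obtain ⟨x', y'⟩ := Bk
      rw [hd] at h2 hle'
      simp only [Prod.mk_le_mk, ne_eq, Prod.mk.injEq] at *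
      omega

end IsBoxSeq

/-! ### Inversions of permutations -/

section Inversions

variable {n : ℕ}

/-- The number of inversions of a permutation. -/
def invCount (σ : Equiv.Perm (Fin n)) : ℕ :=
  (Finset.univ.filter fun p : Fin n × Fin n => p.1 < p.2 ∧ σ p.2 < σ p.1).card

theorem swap_lt_swap_iff {k k' : Fin n} (hk : (k' : ℕ) = k + 1) {x y : Fin n}
    (h1 : ¬ (x = k ∧ y = k')) (h2 : ¬ (x = k' ∧ y = k)) :
    Equiv.swap k k' x < Equiv.swap k k' y ↔ x < y := by
  simp only [Fin.ext_iff, Fin.lt_def, Equiv.swap_apply_def] at *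
  split_ifs <;> omega

/-- Exchanging two adjacent values alters the relative order at one pair of positions only, namely
where these values are taken. -/
theorem invCount_swap_mul {k k' : Fin n} (hk : (k' : ℕ) = k + 1) {σ : Equiv.Perm (Fin n)}
    (h : σ.symm k < σ.symm k') : invCount (Equiv.swap k k' * σ) = invCount σ + 1 := by
  have hkk : k < k' := by rw [Fin.lt_def]; omega
  have key : (Finset.univ.filter fun p : Fin n × Fin n =>
      p.1 < p.2 ∧ (Equiv.swap k k' * σ) p.2 < (Equiv.swap k k' * σ) p.1) =
      insert (σ.symm k, σ.symm k')
        (Finset.univ.filter fun p : Fin n × Fin n => p.1 < p.2 ∧ σ p.2 < σ p.1) := by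
    ext ⟨i, j⟩
    rw [Finset.mem_filter, Finset.mem_insert, Finset.mem_filter]
    simp only [Finset.mem_univ, true_and, Prod.mk.injEq, Equiv.Perm.mul_apply,
      Equiv.eq_symm_apply]
    by_cases h1 : σ j = k ∧ σ i = k'
    · rw [← h1.1, ← h1.2, Equiv.symm_apply_apply, Equiv.symm_apply_apply] at h
      have : σ i ≠ k := by rw [h1.2]; exact hkk.ne'
      simp [h.asymm, this]
    · by_cases h2 : σ j = k' ∧ σ i = k
      · rw [← h2.1, ← h2.2, Equiv.symm_apply_apply, Equiv.symm_apply_apply] at h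
        simp [h, h2, hkk]
      · rw [swap_lt_swap_iff hk h1 h2]
        have : ¬ (σ i = k ∧ σ j = k') := fun h => h2 ⟨h.2, h.1⟩
        simp [this]
  rw [invCount, key, Finset.card_insert_of_notMem, invCount]
  simp [hkk.le]

theorem exists_descent {σ : Equiv.Perm (Fin n)} (h : σ ≠ 1) :
    ∃ k k' : Fin n, (k' : ℕ) = k + 1 ∧ σ.symm k' < σ.symm k := by
  by_contra! hcon
  apply h
  have hmono : StrictMono σ.symm := by
    rcases n with _ | n
    · intro x
      exact x.elim0
    · rw [Fin.strictMono_iff_lt_succ]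
      intro i
      refine lt_of_le_of_ne (hcon i.castSucc i.succ (by simp)) fun he => ?_
      have := Fin.ext_iff.1 (σ.symm.injective he)
      simp at this
  have h1 : σ.symm = 1 := by
    have := Subsingleton.elim (hmono.orderIsoOfSurjective _ σ.symm.surjective) (OrderIso.refl _)
    ext x
    exact congrArg Fin.val (DFunLike.congr_fun this x)
  calc σ = σ.symm.symm := (Equiv.symm_symm σ).symm
    _ = 1 := by rw [h1]; rfl

end Inversions

/-! ### Standard tableaux, their contents and admissible transpositions -/

namespace StandardTableau

variable {n : ℕ} {lam mu : StrictPartition n}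

theorem ext_box {T S : StandardTableau lam} (h : T.box = S.box) : T = S := by
  cases T
  cases S
  cases h
  rfl

instance : Finite (StandardTableau lam) :=
  Finite.of_injective (fun T => T.box) fun _ _ h => ext_box h

theorem content_eq (T : StandardTableau lam) (k : Fin n) :
    T.content k = boxContent (T.box k).1 := rfl

/-- One walks along the row of the first box to the column of the second and then down. The corner
belongs to the diagram, as it lies in the shifted quadrant and below the second box in the product
order. -/
theorem lt_of_box_le (T : StandardTableau lam) {k l : Fin n} (hle : (T.box k).1 ≤ (T.box l).1)
    (hne : k ≠ l) : k < l := by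
  have hk := lam.mem_boxes.1 (T.box k).2
  have hm : ((T.box k).1.1, (T.box l).1.2) ∈ lam.boxes :=
    lam.mem_boxes_of_le (T.box l).2 (by simp only; have := hle.2; omega) ⟨hle.1, le_rfl⟩
  obtain ⟨j, hj⟩ := T.box.surjective ⟨_, hm⟩
  have hj1 : (T.box j).1.1 = (T.box k).1.1 := by rw [hj]
  have hj2 : (T.box j).1.2 = (T.box l).1.2 := by rw [hj]
  have h1 : k = j ∨ k < j := by
    rcases (hle.2 : (T.box k).1.2 ≤ (T.box l).1.2).eq_or_lt with he | hlt
    · left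
      exact T.box.injective (Subtype.ext (Prod.ext hj1.symm (he.trans hj2.symm)))
    · right
      exact T.row_increasing k j hj1.symm (by rw [hj2]; exact hlt)
  have h2 : j = l ∨ j < l := by
    rcases (hle.1 : (T.box k).1.1 ≤ (T.box l).1.1).eq_or_lt with he | hlt
    · left
      exact T.box.injective (Subtype.ext (Prod.ext (hj1.trans he) hj2))
    · right
      exact T.column_increasing j l hj2 (by rw [hj1]; exact hlt)
  rcases h1 with rfl | h1
  · exact h2.resolve_left hne
  · rcases h2 with rfl | h2
    · exact h1
    · exact h1.trans h2

/-- The boxes of a tableau as a sequence. -/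
def seq (T : StandardTableau lam) (k : ℕ) : ℕ × ℕ :=
  if h : k < n then (T.box ⟨k, h⟩).1 else (0, 0)

theorem seq_val (T : StandardTableau lam) (k : Fin n) : T.seq k = (T.box k).1 := by
  simp [seq]

theorem isBoxSeq_seq (T : StandardTableau lam) : IsBoxSeq n T.seq := by
  intro k hk
  have hk' : T.seq k = (T.box ⟨k, hk⟩).1 := T.seq_val ⟨k, hk⟩
  rw [hk']
  refine ⟨(lam.mem_boxes.1 (T.box _).2).1, ?_, ?_⟩
  · rintro ⟨j, hj, he⟩
    rw [Set.mem_Iio] at hj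
    have hj' : T.seq j = (T.box ⟨j, hj.trans hk⟩).1 := T.seq_val ⟨j, hj.trans hk⟩
    rw [hj'] at he
    have := Fin.ext_iff.1 (T.box.injective (Subtype.ext he))
    simp only at this
    omega
  · intro b hb hle hne
    obtain ⟨j, hj⟩ := T.box.surjective ⟨b, lam.mem_boxes_of_le (T.box ⟨k, hk⟩).2 hb hle⟩
    have hjb : (T.box j).1 = b := by rw [hj]
    refine ⟨j, ?_, by rw [T.seq_val, hjb]⟩
    have : j < ⟨k, hk⟩ := T.lt_of_box_le (by rwa [hjb]) (by rintro rfl; exact hne hjb.symm)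
    exact this

theorem box_eq_of_content_eq {T : StandardTableau lam} {S : StandardTableau mu}
    (h : T.content = S.content) (k : Fin n) : (T.box k).1 = (S.box k).1 := by
  rw [← seq_val, ← seq_val]
  refine T.isBoxSeq_seq.eq_of_content_eq S.isBoxSeq_seq ?_ k k.2
  intro j hj
  have h1 := T.seq_val ⟨j, hj⟩
  have h2 := S.seq_val ⟨j, hj⟩
  simp only at h1 h2
  rw [h1, h2, ← content_eq, ← content_eq, h]

theorem shape_eq_of_content_eq {T : StandardTableau lam} {S : StandardTableau mu}
    (h : T.content = S.content) : lam = mu := by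
  apply StrictPartition.ext_boxes
  have h1 := box_eq_of_content_eq h
  ext b
  constructor
  · intro hb
    obtain ⟨k, hk⟩ := T.box.surjective ⟨b, hb⟩
    have : b = (S.box k).1 := by rw [← h1, hk]
    rw [this]
    exact (S.box k).2
  · intro hb
    obtain ⟨k, hk⟩ := S.box.surjective ⟨b, hb⟩
    have : b = (T.box k).1 := by rw [h1, hk]
    rw [this]
    exact (T.box k).2

theorem content_injective :
    Function.Injective (StandardTableau.content : StandardTableau lam → Fin n → ℕ) :=
  fun _ _ h => ext_box (Equiv.ext fun k => Subtype.ext (box_eq_of_content_eq h k))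

theorem exists_of_isBoxSeq {β : ℕ → ℕ × ℕ} (h : IsBoxSeq n β) :
    ∃ (lam : StrictPartition n) (T : StandardTableau lam), ∀ k : Fin n, (T.box k).1 = β k := by
  classical
  obtain ⟨lam, hlam⟩ := StrictPartition.exists_boxes_eq (n := n) ((Finset.range n).image β)
    (by rw [Finset.card_image_of_injOn, Finset.card_range]
        simpa using h.injOn)
    (by intro b hb
        obtain ⟨k, hk, rfl⟩ := Finset.mem_image.1 hb
        exact (h k (Finset.mem_range.1 hk)).1)
    (by intro b hb b' h1 h2
        have := h.lower le_rfl (b := b) (b' := b') (by simpa using hb) h1 h2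
        simpa using this)
  have hmem : ∀ k : Fin n, β k ∈ lam.boxes := fun k => by
    rw [hlam, Finset.mem_coe]
    exact Finset.mem_image_of_mem _ (Finset.mem_range.2 k.2)
  let f : Fin n → lam.boxes := fun k => ⟨β k, hmem k⟩
  have hf : Function.Bijective f := by
    constructor
    · intro k l hkl
      exact Fin.ext (h.injOn k.2 l.2 (Subtype.ext_iff.1 hkl))
    · rintro ⟨b, hb⟩
      have hb' := hb
      rw [hlam, Finset.mem_coe, Finset.mem_image] at hb'
      obtain ⟨k, hk, rfl⟩ := hb'
      exact ⟨⟨k, Finset.mem_range.1 hk⟩, rfl⟩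
  have hlt : ∀ k l : Fin n, β k ≤ β l → β k ≠ β l → k < l := by
    intro k l hle hne
    obtain ⟨j, hj, he⟩ := (h l l.2).2.2 (β k) (h k k.2).1 hle hne
    have := h.injOn (Set.mem_Iio.2 ((Set.mem_Iio.1 hj).trans l.2)) (Set.mem_Iio.2 k.2) he
    rw [Fin.lt_def, ← this]
    exact hj
  refine ⟨lam, ⟨Equiv.ofBijective f hf, ?_, ?_⟩, fun k => rfl⟩
  · intro k l h1 h2
    exact hlt k l ⟨h1.le, h2.le⟩ fun he => (Prod.ext_iff.1 he).2.not_lt h2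
  · intro k l h1 h2
    exact hlt k l ⟨h2.le, h1.le⟩ fun he => (Prod.ext_iff.1 he).1.not_lt h2

/-- The boxes are labelled in lexicographic order, row after row. -/
instance : Nonempty (StandardTableau lam) := by
  classical
  let D : Finset (ℕ ×ₗ ℕ) := (Set.toFinite (toLex '' lam.boxes)).toFinset
  have hmem : ∀ x, x ∈ D ↔ ofLex x ∈ lam.boxes := fun x => by
    simp only [D, Set.Finite.mem_toFinset, Set.mem_image]
    constructor
    · rintro ⟨y, hy, rfl⟩
      exact hy
    · intro h
      exact ⟨_, h, rfl⟩
  have hcard : D.card = n := by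
    rw [← lam.card_boxes, Nat.card_coe_set_eq, ← Set.ncard_image_of_injective _ toLex.injective,
      Set.ncard_eq_toFinset_card _ (Set.toFinite _)]
  let e := D.orderIsoOfFin hcard
  let f : Fin n ≃ lam.boxes := e.toEquiv.trans
    { toFun := fun x => ⟨ofLex x.1, (hmem _).1 x.2⟩
      invFun := fun b => ⟨toLex b.1, (hmem _).2 b.2⟩
      left_inv := fun _ => rfl
      right_inv := fun _ => rfl }
  have hlt : ∀ k l, toLex (f k).1 < toLex (f l).1 → k < l := fun k l h =>
    e.lt_iff_lt.1 h
  refine ⟨⟨f, fun k l h1 h2 => hlt k l ?_, fun k l h1 h2 => hlt k l ?_⟩⟩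
  · exact Prod.Lex.toLex_lt_toLex.2 (Or.inr ⟨h1, h2⟩)
  · exact Prod.Lex.toLex_lt_toLex.2 (Or.inl h2)

section Adjacent

variable (T : StandardTableau lam) {k k' : Fin n} (hk : (k' : ℕ) = k + 1)
include hk

theorem seq_succ : T.seq (k + 1) = (T.box k').1 := by
  rw [← hk, seq_val]

theorem content_ne : T.content k ≠ T.content k' := by
  have := T.isBoxSeq_seq.content_ne (k := k) (by omega)
  rwa [T.seq_succ hk, seq_val] at this

/-- This makes admissibility, a condition on contents, the same as incomparability of the two boxes,
which is what allows their labels to be exchanged. -/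
theorem box_le_iff :
    (T.box k).1 ≤ (T.box k').1 ↔ ¬ HeckeClifford.Admissible T.content k k' := by
  have := T.isBoxSeq_seq.le_iff (k := k) (by omega)
  rw [T.seq_succ hk, seq_val] at this
  rw [this, HeckeClifford.Admissible, content_eq, content_eq]
  tauto

theorem content_eq_zero {k'' : Fin n} (hk' : (k'' : ℕ) = k' + 1)
    (h : T.content k = T.content k'') : T.content k = 0 ∧ T.content k' = 1 := by
  have := T.isBoxSeq_seq.content_eq_zero (k := k) (by omega)
  rw [T.seq_succ hk, show (k : ℕ) + 2 = k' + 1 by omega, T.seq_succ hk', seq_val] at this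
  exact this h

/-- The tableau `s_k T`. -/
def swapAdj (h : HeckeClifford.Admissible T.content k k') : StandardTableau lam where
  box := (Equiv.swap k k').trans T.box
  row_increasing := by
    have hnot : ¬ (T.box k).1 ≤ (T.box k').1 := fun hle => (T.box_le_iff hk).1 hle h
    intro i l h1 h2
    have h3 := T.row_increasing _ _ h1 h2
    by_cases h4 : i = k ∧ l = k'
    · rw [h4.1, h4.2, Fin.lt_def]
      omega
    · by_cases h5 : i = k' ∧ l = k
      · rw [h5.1, h5.2] at h1 h2
        simp only [Equiv.trans_apply, Equiv.swap_apply_left, Equiv.swap_apply_right] at h1 h2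
        exact absurd ⟨h1.le, h2.le⟩ hnot
      · exact (swap_lt_swap_iff hk h4 h5).1 h3
  column_increasing := by
    have hnot : ¬ (T.box k).1 ≤ (T.box k').1 := fun hle => (T.box_le_iff hk).1 hle h
    intro i l h1 h2
    have h3 := T.column_increasing _ _ h1 h2
    by_cases h4 : i = k ∧ l = k'
    · rw [h4.1, h4.2, Fin.lt_def]
      omega
    · by_cases h5 : i = k' ∧ l = k
      · rw [h5.1, h5.2] at h1 h2
        simp only [Equiv.trans_apply, Equiv.swap_apply_left, Equiv.swap_apply_right] at h1 h2
        exact absurd ⟨h2.le, h1.le⟩ hnot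
      · exact (swap_lt_swap_iff hk h4 h5).1 h3

end Adjacent

open Classical in
/-- The tableau `s_k T` if it is standard, and `T` otherwise. -/
noncomputable def move (T : StandardTableau lam) {k k' : Fin n} (hk : (k' : ℕ) = k + 1) :
    StandardTableau lam :=
  if h : HeckeClifford.Admissible T.content k k' then T.swapAdj hk h else T

section Move

variable (T : StandardTableau lam) {k k' : Fin n} (hk : (k' : ℕ) = k + 1)

theorem box_move (h : HeckeClifford.Admissible T.content k k') (j : Fin n) :
    (T.move hk).box j = T.box (Equiv.swap k k' j) := by
  rw [move, dif_pos h]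
  rfl

theorem content_move (h : HeckeClifford.Admissible T.content k k') (j : Fin n) :
    (T.move hk).content j = T.content (Equiv.swap k k' j) := by
  rw [content_eq, box_move T hk h, content_eq]

theorem admissible_move (h : HeckeClifford.Admissible T.content k k') :
    HeckeClifford.Admissible (T.move hk).content k k' := by
  rw [HeckeClifford.Admissible, content_move T hk h, content_move T hk h, Equiv.swap_apply_left,
    Equiv.swap_apply_right]
  exact ⟨h.2, h.1⟩

theorem move_of_not (h : ¬ HeckeClifford.Admissible T.content k k') : T.move hk = T := by
  rw [move, dif_neg h]

theorem move_move : (T.move hk).move hk = T := by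
  by_cases h : HeckeClifford.Admissible T.content k k'
  · apply ext_box
    ext1 j
    rw [box_move _ hk (T.admissible_move hk h), box_move T hk h, Equiv.swap_apply_self]
  · rw [T.move_of_not hk h, T.move_of_not hk h]

theorem move_ne (h : HeckeClifford.Admissible T.content k k') : T.move hk ≠ T := by
  intro he
  have h1 := T.box_move hk h k
  rw [he, Equiv.swap_apply_left] at h1
  have := T.box.injective h1
  rw [Fin.ext_iff] at this
  omega

theorem transition_move (S : StandardTableau lam) (h : HeckeClifford.Admissible S.content k k') :
    T.transition (S.move hk) = Equiv.swap k k' * T.transition S := by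
  ext1 j
  rw [Equiv.Perm.mul_apply, transition, transition, Equiv.trans_apply, Equiv.trans_apply,
    Equiv.symm_apply_eq, box_move S hk h, Equiv.swap_apply_self, Equiv.apply_symm_apply]

theorem transition_self : T.transition T = 1 := Equiv.self_trans_symm _

theorem eq_of_transition {S S' : StandardTableau lam} (h : T.transition S = T.transition S') :
    S = S' := by
  apply ext_box
  have h1 : S.box.symm = S'.box.symm := by
    ext1 b
    have := DFunLike.congr_fun h (T.box.symm b)
    rwa [transition, transition, Equiv.trans_apply, Equiv.trans_apply, Equiv.apply_symm_apply] at this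
  rw [← Equiv.symm_symm S.box, h1, Equiv.symm_symm]

theorem transition_symm_apply (S : StandardTableau lam) (j : Fin n) :
    (T.transition S).symm j = T.box.symm (S.box j) := rfl

include hk in
-- If the transposition is not admissible for `S`, the two boxes are comparable, and then `T` labels
-- them in the same order as `S` does.
theorem admissible_of_descent {S : StandardTableau lam}
    (h : (T.transition S).symm k' < (T.transition S).symm k) :
    HeckeClifford.Admissible S.content k k' := by
  by_contra hadm
  have h1 := (S.box_le_iff hk).2 hadm
  rw [transition_symm_apply, transition_symm_apply] at h
  refine lt_asymm h (T.lt_of_box_le ?_ ?_)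
  · rwa [Equiv.apply_symm_apply, Equiv.apply_symm_apply]
  · exact h.ne'

/-- All tableaux are reached from `T` by admissible transpositions that increase the length. -/
theorem induction_move (p : StandardTableau lam → Prop) (h0 : p T)
    (hstep : ∀ (S : StandardTableau lam) (k k' : Fin n) (hk : (k' : ℕ) = k + 1),
      HeckeClifford.Admissible S.content k k' →
      invCount (T.transition (S.move hk)) = invCount (T.transition S) + 1 → p S → p (S.move hk)) :
    ∀ S, p S := by
  intro S
  induction hl : invCount (T.transition S) using Nat.strong_induction_on generalizing S with
  | _ l ih =>
    by_cases h1 : T.transition S = 1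
    · rw [← T.eq_of_transition (T.transition_self.trans h1.symm)]
      exact h0
    · obtain ⟨k, k', hk, hlt⟩ := exists_descent h1
      have hadm := T.admissible_of_descent hk hlt
      -- At a descent, `S` has one inversion more than the tableau with the two labels exchanged,
      -- which is reached by the induction hypothesis.
      have hinv : invCount (T.transition ((S.move hk).move hk)) =
          invCount (T.transition (S.move hk)) + 1 := by
        rw [transition_move T hk _ (S.admissible_move hk hadm)]
        apply invCount_swap_mul hk
        rw [transition_symm_apply, transition_symm_apply, box_move S hk hadm,
          box_move S hk hadm, Equiv.swap_apply_left, Equiv.swap_apply_right]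
        exact hlt
      have := hstep (S.move hk) k k' hk (S.admissible_move hk hadm) hinv
        (ih _ (by rw [← hl]; rw [S.move_move hk] at hinv; omega) _ rfl)
      rwa [move_move] at this

theorem invCount_move (S : StandardTableau lam) (h : HeckeClifford.Admissible S.content k k') :
    invCount (T.transition (S.move hk)) = invCount (T.transition S) + 1 ∨
      invCount (T.transition S) = invCount (T.transition (S.move hk)) + 1 := by
  have key : ∀ S : StandardTableau lam, HeckeClifford.Admissible S.content k k' →
      (T.transition S).symm k < (T.transition S).symm k' →
      invCount (T.transition (S.move hk)) = invCount (T.transition S) + 1 := fun S h h1 => by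
    rw [transition_move T hk S h, invCount_swap_mul hk h1]
  rcases lt_trichotomy ((T.transition S).symm k) ((T.transition S).symm k') with h1 | h1 | h1
  · exact Or.inl (key S h h1)
  · have := Fin.ext_iff.1 ((T.transition S).symm.injective h1)
    omega
  · right
    have := key (S.move hk) (S.admissible_move hk h) (by
      rw [transition_symm_apply, transition_symm_apply, box_move S hk h,
        box_move S hk h, Equiv.swap_apply_left, Equiv.swap_apply_right]
      exact h1)
    rwa [move_move] at this

end Move

end StandardTableau

/-! ### The operators Ξ and the scalars Ω -/

set_option linter.unusedSectionVars false

namespace WeightRep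

variable {F : Type u} [Field F] {ι : Type v} {a : ι → F} {R : WeightRep.{u, v, w} F ι a}
  {b b' d : ι}

theorem xi_C_left (h : b ≠ b') (v : R.V) : R.xi b b' (R.C b v) = R.C b' (R.xi b b' v) := by
  have := LinearMap.congr_fun (R.xiNum_mul_C_left h) v
  simp only [Module.End.mul_apply] at this
  simp only [xi, LinearMap.neg_apply, LinearMap.smul_apply, map_neg, map_smul, this]

theorem xi_C_right (h : b ≠ b') (v : R.V) : R.xi b b' (R.C b' v) = R.C b (R.xi b b' v) := by
  have := LinearMap.congr_fun (R.xiNum_mul_C_right h) v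
  simp only [Module.End.mul_apply] at this
  simp only [xi, LinearMap.neg_apply, LinearMap.smul_apply, map_neg, map_smul, this]

theorem xi_C (h : d ≠ b) (h' : d ≠ b') (v : R.V) :
    R.xi b b' (R.C d v) = R.C d (R.xi b b' v) := by
  have := LinearMap.congr_fun (R.xiNum_mul_C h h') v
  simp only [Module.End.mul_apply] at this
  simp only [xi, LinearMap.neg_apply, LinearMap.smul_apply, map_neg, map_smul, this]

theorem xi_X (h : d ≠ b) (h' : d ≠ b') (v : R.V) :
    R.xi b b' (R.X d v) = R.X d (R.xi b b' v) := by
  have := LinearMap.congr_fun (R.xiNum_mul_X h h') v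
  simp only [Module.End.mul_apply] at this
  simp only [xi, LinearMap.neg_apply, LinearMap.smul_apply, map_neg, map_smul, this]

theorem xi_X_left (h : b ≠ b') (hab : a b ≠ a b') (v : R.V) :
    R.xi b b' (R.X b v) = R.X b' (R.xi b b' v) - (v + R.C b (R.C b' v)) := by
  have := LinearMap.congr_fun (R.xiNum_mul_X_left h) v
  simp only [Module.End.mul_apply, LinearMap.sub_apply, LinearMap.add_apply,
    LinearMap.smul_apply, Module.End.one_apply] at this
  rw [sub_eq_iff_eq_add] at this
  simp only [xi, LinearMap.neg_apply, LinearMap.smul_apply, map_neg, map_smul, this, smul_add,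
    inv_smul_smul₀ (sub_ne_zero.2 hab)]
  abel

theorem xi_X_right (h : b ≠ b') (hab : a b ≠ a b') (v : R.V) :
    R.xi b b' (R.X b' v) = R.X b (R.xi b b' v) + (v - R.C b (R.C b' v)) := by
  have := LinearMap.congr_fun (R.xiNum_mul_X_right h) v
  simp only [Module.End.mul_apply, LinearMap.sub_apply, LinearMap.neg_apply,
    LinearMap.smul_apply, Module.End.one_apply] at this
  rw [sub_eq_iff_eq_add] at this
  simp only [xi, LinearMap.neg_apply, LinearMap.smul_apply, map_neg, map_smul, this, smul_add,
    smul_neg, inv_smul_smul₀ (sub_ne_zero.2 hab)]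
  abel

theorem P_xi (v : R.V) : R.P (R.xi b b' v) = R.xi b b' (R.P v) := by
  have := LinearMap.congr_fun (R.P_mul_xiNum (b := b) (b' := b')) v
  simp only [Module.End.mul_apply] at this
  simp only [xi, LinearMap.neg_apply, LinearMap.smul_apply, map_neg, map_smul, this]

theorem xi_swap (h : b ≠ b') : R.xi b' b = -R.xi b b' := by
  rw [xi, xi, xiNum_swap h, ← neg_sub, inv_neg, neg_smul]

theorem xi_xi (h : b ≠ b') (v : R.V) :
    R.xi b b' (R.xi b b' v) = (2 * (a b + a b') / (a b - a b') ^ 2) • v := by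
  have := LinearMap.congr_fun (R.xiNum_mul_self h) v
  simp only [Module.End.mul_apply, LinearMap.smul_apply, Module.End.one_apply] at this
  simp only [xi, LinearMap.neg_apply, LinearMap.smul_apply, map_neg, map_smul, this, smul_neg,
    neg_neg, smul_smul]
  congr 1
  rw [div_eq_mul_inv, ← inv_pow]
  ring

theorem xi_comm {b₁ b₂ b₃ b₄ : ι} (h13 : b₁ ≠ b₃) (h14 : b₁ ≠ b₄) (h23 : b₂ ≠ b₃) (h24 : b₂ ≠ b₄)
    (v : R.V) : R.xi b₁ b₂ (R.xi b₃ b₄ v) = R.xi b₃ b₄ (R.xi b₁ b₂ v) := by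
  have := LinearMap.congr_fun (R.xiNum_commute h13 h14 h23 h24) v
  simp only [Module.End.mul_apply] at this
  simp only [xi, LinearMap.neg_apply, LinearMap.smul_apply, map_neg, map_smul, this,
    smul_neg, neg_neg]
  rw [smul_comm]

/-- The braid relation holds for the operators `xi` if the outer weights vanish. -/
theorem xi_braid {b₁ b₂ b₃ : ι} (h12 : b₁ ≠ b₂) (h13 : b₁ ≠ b₃) (h23 : b₂ ≠ b₃) (h1 : a b₁ = 0)
    (h3 : a b₃ = 0) (v : R.V) :
    R.xi b₁ b₂ (R.xi b₂ b₃ (R.xi b₁ b₂ v)) = R.xi b₂ b₃ (R.xi b₁ b₂ (R.xi b₂ b₃ v)) := by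
  have := LinearMap.congr_fun (R.xiNum_braid h12 h13 h23 (h3.trans h1.symm)) v
  simp only [R.X_eq_zero _ h1, R.X_eq_zero _ h3, add_zero, sub_zero, mul_zero, smul_zero,
    LinearMap.zero_apply, LinearMap.add_apply, Module.End.mul_apply] at this
  rw [add_eq_zero_iff_eq_neg] at this
  simp only [xi, LinearMap.neg_apply, LinearMap.smul_apply, map_neg, map_smul, this, h1, h3,
    zero_sub, sub_zero, inv_neg, neg_smul, neg_neg, smul_neg]

end WeightRep

namespace HeckeClifford

variable {F : Type u} [Field F]

theorem q_zero : q F 0 = 0 := by simp [q]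

theorem q_injective [CharZero F] : Function.Injective (q F) := by
  intro i j h
  have h1 : i * (i + 1) = j * (j + 1) := by
    rw [q, q] at h
    exact_mod_cast h
  rcases lt_trichotomy i j with h2 | h2 | h2
  · nlinarith
  · exact h2
  · nlinarith

theorem q_eq_zero [CharZero F] {i : ℕ} : q F i = 0 ↔ i = 0 :=
  ⟨fun h => q_injective (h.trans q_zero.symm), fun h => by rw [h, q_zero]⟩

theorem q_ne [CharZero F] {i j : ℕ} (h : i ≠ j) : q F i ≠ q F j := fun h' => h (q_injective h')

theorem squareRoot_sq [IsAlgClosed F] (x : F) : squareRoot x ^ 2 = x :=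
  (IsAlgClosed.exists_pow_nat_eq x (n := 2) two_pos).choose_spec

theorem squareRoot_eq_zero [IsAlgClosed F] {x : F} : squareRoot x = 0 ↔ x = 0 := by
  rw [← sq_eq_zero_iff, squareRoot_sq]

/-- The scalar `Ω` for two contents. -/
noncomputable def omegaScalar (F : Type u) [Field F] [IsAlgClosed F] (i j : ℕ) : F :=
  squareRoot (1 - 2 * (q F i + q F j) / (q F i - q F j) ^ 2)

theorem omegaScalar_comm [IsAlgClosed F] (i j : ℕ) : omegaScalar F i j = omegaScalar F j i := by
  rw [omegaScalar, omegaScalar, add_comm, ← neg_sub (q F j), neg_sq]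

theorem omegaScalar_sq [IsAlgClosed F] (i j : ℕ) :
    omegaScalar F i j ^ 2 = 1 - 2 * (q F i + q F j) / (q F i - q F j) ^ 2 := squareRoot_sq _

/-- The numerator of `Ω²` factors as (i - j - 1)(i - j + 1)(i + j)(i + j + 2). In characteristic 0
the last factor never vanishes, and `i + j = 0` would force `i = j`. -/
theorem omegaScalar_eq_zero [IsAlgClosed F] [CharZero F] {i j : ℕ} (h : i ≠ j) :
    omegaScalar F i j = 0 ↔ i = j + 1 ∨ j = i + 1 := by
  have hq : (q F i - q F j) ^ 2 ≠ 0 := pow_ne_zero _ (sub_ne_zero.2 (q_ne h))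
  rw [omegaScalar, squareRoot_eq_zero, sub_eq_zero, eq_div_iff hq, one_mul, ← sub_eq_zero]
  have key : (q F i - q F j) ^ 2 - 2 * (q F i + q F j) =
      ((i : F) - (j + 1 : ℕ)) * ((i + 1 : ℕ) - (j : F)) * ((i + j : ℕ) : F) *
        ((i + j + 2 : ℕ) : F) := by
    simp only [q]
    push_cast
    ring
  rw [key, mul_eq_zero, mul_eq_zero, mul_eq_zero, sub_eq_zero, sub_eq_zero, Nat.cast_inj,
    Nat.cast_inj, Nat.cast_eq_zero, Nat.cast_eq_zero]
  omega

end HeckeClifford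

namespace StandardTableau

/-- A box off the main diagonal must be preceded by the diagonal box of its row. -/
theorem content_zero {n : ℕ} {lam : StrictPartition n} (T : StandardTableau lam) {k : Fin n}
    (hk : (k : ℕ) = 0) : T.content k = 0 := by
  obtain ⟨-, -, h⟩ := T.isBoxSeq_seq k k.2
  rw [T.seq_val] at h
  by_contra hne
  rw [content] at hne
  obtain ⟨j, hj, -⟩ := h ((T.box k).1.1, (T.box k).1.1) le_rfl
    ⟨le_rfl, by simp only; omega⟩ (fun he => hne (by rw [← he]; simp))
  rw [Set.mem_Iio] at hj
  omega

end StandardTableau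

/-! ### The operators of the seminormal form -/

/-- The weights of the boxes of a shifted diagram. -/
noncomputable def boxWeight (F : Type u) [Field F] {n : ℕ} (lam : StrictPartition n) :
    lam.boxes → F := fun b => HeckeClifford.q F (boxContent b.1)

namespace SeminormalModel

open HeckeClifford

variable {F : Type u} [Field F] [IsAlgClosed F] [CharZero F] {n : ℕ} {lam : StrictPartition n}
  (R : WeightRep.{u, 0, w} F lam.boxes (boxWeight F lam))

/-- The direct sum of copies of `R`, one for each standard tableau. -/
abbrev Space : Type w := StandardTableau lam → R.V

/-- The parity operator. -/
def opP : Module.End F (Space R) := LinearMap.pi fun T => R.P ∘ₗ LinearMap.proj T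

/-- The action of `c_j`. -/
def opC (j : Fin n) : Module.End F (Space R) :=
  LinearMap.pi fun T => R.C (T.box j) ∘ₗ LinearMap.proj T

/-- The action of `L_j`. -/
def opX (j : Fin n) : Module.End F (Space R) :=
  LinearMap.pi fun T => R.X (T.box j) ∘ₗ LinearMap.proj T

/-- The action of `s_k`. -/
noncomputable def opS {k k' : Fin n} (hk : (k' : ℕ) = k + 1) : Module.End F (Space R) :=
  LinearMap.pi fun T => R.xi (T.box k) (T.box k') ∘ₗ LinearMap.proj T +
    omegaScalar F (T.content k) (T.content k') • LinearMap.proj (T.move hk)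

theorem opP_apply (f : Space R) (T : StandardTableau lam) : opP R f T = R.P (f T) := rfl

theorem opC_apply (j : Fin n) (f : Space R) (T : StandardTableau lam) :
    opC R j f T = R.C (T.box j) (f T) := rfl

theorem opX_apply (j : Fin n) (f : Space R) (T : StandardTableau lam) :
    opX R j f T = R.X (T.box j) (f T) := rfl

theorem opS_apply {k k' : Fin n} (hk : (k' : ℕ) = k + 1) (f : Space R) (T : StandardTableau lam) :
    opS R hk f T = R.xi (T.box k) (T.box k') (f T) +
      omegaScalar F (T.content k) (T.content k') • f (T.move hk) := rfl

theorem box_ne (T : StandardTableau lam) {j k : Fin n} (h : j ≠ k) : T.box j ≠ T.box k :=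
  fun h' => h (T.box.injective h')

section Adjacent

variable {k k' : Fin n} (hk : (k' : ℕ) = k + 1)

theorem adjacent_ne (hk : (k' : ℕ) = k + 1) : k ≠ k' := by
  rw [ne_eq, Fin.ext_iff]
  omega

theorem omegaScalar_of_not (hk : (k' : ℕ) = k + 1) (T : StandardTableau lam)
    (h : ¬ Admissible T.content k k') : omegaScalar F (T.content k) (T.content k') = 0 := by
  rw [omegaScalar_eq_zero (T.content_ne hk)]
  rw [Admissible] at h
  tauto

theorem omegaScalar_ne_zero (hk : (k' : ℕ) = k + 1) (T : StandardTableau lam)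
    (h : Admissible T.content k k') : omegaScalar F (T.content k) (T.content k') ≠ 0 := by
  rw [ne_eq, omegaScalar_eq_zero (T.content_ne hk)]
  rw [Admissible] at h
  tauto

theorem boxWeight_ne (hk : (k' : ℕ) = k + 1) (T : StandardTableau lam) :
    boxWeight F lam (T.box k) ≠ boxWeight F lam (T.box k') := q_ne (T.content_ne hk)

theorem omegaScalar_move (T : StandardTableau lam) :
    omegaScalar F ((T.move hk).content k) ((T.move hk).content k') =
      omegaScalar F (T.content k) (T.content k') := by
  by_cases h : Admissible T.content k k'
  · rw [T.content_move hk h, T.content_move hk h, Equiv.swap_apply_left, Equiv.swap_apply_right,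
      omegaScalar_comm]
  · rw [T.move_of_not hk h]

theorem opS_opP (f : Space R) : opP R (opS R hk f) = opS R hk (opP R f) := by
  ext T
  simp only [opS_apply, opP_apply, map_add, map_smul, R.P_xi]

theorem opS_opC (j : Fin n) (f : Space R) :
    opS R hk (opC R j f) = opC R (Equiv.swap k k' j) (opS R hk f) := by
  ext T
  have hne := adjacent_ne hk
  -- If the transposition is not admissible, `T.move hk` has the default value `T`, which would give
  -- the wrong box; the vanishing of `Ω` makes this irrelevant. The same device occurs in the
  -- relations below.
  have h1 : omegaScalar F (T.content k) (T.content k') •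
      R.C ((T.move hk).box j) (f (T.move hk)) = omegaScalar F (T.content k) (T.content k') •
      R.C (T.box (Equiv.swap k k' j)) (f (T.move hk)) := by
    by_cases h : Admissible T.content k k'
    · rw [T.box_move hk h]
    · rw [omegaScalar_of_not hk T h, zero_smul, zero_smul]
  simp only [opS_apply, opC_apply, map_add, map_smul, h1]
  congr 1
  by_cases h : j = k
  · rw [h, Equiv.swap_apply_left, R.xi_C_left (box_ne T hne)]
  · by_cases h' : j = k'
    · rw [h', Equiv.swap_apply_right, R.xi_C_right (box_ne T hne)]
    · rw [Equiv.swap_apply_of_ne_of_ne h h', R.xi_C (box_ne T h) (box_ne T h')]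

/-- The mixed terms cancel, since `Ω` is symmetric in the two contents and `Ξ` changes sign when the
two labels are exchanged. What remains is Ξ² + Ω² = 1. -/
theorem opS_opS (f : Space R) : opS R hk (opS R hk f) = f := by
  ext T
  have hne := adjacent_ne hk
  have h1 : omegaScalar F (T.content k) (T.content k') •
      R.xi ((T.move hk).box k) ((T.move hk).box k') (f (T.move hk)) =
      -(omegaScalar F (T.content k) (T.content k') •
      R.xi (T.box k) (T.box k') (f (T.move hk))) := by
    by_cases h : Admissible T.content k k'
    · rw [T.box_move hk h, T.box_move hk h, Equiv.swap_apply_left, Equiv.swap_apply_right,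
        R.xi_swap (box_ne T hne), LinearMap.neg_apply, smul_neg]
    · rw [omegaScalar_of_not hk T h, zero_smul, zero_smul, neg_zero]
  simp only [opS_apply, map_add, map_smul, smul_add, h1, omegaScalar_move, T.move_move hk,
    R.xi_xi (box_ne T hne)]
  rw [smul_smul, ← sq, omegaScalar_sq]
  simp only [boxWeight, ← StandardTableau.content_eq]
  module

theorem opS_opX_of_ne {j : Fin n} (h : j ≠ k) (h' : j ≠ k') (f : Space R) :
    opS R hk (opX R j f) = opX R j (opS R hk f) := by
  ext T
  have h1 : omegaScalar F (T.content k) (T.content k') •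
      R.X ((T.move hk).box j) (f (T.move hk)) = omegaScalar F (T.content k) (T.content k') •
      R.X (T.box j) (f (T.move hk)) := by
    by_cases hadm : Admissible T.content k k'
    · rw [T.box_move hk hadm, Equiv.swap_apply_of_ne_of_ne h h']
    · rw [omegaScalar_of_not hk T hadm, zero_smul, zero_smul]
  simp only [opS_apply, opX_apply, map_add, map_smul, h1, R.xi_X (box_ne T h) (box_ne T h')]

theorem opS_opX_left (f : Space R) :
    opS R hk (opX R k f) = opX R k' (opS R hk f) - (f + opC R k (opC R k' f)) := by
  ext T
  have h1 : omegaScalar F (T.content k) (T.content k') •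
      R.X ((T.move hk).box k) (f (T.move hk)) = omegaScalar F (T.content k) (T.content k') •
      R.X (T.box k') (f (T.move hk)) := by
    by_cases hadm : Admissible T.content k k'
    · rw [T.box_move hk hadm, Equiv.swap_apply_left]
    · rw [omegaScalar_of_not hk T hadm, zero_smul, zero_smul]
  simp only [opS_apply, opX_apply, opC_apply, Pi.sub_apply, Pi.add_apply, map_add, map_smul, h1,
    R.xi_X_left (box_ne T (adjacent_ne hk)) (boxWeight_ne hk T)]
  abel

theorem opS_opX_right (f : Space R) :
    opS R hk (opX R k' f) = opX R k (opS R hk f) + (f - opC R k (opC R k' f)) := by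
  ext T
  have h1 : omegaScalar F (T.content k) (T.content k') •
      R.X ((T.move hk).box k') (f (T.move hk)) = omegaScalar F (T.content k) (T.content k') •
      R.X (T.box k) (f (T.move hk)) := by
    by_cases hadm : Admissible T.content k k'
    · rw [T.box_move hk hadm, Equiv.swap_apply_right]
    · rw [omegaScalar_of_not hk T hadm, zero_smul, zero_smul]
  simp only [opS_apply, opX_apply, opC_apply, Pi.sub_apply, Pi.add_apply, map_add, map_smul, h1,
    R.xi_X_right (box_ne T (adjacent_ne hk)) (boxWeight_ne hk T)]
  abel

end Adjacent

theorem move_content_of_ne (T : StandardTableau lam) {k k' j : Fin n} (hk : (k' : ℕ) = k + 1)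
    (h : j ≠ k) (h' : j ≠ k') : (T.move hk).content j = T.content j := by
  by_cases hadm : Admissible T.content k k'
  · rw [T.content_move hk hadm, Equiv.swap_apply_of_ne_of_ne h h']
  · rw [T.move_of_not hk hadm]

theorem move_box_of_ne (T : StandardTableau lam) {k k' j : Fin n} (hk : (k' : ℕ) = k + 1)
    (h : j ≠ k) (h' : j ≠ k') : (T.move hk).box j = T.box j := by
  by_cases hadm : Admissible T.content k k'
  · rw [T.box_move hk hadm, Equiv.swap_apply_of_ne_of_ne h h']
  · rw [T.move_of_not hk hadm]

theorem move_comm (T : StandardTableau lam) {k k' l l' : Fin n} (hk : (k' : ℕ) = k + 1)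
    (hl : (l' : ℕ) = l + 1) (hkl : (k' : ℕ) < l) :
    (T.move hk).move hl = (T.move hl).move hk := by
  have n1 : l ≠ k := by rw [ne_eq, Fin.ext_iff]; omega
  have n2 : l ≠ k' := by rw [ne_eq, Fin.ext_iff]; omega
  have n3 : l' ≠ k := by rw [ne_eq, Fin.ext_iff]; omega
  have n4 : l' ≠ k' := by rw [ne_eq, Fin.ext_iff]; omega
  have e1 : Admissible (T.move hl).content k k' ↔ Admissible T.content k k' := by
    rw [Admissible, move_content_of_ne T hl n1.symm n3.symm, move_content_of_ne T hl n2.symm n4.symm,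
      Admissible]
  have e2 : Admissible (T.move hk).content l l' ↔ Admissible T.content l l' := by
    rw [Admissible, move_content_of_ne T hk n1 n2, move_content_of_ne T hk n3 n4, Admissible]
  by_cases h1 : Admissible T.content k k'
  · by_cases h2 : Admissible T.content l l'
    · apply StandardTableau.ext_box
      ext1 j
      rw [StandardTableau.box_move _ hl (e2.2 h2), StandardTableau.box_move _ hk h1,
        StandardTableau.box_move _ hk (e1.2 h1), StandardTableau.box_move _ hl h2]
      congr 1
      have hcomm : Equiv.swap k k' * Equiv.swap l l' = Equiv.swap l l' * Equiv.swap k k' :=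
        Equiv.Perm.Disjoint.commute (Equiv.Perm.disjoint_swap_swap (by
          simp [n1.symm, n2.symm, n3.symm, n4.symm, adjacent_ne hk, adjacent_ne hl]))
      exact DFunLike.congr_fun hcomm j
    · rw [T.move_of_not hl h2, StandardTableau.move_of_not _ hl (mt e2.1 h2)]
  · rw [T.move_of_not hk h1, StandardTableau.move_of_not _ hk (mt e1.1 h1)]

theorem opS_comm {k k' l l' : Fin n} (hk : (k' : ℕ) = k + 1) (hl : (l' : ℕ) = l + 1)
    (hkl : (k' : ℕ) < l) (f : Space R) : opS R hk (opS R hl f) = opS R hl (opS R hk f) := by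
  have n1 : l ≠ k := by rw [ne_eq, Fin.ext_iff]; omega
  have n2 : l ≠ k' := by rw [ne_eq, Fin.ext_iff]; omega
  have n3 : l' ≠ k := by rw [ne_eq, Fin.ext_iff]; omega
  have n4 : l' ≠ k' := by rw [ne_eq, Fin.ext_iff]; omega
  ext T
  simp only [opS_apply, map_add, map_smul, smul_add, move_comm T hk hl hkl,
    move_content_of_ne T hk n1 n2, move_content_of_ne T hk n3 n4,
    move_content_of_ne T hl n1.symm n3.symm, move_content_of_ne T hl n2.symm n4.symm,
    move_box_of_ne T hk n1 n2, move_box_of_ne T hk n3 n4,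
    move_box_of_ne T hl n1.symm n3.symm, move_box_of_ne T hl n2.symm n4.symm,
    R.xi_comm (box_ne T n1.symm) (box_ne T n3.symm) (box_ne T n2.symm) (box_ne T n4.symm)]
  rw [smul_comm]
  abel

end SeminormalModel

/-! ### The braid relation and the action of the symmetric group -/

set_option linter.unusedSectionVars false

namespace SeminormalModel

open HeckeClifford

variable {F : Type u} [Field F] [IsAlgClosed F] [CharZero F] {n : ℕ} {lam : StrictPartition n}
  (R : WeightRep.{u, 0, w} F lam.boxes (boxWeight F lam))

section Braid

variable {k k' k'' : Fin n} (hk : (k' : ℕ) = k + 1) (hk' : (k'' : ℕ) = k' + 1)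

/-- The operators whose equality is the braid relation. -/
noncomputable def braidDiff : Module.End F (Space R) :=
  opS R hk * opS R hk' * opS R hk - opS R hk' * opS R hk * opS R hk'

theorem braidDiff_apply (f : Space R) : braidDiff R hk hk' f =
    opS R hk (opS R hk' (opS R hk f)) - opS R hk' (opS R hk (opS R hk' f)) := rfl

/-- The corrections that arise when `opX` is moved through three transpositions are the same for
both sides of the braid relation and cancel in the difference. So the difference intertwines,
although its two terms do not. -/
theorem braidDiff_opX (j : Fin n) (f : Space R) :
    braidDiff R hk hk' (opX R j f) = opX R (Equiv.swap k k'' j) (braidDiff R hk hk' f) := by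
  have n12 : k ≠ k' := adjacent_ne hk
  have n23 : k' ≠ k'' := adjacent_ne hk'
  have n13 : k ≠ k'' := by rw [ne_eq, Fin.ext_iff]; omega
  have c1 : Equiv.swap k k' k'' = k'' := Equiv.swap_apply_of_ne_of_ne n13.symm n23.symm
  have c2 : Equiv.swap k' k'' k = k := Equiv.swap_apply_of_ne_of_ne n12 n13
  simp only [braidDiff_apply]
  by_cases h1 : j = k
  · subst h1
    simp only [Equiv.swap_apply_left, opS_opX_left, opS_opX_of_ne R hk n13.symm n23.symm,
      opS_opX_of_ne R hk' n12 n13, map_sub, map_add, opS_opC, opS_opS, c1, c2,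
      Equiv.swap_apply_right]
    abel
  · by_cases h2 : j = k'
    · subst h2
      rw [Equiv.swap_apply_of_ne_of_ne n12.symm n23]
      simp only [Equiv.swap_apply_left, opS_opX_left, opS_opX_right,
        opS_opX_of_ne R hk n13.symm n23.symm,
        opS_opX_of_ne R hk' n12 n13, map_sub, map_add, opS_opC, c1, c2,
        Equiv.swap_apply_right]
      abel
    · by_cases h3 : j = k''
      · subst h3
        simp only [Equiv.swap_apply_left, opS_opX_right, opS_opX_of_ne R hk n13.symm n23.symm,
          opS_opX_of_ne R hk' n12 n13, map_sub, map_add, opS_opC, opS_opS, c1, c2,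
          Equiv.swap_apply_right]
        abel
      · rw [Equiv.swap_apply_of_ne_of_ne h1 h3]
        simp only [opS_opX_of_ne R hk h1 h2, opS_opX_of_ne R hk' h2 h3, map_sub]

variable {R}

/-- `f` is supported at the tableau `T`. -/
def SupportedAt (T : StandardTableau lam) (f : Space R) : Prop := ∀ S, S ≠ T → f S = 0

theorem opX_opX_of_supportedAt {T : StandardTableau lam} {f : Space R} (hf : SupportedAt T f)
    (j : Fin n) : opX R j (opX R j f) = q F (T.content j) • f := by
  ext S
  have := LinearMap.congr_fun (R.X_mul_self (S.box j)) (f S)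
  rw [Module.End.mul_apply] at this
  rw [opX_apply, opX_apply, this, Pi.smul_apply]
  by_cases h : S = T
  · rw [h]
    rfl
  · rw [hf S h, smul_zero, map_zero]

/-- The squares of the `opX` act on each summand by scalars that separate contents, and by
`braidDiff_opX` the difference permutes these scalars by `(k k'')`. -/
theorem braidDiff_eq_zero_of_ne {T S : StandardTableau lam} {f : Space R} (hf : SupportedAt T f)
    {j : Fin n} (h : T.content j ≠ S.content (Equiv.swap k k'' j)) :
    braidDiff R hk hk' f S = 0 := by
  have h1 := congrFun (congrArg (braidDiff R hk hk') (opX_opX_of_supportedAt hf j)) S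
  rw [braidDiff_opX, braidDiff_opX, map_smul, opX_apply, opX_apply, Pi.smul_apply] at h1
  have := LinearMap.congr_fun (R.X_mul_self (S.box (Equiv.swap k k'' j)))
    (braidDiff R hk hk' f S)
  rw [Module.End.mul_apply, h1, ← sub_eq_zero, LinearMap.smul_apply, Module.End.one_apply,
    ← sub_smul, smul_eq_zero] at this
  exact this.resolve_left (sub_ne_zero.2 (q_ne h))

theorem eq_zero_of_content_ne {T S : StandardTableau lam} {f : Space R} (hf : SupportedAt T f)
    (j : Fin n) (h : S.content j ≠ T.content j) : f S = 0 :=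
  hf S fun h' => h (by rw [h'])

theorem opS_eq_zero_of_content_ne {T S : StandardTableau lam} {f : Space R} (hf : SupportedAt T f)
    {j : Fin n} (h1 : j ≠ k) (h2 : j ≠ k') (h : S.content j ≠ T.content j) :
    opS R hk f S = 0 := by
  rw [opS_apply, eq_zero_of_content_ne hf j h, map_zero, zero_add,
    eq_zero_of_content_ne hf j (by rwa [move_content_of_ne S hk h1 h2]), smul_zero]

theorem opS_of_content_ne {S : StandardTableau lam} {f : Space R} (hf : f S = 0) :
    opS R hk f S = omegaScalar F (S.content k) (S.content k') • f (S.move hk) := by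
  rw [opS_apply, hf, map_zero, zero_add]

/-- The leading coefficient of `s_k s_k' s_k`. -/
theorem opS_opS_opS {T S : StandardTableau lam} {f : Space R} (hf : SupportedAt T f)
    (h : ∀ j, T.content j = S.content (Equiv.swap k k'' j)) (hne : S.content k ≠ S.content k'') :
    opS R hk (opS R hk' (opS R hk f)) S =
      (omegaScalar F (S.content k) (S.content k') * omegaScalar F (S.content k) (S.content k'') *
        omegaScalar F (S.content k') (S.content k'')) • f T := by
  have n12 : k ≠ k' := adjacent_ne hk
  have n23 : k' ≠ k'' := adjacent_ne hk'
  have n13 : k ≠ k'' := by rw [ne_eq, Fin.ext_iff]; omega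
  have e1 : T.content k = S.content k'' := by rw [h, Equiv.swap_apply_left]
  have e2 : T.content k' = S.content k' := by
    rw [h, Equiv.swap_apply_of_ne_of_ne n12.symm n23]
  have e3 : T.content k'' = S.content k := by rw [h, Equiv.swap_apply_right]
  have hc23 := S.content_ne hk'
  have hc12 := S.content_ne hk
  -- The first factor does not change the content at `k''`. This removes the `xi` terms of the two
  -- outer factors.
  have third : ∀ S' : StandardTableau lam, S'.content k'' ≠ S.content k → opS R hk f S' = 0 :=
    fun S' h' => opS_eq_zero_of_content_ne hk hf n13.symm n23.symm (by rwa [e3])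
  have z1 : opS R hk' (opS R hk f) S = 0 := by
    rw [opS_apply, third S hne.symm, map_zero, zero_add]
    by_cases hadm : Admissible S.content k' k''
    · rw [third, smul_zero]
      rw [S.content_move hk' hadm, Equiv.swap_apply_right]
      exact hc12.symm
    · rw [omegaScalar_of_not hk' S hadm, zero_smul]
  rw [opS_of_content_ne hk z1, mul_assoc, mul_smul]
  by_cases hadm : Admissible S.content k k'
  swap
  · rw [omegaScalar_of_not hk S hadm, zero_smul, zero_smul]
  congr 1
  have m1 := S.content_move hk hadm
  have m1k : (S.move hk).content k = S.content k' := by rw [m1, Equiv.swap_apply_left]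
  have m1k' : (S.move hk).content k' = S.content k := by rw [m1, Equiv.swap_apply_right]
  have m1k'' : (S.move hk).content k'' = S.content k'' := by
    rw [m1, Equiv.swap_apply_of_ne_of_ne n13.symm n23.symm]
  rw [opS_of_content_ne hk' (third _ (by rw [m1k'']; exact hne.symm)), m1k', m1k'', mul_smul]
  by_cases hadm' : Admissible (S.move hk).content k' k''
  swap
  · have := omegaScalar_of_not (F := F) hk' _ hadm'
    rw [m1k', m1k''] at this
    rw [this, zero_smul, zero_smul]
  congr 1
  have m2 := (S.move hk).content_move hk' hadm'
  have m2k : ((S.move hk).move hk').content k = S.content k' := by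
    rw [m2, Equiv.swap_apply_of_ne_of_ne n12 n13, m1k]
  have m2k' : ((S.move hk).move hk').content k' = S.content k'' := by
    rw [m2, Equiv.swap_apply_left, m1k'']
  rw [opS_of_content_ne hk (eq_zero_of_content_ne hf k (by rwa [m2k, e1])), m2k, m2k']
  by_cases hadm'' : Admissible ((S.move hk).move hk').content k k'
  swap
  · have := omegaScalar_of_not (F := F) hk _ hadm''
    rw [m2k, m2k'] at this
    rw [this, zero_smul, zero_smul]
  congr 2
  apply StandardTableau.content_injective
  ext j
  rw [StandardTableau.content_move _ hk hadm'', m2, m1, h]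
  congr 1
  have : Equiv.swap k k' * Equiv.swap k' k'' * Equiv.swap k k' = Equiv.swap k k'' := by
    rw [Equiv.swap_comm k k', Equiv.swap_comm k' k'',
      Equiv.swap_mul_swap_mul_swap n23.symm n13.symm]
  exact DFunLike.congr_fun this j

/-- The leading coefficient of `s_k' s_k s_k'`. -/
theorem opS_opS_opS' {T S : StandardTableau lam} {f : Space R} (hf : SupportedAt T f)
    (h : ∀ j, T.content j = S.content (Equiv.swap k k'' j)) (hne : S.content k ≠ S.content k'') :
    opS R hk' (opS R hk (opS R hk' f)) S =
      (omegaScalar F (S.content k') (S.content k'') * omegaScalar F (S.content k) (S.content k'') *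
        omegaScalar F (S.content k) (S.content k')) • f T := by
  have n12 : k ≠ k' := adjacent_ne hk
  have n23 : k' ≠ k'' := adjacent_ne hk'
  have n13 : k ≠ k'' := by rw [ne_eq, Fin.ext_iff]; omega
  have e1 : T.content k = S.content k'' := by rw [h, Equiv.swap_apply_left]
  have e3 : T.content k'' = S.content k := by rw [h, Equiv.swap_apply_right]
  have hc23 := S.content_ne hk'
  have hc12 := S.content_ne hk
  have first : ∀ S' : StandardTableau lam, S'.content k ≠ S.content k'' → opS R hk' f S' = 0 :=
    fun S' h' => opS_eq_zero_of_content_ne hk' hf n12 n13 (by rwa [e1])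
  have z1 : opS R hk (opS R hk' f) S = 0 := by
    rw [opS_apply, first S hne, map_zero, zero_add]
    by_cases hadm : Admissible S.content k k'
    · rw [first, smul_zero]
      rw [S.content_move hk hadm, Equiv.swap_apply_left]
      exact hc23
    · rw [omegaScalar_of_not hk S hadm, zero_smul]
  rw [opS_of_content_ne hk' z1, mul_assoc, mul_smul]
  by_cases hadm : Admissible S.content k' k''
  swap
  · rw [omegaScalar_of_not hk' S hadm, zero_smul, zero_smul]
  congr 1
  have m1 := S.content_move hk' hadm
  have m1k : (S.move hk').content k = S.content k := by
    rw [m1, Equiv.swap_apply_of_ne_of_ne n12 n13]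
  have m1k' : (S.move hk').content k' = S.content k'' := by rw [m1, Equiv.swap_apply_left]
  have m1k'' : (S.move hk').content k'' = S.content k' := by rw [m1, Equiv.swap_apply_right]
  rw [opS_of_content_ne hk (first _ (by rwa [m1k])), m1k, m1k', mul_smul]
  by_cases hadm' : Admissible (S.move hk').content k k'
  swap
  · have := omegaScalar_of_not (F := F) hk _ hadm'
    rw [m1k, m1k'] at this
    rw [this, zero_smul, zero_smul]
  congr 1
  have m2 := (S.move hk').content_move hk hadm'
  have m2k' : ((S.move hk').move hk).content k' = S.content k := by
    rw [m2, Equiv.swap_apply_right, m1k]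
  have m2k'' : ((S.move hk').move hk).content k'' = S.content k' := by
    rw [m2, Equiv.swap_apply_of_ne_of_ne n13.symm n23.symm, m1k'']
  rw [opS_of_content_ne hk' (eq_zero_of_content_ne hf k'' (by rw [m2k'', e3]; exact hc12.symm)),
    m2k', m2k'']
  by_cases hadm'' : Admissible ((S.move hk').move hk).content k' k''
  swap
  · have := omegaScalar_of_not (F := F) hk' _ hadm''
    rw [m2k', m2k''] at this
    rw [this, zero_smul, zero_smul]
  congr 2
  apply StandardTableau.content_injective
  ext j
  rw [StandardTableau.content_move _ hk' hadm'', m2, m1, h]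
  congr 1
  have : Equiv.swap k' k'' * Equiv.swap k k' * Equiv.swap k' k'' = Equiv.swap k k'' := by
    rw [Equiv.swap_mul_swap_mul_swap n12 n13, Equiv.swap_comm]
  exact DFunLike.congr_fun this j

/-- Only components at tableaux `S` whose contents are those of `T` permuted by `(k k'')` need
attention. If the contents at `k` and `k''` differ, only the leading terms contribute, and these are
equal products of three `Ω`. If they agree, the contents are 0, 1, 0; then neither transposition is
admissible, and the relation is the one for the operators `xi`. -/
theorem braidDiff_eq_zero : braidDiff R hk hk' = 0 := by
  classical
  cases nonempty_fintype (StandardTableau lam)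
  refine LinearMap.pi_ext fun T v => ?_
  ext S
  rw [LinearMap.zero_apply, Pi.zero_apply]
  have hf : SupportedAt (R := R) T (Pi.single T v) := fun S hS => Pi.single_eq_of_ne hS _
  by_cases h : ∀ j, T.content j = S.content (Equiv.swap k k'' j)
  · rw [braidDiff_apply, Pi.sub_apply]
    by_cases hne : S.content k = S.content k''
    · obtain ⟨h0, h1⟩ := S.content_eq_zero hk hk' hne
      have a1 : ¬ Admissible S.content k k' := by
        rw [Admissible]
        omega
      have a2 : ¬ Admissible S.content k' k'' := by
        rw [Admissible]
        omega
      have n12 : k ≠ k' := adjacent_ne hk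
      have n23 : k' ≠ k'' := adjacent_ne hk'
      have n13 : k ≠ k'' := by rw [ne_eq, Fin.ext_iff]; omega
      have z1 : ∀ f : Space R, opS R hk f S = R.xi (S.box k) (S.box k') (f S) := fun f => by
        rw [opS_apply, omegaScalar_of_not hk S a1, zero_smul, add_zero]
      have z2 : ∀ f : Space R, opS R hk' f S = R.xi (S.box k') (S.box k'') (f S) := fun f => by
        rw [opS_apply, omegaScalar_of_not hk' S a2, zero_smul, add_zero]
      simp only [z1, z2]
      rw [R.xi_braid (box_ne S n12) (box_ne S n13) (box_ne S n23) (q_eq_zero.2 h0)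
        (q_eq_zero.2 (hne.symm.trans h0)), sub_self]
    · rw [opS_opS_opS hk hk' hf h hne, opS_opS_opS' hk hk' hf h hne, ← sub_smul]
      rw [show ∀ x y z : F, x * y * z - z * y * x = 0 by intros; ring, zero_smul]
  · push Not at h
    obtain ⟨j, hj⟩ := h
    exact braidDiff_eq_zero_of_ne hk hk' hf hj

end Braid

/-- The operator `s_k` as a unit, and `1` for `k` out of range. -/
noncomputable def unitS (i : ℕ) : (Module.End F (Space R))ˣ :=
  if h : i + 1 < n then
    { val := opS R (k := ⟨i, by omega⟩) (k' := ⟨i + 1, h⟩) rfl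
      inv := opS R (k := ⟨i, by omega⟩) (k' := ⟨i + 1, h⟩) rfl
      val_inv := LinearMap.ext fun f => opS_opS R _ f
      inv_val := LinearMap.ext fun f => opS_opS R _ f }
  else 1

theorem unitS_val {i : ℕ} (h : i + 1 < n) :
    (unitS R i : Module.End F (Space R)) = opS R (k := ⟨i, by omega⟩) (k' := ⟨i + 1, h⟩) rfl := by
  rw [unitS, dif_pos h]

theorem isCoxeterFamily_unitS {m : ℕ} (hm : n = m + 1) : IsCoxeterFamily (unitS R) m where
  mul_self i hi := by
    ext1
    rw [Units.val_mul, unitS_val R (by omega)]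
    exact LinearMap.ext fun f => opS_opS R _ f
  comm i j hj hij := by
    ext1
    rw [Units.val_mul, Units.val_mul, unitS_val R (by omega), unitS_val R (by omega)]
    exact LinearMap.ext fun f => opS_comm R _ _ hij f
  braid i hi := by
    ext1
    simp only [Units.val_mul]
    rw [unitS_val R (by omega), unitS_val R (by omega), ← sub_eq_zero]
    exact braidDiff_eq_zero (R := R) (k := ⟨i, by omega⟩) (k' := ⟨i + 1, by omega⟩)
      (k'' := ⟨i + 2, by omega⟩) rfl rfl

theorem exists_permHom : ∃ ρ : Equiv.Perm (Fin n) →* Module.End F (Space R),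
    ∀ (k k' : Fin n) (hk : (k' : ℕ) = k + 1), ρ (Equiv.swap k k') = opS R hk := by
  rcases n with _ | m
  · exact ⟨1, fun k => k.elim0⟩
  · obtain ⟨f, hf⟩ := exists_perm_hom_of_isCoxeterFamily _ (isCoxeterFamily_unitS R rfl)
    refine ⟨(Units.coeHom _).comp f, fun k k' hk => ?_⟩
    obtain ⟨k', h'⟩ := k'
    simp only at hk
    subst hk
    have := hf ⟨k, by omega⟩
    change (f (Equiv.swap (⟨k, by omega⟩ : Fin m).castSucc (⟨k, by omega⟩ : Fin m).succ)).val = _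
    rw [this, unitS_val R h']

/-- The action of the symmetric group. -/
noncomputable def permHom : Equiv.Perm (Fin n) →* Module.End F (Space R) :=
  (exists_permHom R).choose

theorem permHom_swap {k k' : Fin n} (hk : (k' : ℕ) = k + 1) :
    permHom R (Equiv.swap k k') = opS R hk := (exists_permHom R).choose_spec k k' hk

end SeminormalModel

set_option linter.unusedSectionVars false

/-! ### Gradings in terms of parity operators -/

section Parity

variable {F : Type u} [Field F] [NeZero (2 : F)] {V : Type v} [AddCommGroup V] [Module F V]

/-- The eigenspaces of an involution form a `ℤ/2`-grading. -/
def signEigenspace (P : Module.End F V) (d : ZMod 2) : Submodule F V where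
  carrier := {z | P z = (-1 : F) ^ d.val • z}
  add_mem' := by
    intro y z (hy : P y = _) (hz : P z = _)
    change P (y + z) = _
    rw [map_add, hy, hz, smul_add]
  zero_mem' := by
    change P 0 = _
    simp
  smul_mem' := by
    intro r z (hz : P z = _)
    change P (r • z) = _
    rw [map_smul, hz, smul_comm]

theorem mem_signEigenspace {P : Module.End F V} {d : ZMod 2} {z : V} :
    z ∈ signEigenspace P d ↔ P z = (-1 : F) ^ d.val • z := Iff.rfl

theorem signEigenspace_isInternal {P : Module.End F V} (hP : P * P = 1) :
    DirectSum.IsInternal (signEigenspace P) := by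
  have h2 : (2 : F) ≠ 0 := NeZero.ne _
  have hPP : ∀ z, P (P z) = z := fun z => LinearMap.congr_fun hP z
  rw [DirectSum.isInternal_submodule_iff_isCompl (signEigenspace P) (i := 0) (j := 1) (by decide)
    (by ext d; simpa using HeckeClifford.zmod_two_cases d)]
  constructor
  · rw [Submodule.disjoint_def]
    intro z h0 h1
    rw [mem_signEigenspace] at h0 h1
    rw [h0] at h1
    simp only [ZMod.val_zero, pow_zero, one_smul, ZMod.val_one, pow_one, neg_smul] at h1
    have : (2 : F) • z = 0 := by rw [two_smul]; nth_rewrite 1 [h1]; exact neg_add_cancel z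
    exact (smul_eq_zero.1 this).resolve_left h2
  · rw [codisjoint_iff, eq_top_iff]
    intro z _
    have hz : z = (2 : F)⁻¹ • (z + P z) + (2 : F)⁻¹ • (z - P z) := by
      rw [← smul_add, add_add_sub_cancel, ← two_smul F z, inv_smul_smul₀ h2]
    rw [hz]
    refine Submodule.add_mem_sup ?_ ?_
    · rw [mem_signEigenspace, map_smul, map_add, hPP]
      simp [add_comm]
    · rw [mem_signEigenspace, map_smul, map_sub, hPP, ZMod.val_one, pow_one, neg_one_smul,
        ← smul_neg, neg_sub]

end Parity

namespace SuperModule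

variable {F : Type u} [Field F] {A : Type v} [Ring A] [Algebra F A]
  {𝒜 : ZMod 2 → Submodule F A} [GradedAlgebra 𝒜] (M : SuperModule.{u, v, w} F 𝒜)

theorem isCompl_gr : IsCompl (M.gr 0) (M.gr 1) :=
  (DirectSum.isInternal_submodule_iff_isCompl M.gr (i := 0) (j := 1) (by decide)
    (by ext d; simpa using HeckeClifford.zmod_two_cases d)).1 M.isInternal

/-- The parity operator of a supermodule. -/
noncomputable def parityOp : Module.End F M.carrier :=
  LinearMap.ofIsCompl M.isCompl_gr (M.gr 0).subtype (-(M.gr 1).subtype)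

variable {M}

theorem parityOp_of_mem {d : ZMod 2} {z : M.carrier} (hz : z ∈ M.gr d) :
    M.parityOp z = (-1 : F) ^ d.val • z := by
  rcases HeckeClifford.zmod_two_cases d with rfl | rfl
  · rw [parityOp]
    simpa using LinearMap.ofIsCompl_apply_left M.isCompl_gr (φ := (M.gr 0).subtype)
      (ψ := -(M.gr 1).subtype) ⟨z, hz⟩
  · rw [parityOp]
    simpa [ZMod.val_one] using LinearMap.ofIsCompl_apply_right M.isCompl_gr
      (φ := (M.gr 0).subtype) (ψ := -(M.gr 1).subtype) ⟨z, hz⟩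

theorem exists_even_add_odd (z : M.carrier) : ∃ x ∈ M.gr 0, ∃ y ∈ M.gr 1, x + y = z :=
  Submodule.mem_sup.1 (M.isCompl_gr.sup_eq_top ▸ Submodule.mem_top)

theorem parityOp_even {z : M.carrier} (hz : z ∈ M.gr 0) : M.parityOp z = z := by
  simpa using parityOp_of_mem hz

theorem parityOp_odd {z : M.carrier} (hz : z ∈ M.gr 1) : M.parityOp z = -z := by
  simpa [ZMod.val_one] using parityOp_of_mem hz

theorem parityOp_parityOp (z : M.carrier) : M.parityOp (M.parityOp z) = z := by
  obtain ⟨x, hx, y, hy, rfl⟩ := exists_even_add_odd z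
  simp [parityOp_even hx, parityOp_odd hy]

section

variable [NeZero (2 : F)]

theorem mem_gr_zero_iff {z : M.carrier} : z ∈ M.gr 0 ↔ M.parityOp z = z := by
  refine ⟨parityOp_even, fun h => ?_⟩
  obtain ⟨x, hx, y, hy, rfl⟩ := exists_even_add_odd z
  rw [map_add, parityOp_even hx, parityOp_odd hy, add_right_inj, neg_eq_iff_add_eq_zero,
    ← two_smul F] at h
  rw [(smul_eq_zero.1 h).resolve_left (NeZero.ne _), add_zero]
  exact hx

theorem mem_gr_one_iff {z : M.carrier} : z ∈ M.gr 1 ↔ M.parityOp z = -z := by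
  refine ⟨parityOp_odd, fun h => ?_⟩
  obtain ⟨x, hx, y, hy, rfl⟩ := exists_even_add_odd z
  rw [map_add, parityOp_even hx, parityOp_odd hy, neg_add, add_left_inj, eq_neg_iff_add_eq_zero,
    ← two_smul F] at h
  rw [(smul_eq_zero.1 h).resolve_left (NeZero.ne _), zero_add]
  exact hy

theorem mem_gr_iff {d : ZMod 2} {z : M.carrier} :
    z ∈ M.gr d ↔ M.parityOp z = (-1 : F) ^ d.val • z := by
  rcases HeckeClifford.zmod_two_cases d with rfl | rfl
  · rw [mem_gr_zero_iff]
    simp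
  · rw [mem_gr_one_iff]
    simp [ZMod.val_one]

theorem isGraded_iff {N : Submodule F M.carrier} :
    M.IsGraded N ↔ ∀ z ∈ N, M.parityOp z ∈ N := by
  constructor
  · intro h z hz
    rw [h] at hz
    obtain ⟨x, hx, y, hy, rfl⟩ := Submodule.mem_sup.1 hz
    rw [map_add, parityOp_even hx.2, parityOp_odd hy.2]
    exact add_mem hx.1 (neg_mem hy.1)
  · intro h
    apply le_antisymm
    · intro z hz
      have h2 : (2 : F) ≠ 0 := NeZero.ne _
      have hz' : z = (2 : F)⁻¹ • (z + M.parityOp z) + (2 : F)⁻¹ • (z - M.parityOp z) := by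
        rw [← smul_add, add_add_sub_cancel, ← two_smul F z, inv_smul_smul₀ h2]
      rw [hz']
      refine Submodule.add_mem_sup ⟨N.smul_mem _ (add_mem hz (h z hz)), ?_⟩
        ⟨N.smul_mem _ (sub_mem hz (h z hz)), ?_⟩
      · rw [SetLike.mem_coe, mem_gr_zero_iff, map_smul, map_add, parityOp_parityOp, add_comm]
      · rw [SetLike.mem_coe, mem_gr_one_iff, map_smul, map_sub, parityOp_parityOp, ← smul_neg,
          neg_sub]
    · exact sup_le inf_le_left inf_le_left

end

end SuperModule

namespace HeckeClifford

open SuperModule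

variable {F : Type u} [Field F] [NeZero (2 : F)] {n : ℕ}

/-- Elements of `𝒴_n` are sums of even and odd elements. -/
theorem exists_even_add_odd (a : Y F n) :
    ∃ x ∈ grading F n 0, ∃ y ∈ grading F n 1, x + y = a := by
  refine ⟨_, (evenPart F n a).2, _, (oddPart F n a).2, ?_⟩
  have h2 : (2 : F) ≠ 0 := NeZero.ne _
  simp only [evenPart, oddPart, AddMonoidHom.coe_mk, ZeroHom.coe_mk]
  rw [← smul_add, add_add_sub_cancel, ← two_smul F a, inv_smul_smul₀ h2]

theorem parityOp_smul (M : YModule.{u, w} F n) (a : Y F n) (z : M.carrier) :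
    M.parityOp (a • z) = parity F n a • M.parityOp z := by
  have key : ∀ (d : ZMod 2) (a : Y F n), a ∈ grading F n d → ∀ e, ∀ z ∈ M.gr e,
      M.parityOp (a • z) = parity F n a • M.parityOp z := by
    intro d a ha e z hz
    rw [parityOp_of_mem (M.smul_mem d e a z ha hz), parityOp_of_mem hz, mem_grading.1 ha,
      smul_assoc, smul_comm a, smul_smul]
    congr 1
    rcases zmod_two_cases d with rfl | rfl <;> rcases zmod_two_cases e with rfl | rfl <;>
      simp [ZMod.val_one, show (1 : ZMod 2) + 1 = 0 from rfl]
  obtain ⟨x, hx, y, hy, rfl⟩ := exists_even_add_odd a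
  obtain ⟨z, hz, z', hz', rfl⟩ := SuperModule.exists_even_add_odd z
  simp only [add_smul, smul_add, map_add, key _ _ hx _ _ hz, key _ _ hx _ _ hz',
    key _ _ hy _ _ hz, key _ _ hy _ _ hz']

variable {M : YModule.{u, w} F n} {N : YModule.{u, w'} F n} {f : M.carrier →ₗ[F] N.carrier}

theorem mem_homOfParity_zero : f ∈ homOfParity M N 0 ↔
    (∀ z, N.parityOp (f z) = f (M.parityOp z)) ∧ ∀ (a : Y F n) z, f (a • z) = a • f z := by
  constructor
  · rintro ⟨h1, h2⟩
    constructor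
    · intro z
      obtain ⟨x, hx, y, hy, rfl⟩ := SuperModule.exists_even_add_odd z
      have hx' := h1 0 x hx
      have hy' := h1 1 y hy
      rw [zero_add] at hx' hy'
      rw [map_add, map_add, map_add, map_add, parityOp_even hx, parityOp_odd hy, parityOp_even hx',
        parityOp_odd hy', map_neg]
    · intro a z
      obtain ⟨x, hx, y, hy, rfl⟩ := exists_even_add_odd a
      have e1 := h2 0 x hx z
      have e2 := h2 1 y hy z
      simp only [ZMod.val_zero, zero_mul, pow_zero, one_smul] at e1 e2
      rw [add_smul, map_add, e1, e2, add_smul]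
  · rintro ⟨h1, h2⟩
    refine ⟨fun e z hz => ?_, fun e a _ z => ?_⟩
    · rw [zero_add, mem_gr_iff, h1, parityOp_of_mem hz, map_smul]
    · rw [h2, ZMod.val_zero, zero_mul, pow_zero, one_smul]

theorem mem_homOfParity_one : f ∈ homOfParity M N 1 ↔
    (∀ z, N.parityOp (f z) = -f (M.parityOp z)) ∧
      ∀ (a : Y F n) z, f (a • z) = parity F n a • f z := by
  constructor
  · rintro ⟨h1, h2⟩
    constructor
    · intro z
      obtain ⟨x, hx, y, hy, rfl⟩ := SuperModule.exists_even_add_odd z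
      have hx' := h1 0 x hx
      have hy' := h1 1 y hy
      rw [add_zero] at hx'
      rw [show (1 : ZMod 2) + 1 = 0 from rfl] at hy'
      rw [map_add, map_add, map_add, map_add, parityOp_even hx, parityOp_odd hy, parityOp_odd hx',
        parityOp_even hy', map_neg, neg_add, neg_neg]
    · intro a z
      obtain ⟨x, hx, y, hy, rfl⟩ := exists_even_add_odd a
      have e1 := h2 0 x hx z
      have e2 := h2 1 y hy z
      simp only [ZMod.val_zero, mul_zero, pow_zero, one_smul, ZMod.val_one, mul_one, pow_one,
        neg_smul] at e1 e2
      rw [add_smul, map_add, e1, e2, map_add, mem_grading_zero.1 hx, mem_grading_one.1 hy,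
        add_smul, neg_smul]
  · rintro ⟨h1, h2⟩
    refine ⟨fun e z hz => ?_, fun e a ha z => ?_⟩
    · rw [mem_gr_iff, h1, parityOp_of_mem hz, map_smul, ← neg_smul]
      congr 1
      rcases zmod_two_cases e with rfl | rfl <;>
        simp [ZMod.val_one, show (1 : ZMod 2) + 1 = 0 from rfl]
    · rw [h2, ZMod.val_one, one_mul, mem_grading.1 ha, smul_assoc]

/-- Composition with the parity operator absorbs the sign rule: odd homomorphisms correspond to
linear maps that commute with the algebra and anticommute with parity. All Schur-type arguments are
made for such unsigned maps. -/
theorem comp_parityOp_mem_homOfParity_one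
    (h1 : ∀ z, N.parityOp (f z) = -f (M.parityOp z))
    (h2 : ∀ (a : Y F n) z, f (a • z) = a • f z) : f ∘ₗ M.parityOp ∈ homOfParity M N 1 := by
  rw [mem_homOfParity_one]
  refine ⟨fun z => h1 _, fun a z => ?_⟩
  rw [LinearMap.comp_apply, parityOp_smul, h2, LinearMap.comp_apply]

theorem mem_homOfParity_one' : f ∈ homOfParity M N 1 ↔
    (∀ z, N.parityOp (f (M.parityOp z)) = -f z) ∧
      ∀ (a : Y F n) z, f (M.parityOp (a • z)) = a • f (M.parityOp z) := by
  rw [mem_homOfParity_one]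
  constructor
  · rintro ⟨h1, h2⟩
    refine ⟨fun z => by rw [h1, parityOp_parityOp], fun a z => ?_⟩
    rw [parityOp_smul, h2, parity_parity]
  · rintro ⟨h1, h2⟩
    refine ⟨fun z => ?_, fun a z => ?_⟩
    · rw [← h1, parityOp_parityOp]
    · have := h2 (parity F n a) (M.parityOp z)
      rwa [parityOp_smul, parity_parity, parityOp_parityOp] at this

/-- The sign `ε` covers both the even case and the parity-reversing one, where the map becomes an
odd homomorphism after composition with the parity operator. -/
theorem isomorphic_of_bijective {ε : F} (hε : ε = 1 ∨ ε = -1) (hf : Function.Bijective f)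
    (h1 : ∀ z, N.parityOp (f z) = ε • f (M.parityOp z))
    (h2 : ∀ (a : Y F n) z, f (a • z) = a • f z) : M.Isomorphic N := by
  rcases hε with rfl | rfl
  · exact ⟨f, Submodule.mem_sup_left (mem_homOfParity_zero.2 ⟨fun z => by rw [h1, one_smul], h2⟩),
      hf⟩
  · refine ⟨_, Submodule.mem_sup_right (comp_parityOp_mem_homOfParity_one
      (fun z => by rw [h1, neg_one_smul]) h2), ?_⟩
    refine hf.comp ⟨fun x y h => ?_, fun z => ⟨_, parityOp_parityOp z⟩⟩
    rw [← parityOp_parityOp x, h, parityOp_parityOp]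

/-- The adjacent transpositions generate the symmetric group. -/
theorem perm_induction {p : Equiv.Perm (Fin n) → Prop} (one : p 1)
    (swap : ∀ k k' : Fin n, (k' : ℕ) = k + 1 → p (Equiv.swap k k'))
    (mul : ∀ s t, p s → p t → p (s * t)) (s : Equiv.Perm (Fin n)) : p s := by
  obtain _ | n := n
  · rwa [Subsingleton.elim s 1]
  have hs : s ∈ Submonoid.closure (Set.range fun i : Fin n ↦ Equiv.swap i.castSucc i.succ) := by
    rw [Equiv.Perm.mclosure_swap_castSucc_succ]; trivial
  induction hs using Submonoid.closure_induction with
  | mem x hx =>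
    obtain ⟨i, rfl⟩ := hx
    exact swap _ _ (by simp)
  | one => exact one
  | mul a b _ _ ha hb => exact mul _ _ ha hb

end HeckeClifford

/-! ### The seminormal model as a supermodule -/

namespace SeminormalModel

open HeckeClifford

variable {F : Type u} [Field F] [IsAlgClosed F] [CharZero F] {n : ℕ} {lam : StrictPartition n}
  (R : WeightRep.{u, 0, w} F lam.boxes (boxWeight F lam))

theorem permHom_opC (s : Equiv.Perm (Fin n)) :
    ∀ j, permHom R s * opC R j = opC R (s j) * permHom R s := by
  induction s using perm_induction with
  | one => intro j; rw [map_one, one_mul, mul_one]; rfl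
  | swap k k' hk =>
    intro j
    rw [permHom_swap R hk]
    exact LinearMap.ext fun f => opS_opC R hk j f
  | mul s t hs ht =>
    intro j
    rw [map_mul, mul_assoc, ht, ← mul_assoc, hs, mul_assoc, Equiv.Perm.mul_apply]

theorem opP_permHom (s : Equiv.Perm (Fin n)) :
    opP R * permHom R s = permHom R s * opP R := by
  induction s using perm_induction with
  | one => rw [map_one, one_mul, mul_one]
  | swap k k' hk =>
    rw [permHom_swap R hk]
    exact LinearMap.ext fun f => opS_opP R hk f
  | mul s t hs ht => rw [map_mul, ← mul_assoc, hs, mul_assoc, ht, mul_assoc]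

theorem opC_mul_self (j : Fin n) : opC R j * opC R j = 1 :=
  LinearMap.ext fun f => funext fun T => LinearMap.congr_fun (R.C_mul_self (T.box j)) (f T)

theorem opC_mul_opC {j k : Fin n} (h : j ≠ k) : opC R j * opC R k = -(opC R k * opC R j) :=
  LinearMap.ext fun f => funext fun T => LinearMap.congr_fun (R.C_mul_C _ _ (box_ne T h)) (f T)

theorem opP_mul_self : opP R * opP R = 1 :=
  LinearMap.ext fun f => funext fun T => LinearMap.congr_fun R.P_mul_self (f T)

theorem opP_mul_opC (j : Fin n) : opP R * opC R j = -(opC R j * opP R) :=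
  LinearMap.ext fun f => funext fun T => LinearMap.congr_fun (R.P_mul_C (T.box j)) (f T)

/-- The action of `𝒴_n`. -/
noncomputable def actionHom : Y F n →ₐ[F] Module.End F (Space R) :=
  lift (FreeAlgebra.lift F (Sum.elim (opC R) (permHom R))) (by
    intro x y h
    induction h with
    | c_sq k => simp [opC_mul_self]
    | c_anticomm k l h => simpa using opC_mul_opC R h
    | perm_one => simp
    | perm_mul s t => simp
    | perm_c s k => simpa using permHom_opC R s k)

theorem actionHom_c (j : Fin n) : actionHom R (c j) = opC R j := by
  simp [actionHom, c, lift_mk]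

theorem actionHom_perm (s : Equiv.Perm (Fin n)) : actionHom R (perm s) = permHom R s := by
  simp [actionHom, perm, lift_mk]

theorem opP_actionHom (a : Y F n) :
    opP R * actionHom R a = actionHom R (parity F n a) * opP R := by
  induction a using induction_on with
  | hr r =>
    rw [AlgHom.commutes, AlgHom.commutes, AlgHom.commutes]
    exact (Algebra.commutes r (opP R)).symm
  | hc k =>
    rw [parity_c, map_neg, actionHom_c, opP_mul_opC]
    exact (neg_mul (opC R k) (opP R)).symm
  | hs s => rw [parity_perm, actionHom_perm, opP_permHom]
  | hadd a b ha hb => rw [map_add, mul_add, ha, hb, map_add, map_add, add_mul]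
  | hmul a b ha hb => rw [map_mul, ← mul_assoc, ha, mul_assoc, hb, map_mul, map_mul, mul_assoc]

/-- The module with seminormal form. -/
noncomputable def model : YModule.{u, w} F n where
  carrier := Space R
  moduleAlg := Module.compHom _ (actionHom R).toRingHom
  isScalarTower := by
    let _ := Module.compHom (Space R) (actionHom R).toRingHom
    refine ⟨fun r a z => ?_⟩
    change actionHom R (r • a) z = r • actionHom R a z
    rw [map_smul, LinearMap.smul_apply]
  gr := signEigenspace (opP R)
  isInternal := signEigenspace_isInternal (opP_mul_self R)
  smul_mem d e a z ha hz := by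
    let _ := Module.compHom (Space R) (actionHom R).toRingHom
    rw [mem_signEigenspace] at hz ⊢
    change opP R (actionHom R a z) = _ • actionHom R a z
    have := LinearMap.congr_fun (opP_actionHom R a) z
    rw [Module.End.mul_apply, Module.End.mul_apply, hz, mem_grading.1 ha, map_smul, map_smul,
      LinearMap.smul_apply, smul_smul] at this
    rw [this]
    congr 1
    rcases zmod_two_cases d with rfl | rfl <;> rcases zmod_two_cases e with rfl | rfl <;>
      simp [ZMod.val_one, show (1 : ZMod 2) + 1 = 0 from rfl]

theorem smul_def (a : Y F n) (z : (model R).carrier) :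
    a • z = (actionHom R a z : Space R) := rfl

theorem c_smul (j : Fin n) (z : (model R).carrier) : (c j : Y F n) • z = (opC R j z : Space R) := by
  rw [smul_def, actionHom_c]

theorem transposition_smul {k k' : Fin n} (hk : (k' : ℕ) = k + 1) (z : (model R).carrier) :
    (transposition k k' : Y F n) • z = (opS R hk z : Space R) := by
  rw [smul_def, transposition, actionHom_perm, permHom_swap R hk]

theorem parityOp_model (z : (model R).carrier) : (model R).parityOp z = (opP R z : Space R) := by
  obtain ⟨x, hx, y, hy, rfl⟩ := SuperModule.exists_even_add_odd z
  have h1 : opP R (x : Space R) = (-1 : F) ^ (0 : ZMod 2).val • (x : Space R) := hx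
  have h2 : opP R (y : Space R) = (-1 : F) ^ (1 : ZMod 2).val • (y : Space R) := hy
  rw [map_add, SuperModule.parityOp_of_mem hx, SuperModule.parityOp_of_mem hy]
  have h3 : opP R ((x : Space R) + (y : Space R)) = opP R x + opP R y := map_add _ _ _
  exact (h3.trans (congrArg₂ (· + ·) h1 h2)).symm

/-- The operators `opX` satisfy the recursion `jucysMurphy_succ`. They also have the right initial
value: the first box of any tableau has content 0, and the `X` of such a box is zero. -/
theorem actionHom_jucysMurphy (j : Fin n) : actionHom R (jucysMurphy j) = opX R j := by
  obtain ⟨j, hj⟩ := j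
  induction j with
  | zero =>
    rw [jucysMurphy_zero rfl, map_zero]
    refine LinearMap.ext fun z => funext fun T => ?_
    rw [opX_apply, R.X_eq_zero _ (q_eq_zero.2 (T.content_zero rfl))]
    rfl
  | succ j ih =>
    have hk : ((⟨j + 1, hj⟩ : Fin n) : ℕ) = ((⟨j, by omega⟩ : Fin n) : ℕ) + 1 := rfl
    have h1 : actionHom R (transposition (⟨j, by omega⟩ : Fin n) ⟨j + 1, hj⟩) = opS R hk := by
      rw [transposition, actionHom_perm, permHom_swap R hk]
    rw [jucysMurphy_succ hk]
    simp only [map_add, map_mul, map_one, actionHom_c, h1, ih]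
    refine LinearMap.ext fun z => ?_
    simp only [LinearMap.add_apply, Module.End.mul_apply, Module.End.one_apply, add_mul, one_mul,
      opS_opX_left, opS_opS]
    exact sub_add_cancel _ _

theorem jucysMurphy_smul (j : Fin n) (z : (model R).carrier) :
    (jucysMurphy j : Y F n) • z = (opX R j z : Space R) := by
  rw [smul_def, actionHom_jucysMurphy]

end SeminormalModel

/-! ### Projections onto the weight spaces -/

set_option linter.unusedSectionVars false

namespace HeckeClifford

variable {F : Type u} [Field F] [CharZero F] {n : ℕ} {lam : StrictPartition n}

open Classical in
/-- A factor of `weightIdempotent`, which is `0` on the weight space of `R` and `1` on the one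
of `S`. -/
noncomputable def weightFactor (F : Type u) [Field F] (S R : StandardTableau lam) : Y F n :=
  if h : ∃ k, S.content k ≠ R.content k then
    (q F (S.content h.choose) - q F (R.content h.choose))⁻¹ •
      (jucysMurphy h.choose ^ 2 - algebraMap F _ (q F (R.content h.choose)))
  else 0

open Classical in
/-- A polynomial in the `L_k²` that projects onto the weight space of `S`. -/
noncomputable def weightIdempotent (F : Type u) [Field F] (S : StandardTableau lam) : Y F n :=
  (((Set.toFinite {R : StandardTableau lam | R ≠ S}).toFinset.toList).map
    (weightFactor F S)).prod

section

variable {V : Type v} [AddCommGroup V] [Module F V] [Module (Y F n) V] [IsScalarTower F (Y F n) V]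

/-- This is Lagrange interpolation in the eigenvalues of a single `L_k²`, at a label `k` where the
contents of `S` and `R` differ. The scalar at a third tableau does not matter, since the product
contains another factor that vanishes there. -/
theorem weightFactor_smul {S R T : StandardTableau lam} (hSR : R ≠ S) {z : V}
    (hz : ∀ k, (jucysMurphy k ^ 2 : Y F n) • z = q F (T.content k) • z) :
    (T = S → weightFactor F S R • z = z) ∧ (T = R → weightFactor F S R • z = 0) ∧
      ∃ r : F, weightFactor F S R • z = r • z := by
  have h : ∃ k, S.content k ≠ R.content k := by
    by_contra! h
    exact hSR (StandardTableau.content_injective (funext h)).symm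
  have key : weightFactor F S R • z = ((q F (S.content h.choose) - q F (R.content h.choose))⁻¹ *
      (q F (T.content h.choose) - q F (R.content h.choose))) • z := by
    rw [weightFactor, dif_pos h, smul_assoc, sub_smul, hz, algebraMap_smul, ← sub_smul, smul_smul]
  refine ⟨?_, ?_, _, key⟩
  · rintro rfl
    rw [key, inv_mul_cancel₀ (sub_ne_zero.2 (q_ne h.choose_spec)), one_smul]
  · rintro rfl
    rw [key, sub_self, mul_zero, zero_smul]

theorem weightIdempotent_smul_self {S : StandardTableau lam} {z : V}
    (hz : ∀ k, (jucysMurphy k ^ 2 : Y F n) • z = q F (S.content k) • z) :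
    weightIdempotent F S • z = z := by
  classical
  rw [weightIdempotent]
  have : ∀ R ∈ (Set.toFinite {R : StandardTableau lam | R ≠ S}).toFinset.toList, R ≠ S := by
    simp
  revert this
  generalize (Set.toFinite {R : StandardTableau lam | R ≠ S}).toFinset.toList = l
  intro this
  induction l with
  | nil => simp
  | cons R l ih =>
    rw [List.map_cons, List.prod_cons, mul_smul, ih fun R' h => this R' (List.mem_cons_of_mem _ h)]
    exact (weightFactor_smul (this R List.mem_cons_self) hz).1 rfl

theorem weightIdempotent_smul_of_ne {S T : StandardTableau lam} (hTS : T ≠ S) {z : V}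
    (hz : ∀ k, (jucysMurphy k ^ 2 : Y F n) • z = q F (T.content k) • z) :
    weightIdempotent F S • z = 0 := by
  classical
  have h3 : ∀ l : List (StandardTableau lam), (∀ R ∈ l, R ≠ S) →
      ∃ r : F, (l.map (weightFactor F S)).prod • z = r • z := by
    intro l hl
    induction l with
    | nil => exact ⟨1, by simp⟩
    | cons R l ih =>
      obtain ⟨r, hr⟩ := ih fun R' h => hl R' (List.mem_cons_of_mem _ h)
      obtain ⟨-, -, r', hr'⟩ := weightFactor_smul (hl R List.mem_cons_self) hz
      exact ⟨r * r', by rw [List.map_cons, List.prod_cons, mul_smul, hr, smul_comm, hr', smul_smul]⟩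
  rw [weightIdempotent]
  have h1 : ∀ R ∈ (Set.toFinite {R : StandardTableau lam | R ≠ S}).toFinset.toList, R ≠ S := by
    simp
  have h2 : T ∈ (Set.toFinite {R : StandardTableau lam | R ≠ S}).toFinset.toList := by
    simpa using hTS
  revert h1 h2
  generalize (Set.toFinite {R : StandardTableau lam | R ≠ S}).toFinset.toList = l
  intro h1 h2
  induction l with
  | nil => simp at h2
  | cons R l ih =>
    rw [List.map_cons, List.prod_cons, mul_smul]
    rcases List.mem_cons.1 h2 with rfl | h2
    · obtain ⟨r, hr⟩ := h3 l fun R' h => h1 R' (List.mem_cons_of_mem _ h)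
      rw [hr, smul_comm, (weightFactor_smul (h1 _ List.mem_cons_self) hz).2.1 rfl, smul_zero]
    · rw [ih (fun R' h => h1 R' (List.mem_cons_of_mem _ h)) h2, smul_zero]

end

end HeckeClifford

namespace SeminormalModel

open HeckeClifford

variable {F : Type u} [Field F] [IsAlgClosed F] [CharZero F] {n : ℕ} {lam : StrictPartition n}
  (R : WeightRep.{u, 0, w} F lam.boxes (boxWeight F lam))

open Classical in
/-- The inclusion of the summand of `T`. -/
noncomputable def single (T : StandardTableau lam) : R.V →ₗ[F] Space R :=
  LinearMap.single F (fun _ : StandardTableau lam => R.V) T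

theorem single_same (T : StandardTableau lam) (v : R.V) : single R T v T = v := by
  classical
  change (Pi.single T v : StandardTableau lam → R.V) T = v
  simp

theorem single_of_ne {T S : StandardTableau lam} (h : S ≠ T) (v : R.V) : single R T v S = 0 := by
  classical
  change (Pi.single T v : StandardTableau lam → R.V) S = 0
  simp [h]

variable {R}

theorem supportedAt_single (T : StandardTableau lam) (v : R.V) : SupportedAt T (single R T v) :=
  fun _ h => single_of_ne R h v

theorem SupportedAt.eq_single {T : StandardTableau lam} {f : Space R} (h : SupportedAt T f) :
    f = single R T (f T) := by
  ext S
  by_cases hS : S = T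
  · rw [hS, single_same]
  · rw [h S hS, single_of_ne R hS]

theorem SupportedAt.ext {T : StandardTableau lam} {f g : Space R} (hf : SupportedAt T f)
    (hg : SupportedAt T g) (h : f T = g T) : f = g := by
  rw [hf.eq_single, hg.eq_single, h]

theorem SupportedAt.opC {T : StandardTableau lam} {f : Space R} (h : SupportedAt T f)
    (j : Fin n) : SupportedAt T (opC R j f) := fun S hS => by
  rw [opC_apply, h S hS, map_zero]

theorem SupportedAt.opX {T : StandardTableau lam} {f : Space R} (h : SupportedAt T f)
    (j : Fin n) : SupportedAt T (opX R j f) := fun S hS => by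
  rw [opX_apply, h S hS, map_zero]

theorem SupportedAt.opP {T : StandardTableau lam} {f : Space R} (h : SupportedAt T f) :
    SupportedAt T (opP R f) := fun S hS => by
  rw [opP_apply, h S hS, map_zero]

theorem opC_single (T : StandardTableau lam) (j : Fin n) (v : R.V) :
    opC R j (single R T v) = single R T (R.C (T.box j) v) :=
  ((supportedAt_single T v).opC j).ext (supportedAt_single T _) (by
    rw [opC_apply, single_same, single_same])

theorem opX_single (T : StandardTableau lam) (j : Fin n) (v : R.V) :
    opX R j (single R T v) = single R T (R.X (T.box j) v) :=
  ((supportedAt_single T v).opX j).ext (supportedAt_single T _) (by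
    rw [opX_apply, single_same, single_same])

theorem opP_single (T : StandardTableau lam) (v : R.V) :
    opP R (single R T v) = single R T (R.P v) :=
  (supportedAt_single T v).opP.ext (supportedAt_single T _) (by
    rw [opP_apply, single_same, single_same])

theorem opS_single (T : StandardTableau lam) {k k' : Fin n} (hk : (k' : ℕ) = k + 1) (v : R.V) :
    opS R hk (single R T v) = single R T (R.xi (T.box k) (T.box k') v) +
      omegaScalar F (T.content k) (T.content k') • single R (T.move hk) v := by
  ext S
  rw [opS_apply, Pi.add_apply, Pi.smul_apply]
  congr 1
  · by_cases h : S = T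
    · rw [h, single_same, single_same]
    · rw [single_of_ne R h, single_of_ne R h, map_zero]
  · by_cases h : S = T.move hk
    · rw [h, T.move_move hk, single_same, single_same, omegaScalar_move]
    · rw [single_of_ne R h, single_of_ne R, smul_zero, smul_zero]
      rintro rfl
      exact h (S.move_move hk).symm

theorem mem_of_single_mem {N : Submodule F (Space R)} (h : ∀ T v, single R T v ∈ N) (f : Space R) :
    f ∈ N := by
  classical
  cases nonempty_fintype (StandardTableau lam)
  rw [← Finset.univ_sum_single f]
  exact sum_mem fun T _ => h T (f T)

theorem opX_opX_apply (j : Fin n) (f : Space R) (S : StandardTableau lam) :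
    opX R j (opX R j f) S = q F (S.content j) • f S := by
  have := LinearMap.congr_fun (R.X_mul_self (S.box j)) (f S)
  rw [Module.End.mul_apply] at this
  rw [opX_apply, opX_apply, this]
  rfl

theorem supportedAt_of_opX_opX {T : StandardTableau lam} {f : Space R}
    (h : ∀ j, opX R j (opX R j f) = q F (T.content j) • f) : SupportedAt T f := by
  intro S hS
  obtain ⟨j, hj⟩ : ∃ j, S.content j ≠ T.content j := by
    by_contra! h
    exact hS (StandardTableau.content_injective (funext h))
  have h1 := congrFun (h j) S
  rw [opX_opX_apply, Pi.smul_apply, ← sub_eq_zero, ← sub_smul, smul_eq_zero] at h1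
  exact h1.resolve_left (sub_ne_zero.2 (q_ne hj))

variable (R)

theorem jucysMurphy_sq_smul (j : Fin n) (z : (model R).carrier) :
    (jucysMurphy j ^ 2 : Y F n) • z = (opX R j (opX R j z) : Space R) := by
  rw [smul_def, map_pow, actionHom_jucysMurphy, sq]
  rfl

theorem jucysMurphy_sq_smul_single (T : StandardTableau lam) (j : Fin n) (v : R.V) :
    (jucysMurphy j ^ 2 : Y F n) • (show (model R).carrier from single R T v) =
      q F (T.content j) • (show (model R).carrier from single R T v) :=
  (jucysMurphy_sq_smul R j _).trans (opX_opX_of_supportedAt (supportedAt_single T v) j)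

theorem weightIdempotent_smul (T : StandardTableau lam) (z : (model R).carrier) :
    weightIdempotent F T • z = (single R T ((z : Space R) T) : Space R) := by
  let g : Module.End F (Space R) := actionHom R (weightIdempotent F T) -
    (single R T ∘ₗ LinearMap.proj T)
  have hg : ∀ f : Space R, f ∈ LinearMap.ker g := by
    refine mem_of_single_mem fun S v => ?_
    rw [LinearMap.mem_ker, LinearMap.sub_apply, sub_eq_zero]
    change weightIdempotent F T • (show (model R).carrier from single R S v) =
      single R T (single R S v T)
    by_cases h : S = T
    · subst h
      rw [weightIdempotent_smul_self (jucysMurphy_sq_smul_single R S · v), single_same]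
    · rw [weightIdempotent_smul_of_ne h (jucysMurphy_sq_smul_single R S · v),
        single_of_ne R (Ne.symm h), map_zero]
      rfl
  exact sub_eq_zero.1 (LinearMap.mem_ker.1 (hg z))

/-- The operators `L_k² - μ` act on each summand by a scalar, so the generalized weight spaces are
the summands themselves. Distinct contents give distinct scalars since `q` is injective in
characteristic 0. -/
theorem mem_weightSpace_model (i : Fin n → ℕ) (z : (model R).carrier) :
    z ∈ weightSpace (model R) i ↔ ∀ S : StandardTableau lam, S.content ≠ i → (z : Space R) S = 0 := by
  have key : ∀ (k : Fin n) (μ : F) (N : ℕ) (z : Space R) (S : StandardTableau lam),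
      ((((model R).op (jucysMurphy k ^ 2) - μ • 1) ^ N) z : Space R) S =
        (q F (S.content k) - μ) ^ N • z S := by
    intro k μ N
    induction N with
    | zero => intro z S; rw [pow_zero, pow_zero, one_smul]; rfl
    | succ N ih =>
      intro z S
      rw [pow_succ ((model R).op _ - _) N, pow_succ (q F _ - _) N, mul_smul]
      refine (ih _ S).trans ?_
      congr 1
      have h1 : (((model R).op (jucysMurphy k ^ 2) - μ • 1) z : Space R) S =
          opX R k (opX R k z) S - μ • z S :=
        congrFun (congrArg (fun y : Space R => y - μ • z) (jucysMurphy_sq_smul R k z)) S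
      rw [h1, opX_opX_apply, sub_smul]
  rw [weightSpace, Submodule.mem_iInf]
  simp only [Module.End.mem_maxGenEigenspace]
  constructor
  · intro h S hS
    obtain ⟨k, hk⟩ : ∃ k, S.content k ≠ i k := by
      by_contra! h
      exact hS (funext h)
    obtain ⟨N, hN⟩ := h k
    have h1 := key k (q F (i k)) N z S
    rw [hN] at h1
    exact (smul_eq_zero.1 h1.symm).resolve_left (pow_ne_zero _ (sub_ne_zero.2 (q_ne hk)))
  · intro h k
    refine ⟨1, funext fun S => ?_⟩
    refine (key k (q F (i k)) 1 z S).trans ?_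
    by_cases hS : S.content = i
    · rw [hS, sub_self, pow_one, zero_smul]
      rfl
    · rw [h S hS, smul_zero]
      rfl

theorem mem_weightSpace_model_content (T : StandardTableau lam) (z : (model R).carrier) :
    z ∈ weightSpace (model R) T.content ↔ SupportedAt (R := R) T z := by
  rw [mem_weightSpace_model]
  exact forall_congr' fun S => imp_congr_left StandardTableau.content_injective.ne_iff

end SeminormalModel

/-! ### Irreducibility, complete splittability and seminormal form of the model -/

set_option linter.unusedSectionVars false

namespace StandardTableau

theorem box_transition {n : ℕ} {lam : StrictPartition n} (T S : StandardTableau lam) (j : Fin n) :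
    S.box (T.transition S j) = T.box j := S.box.apply_symm_apply _

end StandardTableau

namespace SeminormalModel

open HeckeClifford SuperModule

variable {F : Type u} [Field F] [IsAlgClosed F] [CharZero F] {n : ℕ} {lam : StrictPartition n}
  (R : WeightRep.{u, 0, w} F lam.boxes (boxWeight F lam)) {odd : Prop}

section Irreducible

variable {R} (hR : WeightRep.IsUniversal.{u, 0, w, v'} R odd)
include hR

/-- A subspace stable under the parity operator, the `c_j` and the `L_j` contains the summand of
`T` or meets it trivially. -/
theorem single_mem_or {N : Submodule F (Space R)} (hP : ∀ f ∈ N, opP R f ∈ N)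
    (hC : ∀ j, ∀ f ∈ N, opC R j f ∈ N) (hX : ∀ j, ∀ f ∈ N, opX R j f ∈ N)
    (T : StandardTableau lam) :
    (∀ v, single R T v ∈ N → v = 0) ∨ ∀ v, single R T v ∈ N := by
  have hst : R.IsStable (N.comap (single R T)) := by
    refine ⟨fun v hv => ?_, fun b v hv => ?_, fun b v hv => ?_⟩
    · rw [Submodule.mem_comap, ← opP_single]
      exact hP _ hv
    · obtain ⟨j, rfl⟩ := T.box.surjective b
      rw [Submodule.mem_comap, ← opC_single]
      exact hC j _ hv
    · obtain ⟨j, rfl⟩ := T.box.surjective b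
      rw [Submodule.mem_comap, ← opX_single]
      exact hX j _ hv
  rcases hR.irreducible _ hst with h | h
  · left
    intro v hv
    have : v ∈ N.comap (single R T) := hv
    rwa [h, Submodule.mem_bot] at this
  · right
    intro v
    have : v ∈ N.comap (single R T) := by rw [h]; trivial
    exact this

/-- A nonzero graded submodule contains a nonzero vector of some summand by projection, then the
whole summand since `R` is irreducible, and then all summands, because every tableau is reached
through transpositions with nonzero `Ω`. -/
theorem isIrreducible_model : (model R).IsIrreducible := by
  have hnt := hR.nontrivial
  refine ⟨?_, fun _ _ _ _ => trivial, ?_, ?_⟩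
  · rw [isGraded_iff]
    exact fun _ _ => trivial
  · intro h
    obtain ⟨v, hv⟩ := exists_ne (0 : R.V)
    obtain ⟨T⟩ : Nonempty (StandardTableau lam) := inferInstance
    have h1 : (show (model R).carrier from single R T v) ∈ (⊥ : Submodule F (model R).carrier) :=
      h ▸ trivial
    have h2 : single R T v = 0 := (Submodule.mem_bot F).1 h1
    exact hv (by rw [← single_same R T v, h2]; rfl)
  · intro N _ hgr hst
    rw [or_iff_not_imp_left]
    intro hne
    obtain ⟨z, hz, hz0⟩ := N.ne_bot_iff.1 hne
    obtain ⟨T, hT⟩ : ∃ T : StandardTableau lam, (z : Space R) T ≠ 0 := by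
      by_contra! h
      exact hz0 (funext h)
    let N' : Submodule F (Space R) := N
    have hP : ∀ f ∈ N', opP R f ∈ N' := fun (f : (model R).carrier) hf => by
      have := isGraded_iff.1 hgr f hf
      rwa [parityOp_model] at this
    have hC : ∀ j, ∀ f ∈ N', opC R j f ∈ N' := fun j (f : (model R).carrier) hf => by
      have := hst (c j) trivial f hf
      rwa [c_smul] at this
    have hX : ∀ j, ∀ f ∈ N', opX R j f ∈ N' := fun j (f : (model R).carrier) hf => by
      have := hst (jucysMurphy j) trivial f hf
      rwa [jucysMurphy_smul] at this
    have hS : ∀ (k k' : Fin n) (hk : (k' : ℕ) = k + 1), ∀ f ∈ N', opS R hk f ∈ N' :=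
      fun k k' hk (f : (model R).carrier) hf => by
        have := hst (transposition k k') trivial f hf
        rwa [transposition_smul R hk] at this
    have h1 : single R T ((z : Space R) T) ∈ N' := by
      have := hst (weightIdempotent F T) trivial z hz
      rwa [weightIdempotent_smul] at this
    have h2 : ∀ v, single R T v ∈ N' :=
      (single_mem_or hR hP hC hX T).resolve_left fun h => hT (h _ h1)
    have h3 : ∀ S v, single R S v ∈ N' := by
      refine T.induction_move _ h2 fun S k k' hk hadm _ ih v => ?_
      have h4 := hS k k' hk _ (ih v)
      rw [opS_single] at h4
      have h5 := (Submodule.add_mem_iff_right N' (ih _)).1 h4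
      exact (Submodule.smul_mem_iff N' (omegaScalar_ne_zero hk S hadm)).1 h5
    rw [eq_top_iff]
    intro f _
    exact mem_of_single_mem (N := N') h3 f

end Irreducible

section Splittable

open Polynomial

/-- The squarefree polynomial `X² - q(i)`, or `X` if `i = 0`. -/
noncomputable def splitFactor (F : Type u) [Field F] (i : ℕ) : F[X] :=
  if i = 0 then X else X ^ 2 - C (q F i)

theorem splitFactor_separable (i : ℕ) : (splitFactor F i).Separable := by
  rw [splitFactor]
  split_ifs with h
  · exact separable_X
  · exact separable_X_pow_sub_C _ (by norm_num) (q_eq_zero.not.2 h)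

theorem isCoprime_splitFactor {i j : ℕ} (h : i ≠ j) :
    IsCoprime (splitFactor F i) (splitFactor F j) := by
  have key : ∀ i : ℕ, ∃ p : F[X], X ^ 2 - C (q F i) = p * splitFactor F i := fun i => by
    rw [splitFactor]
    split_ifs with h
    · exact ⟨X, by rw [h, q_zero, C_0, sub_zero, sq]⟩
    · exact ⟨1, by rw [one_mul]⟩
  have h1 : IsCoprime (X ^ 2 - C (q F i)) (X ^ 2 - C (q F j)) := by
    have hq : q F j - q F i ≠ 0 := sub_ne_zero.2 (q_ne h.symm)
    refine ⟨C (q F j - q F i)⁻¹, -C (q F j - q F i)⁻¹, ?_⟩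
    calc _ = C (q F j - q F i)⁻¹ * (C (q F j) - C (q F i)) := by ring
      _ = 1 := by rw [← C_sub, ← C_mul, inv_mul_cancel₀ hq, C_1]
  obtain ⟨p, hp⟩ := key i
  obtain ⟨p', hp'⟩ := key j
  rw [hp, hp'] at h1
  exact h1.of_mul_left_right.of_mul_right_right

theorem aeval_opX_apply (p : F[X]) (j : Fin n) (f : Space R) (T : StandardTableau lam) :
    aeval (opX R j) p f T = aeval (R.X (T.box j)) p (f T) := by
  induction p using Polynomial.induction_on' with
  | add p r hp hr => rw [map_add, map_add, LinearMap.add_apply, Pi.add_apply, hp, hr]; rfl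
  | monomial m r =>
    have h : ∀ m : ℕ, ((opX R j) ^ m) f T = ((R.X (T.box j)) ^ m) (f T) := by
      intro m
      induction m with
      | zero => rfl
      | succ m ih =>
        rw [pow_succ', pow_succ', Module.End.mul_apply, Module.End.mul_apply, opX_apply, ih]
    rw [aeval_monomial, aeval_monomial, Module.End.mul_apply, Module.End.mul_apply,
      Module.algebraMap_end_apply, Module.algebraMap_end_apply, Pi.smul_apply, h]

/-- A squarefree polynomial annihilates each `L_k`. For content 0 its factor has to be `X` rather
than `X²`, and this is where the vanishing of the operators on diagonal boxes enters. -/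
theorem isCompletelySplittable_model : IsCompletelySplittable (model R) := by
  classical
  intro k
  cases nonempty_fintype (StandardTableau lam)
  let s : Finset ℕ := Finset.univ.image fun T : StandardTableau lam => T.content k
  have hsep : (∏ i ∈ s, splitFactor F i).Separable :=
    separable_prod' (fun _ _ _ _ h => isCoprime_splitFactor h) fun i _ => splitFactor_separable i
  have hzero : aeval (opX R k) (∏ i ∈ s, splitFactor F i) = 0 := by
    refine LinearMap.ext fun f => funext fun T => ?_
    obtain ⟨p, hp⟩ := Finset.dvd_prod_of_mem (splitFactor F)
      (Finset.mem_image_of_mem (fun T : StandardTableau lam => T.content k) (Finset.mem_univ T))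
    have h0 : aeval (R.X (T.box k)) (splitFactor F (T.content k)) = 0 := by
      rw [splitFactor]
      split_ifs with h
      · rw [aeval_X]
        exact R.X_eq_zero _ (q_eq_zero.2 h)
      · rw [map_sub, map_pow, aeval_X, aeval_C, sq, R.X_mul_self, Algebra.algebraMap_eq_smul_one]
        exact sub_self _
    rw [aeval_opX_apply, hp, map_mul, h0, zero_mul]
    rfl
  have hop : (model R).op (jucysMurphy k) = opX R k := LinearMap.ext fun z => jucysMurphy_smul R k z
  have : (opX R k).IsSemisimple :=
    Module.End.isSemisimple_of_squarefree_aeval_eq_zero hsep.squarefree hzero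
  rw [hop]
  exact this

end Splittable

section Seminormal

theorem iSupIndep_model :
    iSupIndep fun T : StandardTableau lam => weightSpace (model R) T.content := by
  intro T
  rw [Submodule.disjoint_def]
  intro z h1 h2
  rw [mem_weightSpace_model_content] at h1
  let K : Submodule F (Space R) := LinearMap.ker (LinearMap.proj (R := F) T)
  have h3 : (⨆ S, ⨆ _ : S ≠ T, weightSpace (model R) S.content) ≤ K := by
    refine iSup₂_le fun S hS z hz => ?_
    rw [mem_weightSpace_model_content] at hz
    exact hz T hS.symm
  funext S
  by_cases hS : S = T
  · rw [hS]
    exact h3 h2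
  · exact h1 S hS

theorem iSup_model :
    (⨆ T : StandardTableau lam, weightSpace (model R) T.content) = ⊤ := by
  rw [eq_top_iff]
  intro z _
  let N : Submodule F (Space R) := ⨆ T : StandardTableau lam, weightSpace (model R) T.content
  refine mem_of_single_mem (N := N) (fun T v => ?_) z
  have h1 : weightSpace (model R) T.content ≤ N :=
    le_iSup (fun T : StandardTableau lam => weightSpace (model R) T.content) T
  exact h1 ((mem_weightSpace_model_content R T _).2 (supportedAt_single T v))

theorem isIrreducibleUnder_model (hR : WeightRep.IsUniversal.{u, 0, w, v'} R odd)
    (T : StandardTableau lam) :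
    (model R).IsIrreducibleUnder (Set.range c ∪ Set.range jucysMurphy)
      (weightSpace (model R) T.content) := by
  have hnt := hR.nontrivial
  refine ⟨?_, ?_, ?_, ?_⟩
  · rw [isGraded_iff]
    intro z hz
    rw [mem_weightSpace_model_content] at hz ⊢
    rw [parityOp_model]
    exact hz.opP
  · rintro a (⟨j, rfl⟩ | ⟨j, rfl⟩) z hz
    · rw [mem_weightSpace_model_content] at hz ⊢
      rw [c_smul]
      exact hz.opC j
    · rw [mem_weightSpace_model_content] at hz ⊢
      rw [jucysMurphy_smul]
      exact hz.opX j
  · intro h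
    obtain ⟨v, hv⟩ := exists_ne (0 : R.V)
    have h1 := (mem_weightSpace_model_content R T _).2 (supportedAt_single T v)
    rw [h] at h1
    have h2 : single R T v = 0 := (Submodule.mem_bot F).1 h1
    exact hv (by rw [← single_same R T v, h2]; rfl)
  · intro N hN hgr hst
    let N' : Submodule F (Space R) := N
    have hP : ∀ f ∈ N', opP R f ∈ N' := fun (f : (model R).carrier) hf => by
      have := isGraded_iff.1 hgr f hf
      rwa [parityOp_model] at this
    have hC : ∀ j, ∀ f ∈ N', opC R j f ∈ N' := fun j (f : (model R).carrier) hf => by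
      have := hst (c j) (Or.inl ⟨j, rfl⟩) f hf
      rwa [c_smul] at this
    have hX : ∀ j, ∀ f ∈ N', opX R j f ∈ N' := fun j (f : (model R).carrier) hf => by
      have := hst (jucysMurphy j) (Or.inr ⟨j, rfl⟩) f hf
      rwa [jucysMurphy_smul] at this
    have hsupp : ∀ z ∈ N, SupportedAt (R := R) T z := fun z hz =>
      (mem_weightSpace_model_content R T z).1 (hN hz)
    rcases single_mem_or hR hP hC hX T with h | h
    · left
      rw [eq_bot_iff]
      intro z hz
      have h1 := (hsupp z hz).eq_single
      have h2 : (z : Space R) T = 0 := h _ (by rw [← h1]; exact hz)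
      rw [h2, map_zero] at h1
      exact (Submodule.mem_bot F).2 h1
    · right
      refine le_antisymm hN fun z hz => ?_
      have h1 := ((mem_weightSpace_model_content R T z).1 hz).eq_single
      have h2 : (z : Space R) ∈ N' := by rw [h1]; exact h _
      exact h2

/-- The bijections between the weight spaces. -/
noncomputable def theta (T S : StandardTableau lam) : Module.End F (Space R) :=
  single R S ∘ₗ LinearMap.proj T

theorem theta_apply (T S : StandardTableau lam) (f : Space R) :
    theta R T S f = single R S (f T) := rfl

theorem xi_model_apply (T : StandardTableau lam) (k k' : Fin n) (z : (model R).carrier) :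
    (HeckeClifford.xi (model R) T.content k k' z : Space R) =
      -((q F (T.content k) - q F (T.content k'))⁻¹ •
        (opX R k z + opX R k' z + opC R k (opC R k' (opX R k z - opX R k' z)))) := by
  have h : ((jucysMurphy k + jucysMurphy k') + c k * c k' * (jucysMurphy k - jucysMurphy k') :
      Y F n) • z = (opX R k z + opX R k' z + opC R k (opC R k' (opX R k z - opX R k' z)) :
        Space R) := by
    have h1 : actionHom R ((jucysMurphy k + jucysMurphy k') +
        c k * c k' * (jucysMurphy k - jucysMurphy k')) =
        opX R k + opX R k' + opC R k * opC R k' * (opX R k - opX R k') := by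
      simp only [map_add, map_mul, map_sub, actionHom_c, actionHom_jucysMurphy]
    rw [smul_def, h1]
    rfl
  exact congrArg (fun y : Space R => -((q F (T.content k) - q F (T.content k'))⁻¹ • y)) h

theorem opS_of_supportedAt {T : StandardTableau lam} {k k' : Fin n} (hk : (k' : ℕ) = k + 1)
    {z : Space R} (hz : SupportedAt T z) :
    opS R hk z = -((q F (T.content k) - q F (T.content k'))⁻¹ •
        (opX R k z + opX R k' z + opC R k (opC R k' (opX R k z - opX R k' z)))) +
      omegaScalar F (T.content k) (T.content k') • theta R T (T.move hk) z := by
  rw [theta_apply]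
  nth_rewrite 1 [hz.eq_single]
  rw [opS_single]
  congr 1
  nth_rewrite 2 3 4 5 [hz.eq_single]
  simp only [opX_single, opC_single, ← map_add, ← map_sub, ← map_smul, ← map_neg]
  rfl

theorem isSeminormal_model (hR : WeightRep.IsUniversal.{u, 0, w, v'} R odd) :
    IsSeminormal lam (model R) := by
  refine ⟨iSupIndep_model R, iSup_model R, isIrreducibleUnder_model R hR, theta R, ?_, ?_⟩
  · intro T S z hz
    have hz' := (mem_weightSpace_model_content R T z).1 hz
    refine ⟨(mem_weightSpace_model_content R S _).2 (supportedAt_single S _), hz'.eq_single.symm,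
      fun U => ?_, fun d hd => ?_, fun j => ⟨?_, ?_⟩⟩
    · refine congrArg (single R U) ?_
      exact single_same R S _
    · rw [mem_gr_iff, parityOp_model] at hd ⊢
      have h1 : R.P (z T) = (-1 : F) ^ d.val • z T := congrFun hd T
      refine (opP_single (R := R) S (z T)).trans ?_
      rw [h1, map_smul]
      rfl
    · rw [c_smul, c_smul]
      refine Eq.trans ?_ (opC_single S _ _).symm
      rw [StandardTableau.box_transition]
      rfl
    · rw [jucysMurphy_smul, jucysMurphy_smul]
      refine Eq.trans ?_ (opX_single S _ _).symm
      rw [StandardTableau.box_transition]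
      rfl
  · intro T k k' hk
    constructor
    · intro hadm
      refine ⟨T.move hk, ?_, fun z hz => ?_⟩
      · rw [T.transition_move hk T hadm, T.transition_self, mul_one]
      · rw [transposition_smul R hk]
        refine (opS_of_supportedAt R hk ((mem_weightSpace_model_content R T z).1 hz)).trans ?_
        exact congrArg (fun y : Space R => y + omegaScalar F (T.content k) (T.content k') •
          theta R T (T.move hk) z) (xi_model_apply R T k k' z).symm
    · intro hadm z hz
      rw [transposition_smul R hk]
      refine (opS_of_supportedAt R hk ((mem_weightSpace_model_content R T z).1 hz)).trans ?_
      rw [omegaScalar_of_not hk T hadm, zero_smul, add_zero]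
      exact (xi_model_apply R T k k' z).symm

end Seminormal

end SeminormalModel

/-! ### Dimension, endomorphisms and type of the model -/

set_option linter.unusedSectionVars false

namespace SeminormalModel

open HeckeClifford SuperModule

variable {F : Type u} [Field F] [IsAlgClosed F] [CharZero F] {n : ℕ} {lam mu : StrictPartition n}
  (R : WeightRep.{u, 0, w} F lam.boxes (boxWeight F lam)) {odd : Prop}

theorem finite_model [Module.Finite F R.V] : Module.Finite F (model R).carrier :=
  inferInstanceAs (Module.Finite F (Space R))

theorem finrank_model [Module.Finite F R.V] :
    Module.finrank F (model R).carrier = Module.finrank F R.V * numStandardTableaux lam := by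
  cases nonempty_fintype (StandardTableau lam)
  refine (Module.finrank_pi_fintype F (M := fun _ : StandardTableau lam => R.V)).trans ?_
  rw [Finset.sum_const, smul_eq_mul, mul_comm, numStandardTableaux, Nat.card_eq_fintype_card]
  rfl

section Endomorphisms

variable {R}

/-- The operator that acts by `g` on every summand. -/
def diagonal (g : Module.End F R.V) : Module.End F (Space R) :=
  LinearMap.pi fun T => g ∘ₗ LinearMap.proj T

theorem diagonal_apply (g : Module.End F R.V) (f : Space R) (T : StandardTableau lam) :
    diagonal g f T = g (f T) := rfl

theorem xi_isHom {g : Module.End F R.V} (hg : WeightRep.IsHom R R g) (b b' : lam.boxes) (v : R.V) :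
    g (R.xi b b' v) = R.xi b b' (g v) := by
  simp only [WeightRep.xi, WeightRep.xiNum, LinearMap.neg_apply, LinearMap.smul_apply,
    LinearMap.add_apply, LinearMap.sub_apply, Module.End.mul_apply, map_neg, map_smul, map_add,
    map_sub, hg.C, hg.X]

theorem diagonal_actionHom {g : Module.End F R.V} (hg : WeightRep.IsHom R R g) (a : Y F n) :
    diagonal g * actionHom R a = actionHom R a * diagonal g := by
  induction a using induction_on with
  | hr r =>
    rw [AlgHom.commutes]
    exact (Algebra.commutes r (diagonal g)).symm
  | hc k =>
    rw [actionHom_c]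
    exact LinearMap.ext fun f => funext fun T => hg.C _ _
  | hs s =>
    rw [actionHom_perm]
    induction s using perm_induction with
    | one => rw [map_one, one_mul, mul_one]
    | swap k k' hk =>
      rw [permHom_swap R hk]
      refine LinearMap.ext fun f => funext fun T => ?_
      simp only [Module.End.mul_apply, diagonal_apply, opS_apply, map_add, map_smul, xi_isHom hg]
    | mul s t hs ht => rw [map_mul, ← mul_assoc, hs, mul_assoc, ht, mul_assoc]
  | hadd a b ha hb => rw [map_add, mul_add, ha, hb, add_mul]
  | hmul a b ha hb => rw [map_mul, ← mul_assoc, ha, mul_assoc, hb, mul_assoc]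

/-- Operators that commute with `𝒴_n` are diagonal. -/
theorem exists_eq_diagonal {f : Module.End F (Space R)}
    (hf : ∀ a : Y F n, f * actionHom R a = actionHom R a * f) :
    ∃ g : Module.End F R.V, WeightRep.IsHom R R g ∧ f = diagonal g := by
  have hC : ∀ j z, f (opC R j z) = opC R j (f z) := fun j z => by
    have := LinearMap.congr_fun (hf (c j)) z
    rwa [actionHom_c] at this
  have hX : ∀ j z, f (opX R j z) = opX R j (f z) := fun j z => by
    have := LinearMap.congr_fun (hf (jucysMurphy j)) z
    rwa [actionHom_jucysMurphy] at this
  have hS : ∀ (k k' : Fin n) (hk : (k' : ℕ) = k + 1) (z), f (opS R hk z) = opS R hk (f z) :=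
    fun k k' hk z => by
      have := LinearMap.congr_fun (hf (transposition k k')) z
      rwa [transposition, actionHom_perm, permHom_swap R hk] at this
  have hsupp : ∀ T v, SupportedAt T (f (single R T v)) := fun T v =>
    supportedAt_of_opX_opX fun j => by
      rw [← hX, ← hX, opX_opX_of_supportedAt (supportedAt_single T v), map_smul]
  obtain ⟨T₀⟩ : Nonempty (StandardTableau lam) := inferInstance
  -- In the commutation of `f` with `s_k`, the component at the exchanged tableau contains only the
  -- `Ω` terms. As `Ω ≠ 0`, `f` acts by the same operator on both summands.
  have hsame : ∀ S v, f (single R S v) S = f (single R T₀ v) T₀ := by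
    refine T₀.induction_move _ (fun _ => rfl) fun S k k' hk hadm _ ih v => ?_
    rw [← ih]
    have h1 := congrFun (hS k k' hk (single R S v)) (S.move hk)
    rw [opS_single, map_add, map_smul, Pi.add_apply, Pi.smul_apply, opS_apply,
      hsupp S _ _ (S.move_ne hk hadm), hsupp S _ _ (S.move_ne hk hadm), map_zero, zero_add,
      zero_add, S.move_move hk, omegaScalar_move] at h1
    exact smul_right_injective _ (omegaScalar_ne_zero hk S hadm) h1
  let g : Module.End F R.V := LinearMap.proj T₀ ∘ₗ f ∘ₗ single R T₀
  have hg : ∀ S v, f (single R S v) S = g v := hsame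
  refine ⟨g, ⟨fun b v => ?_, fun b v => ?_⟩, ?_⟩
  · obtain ⟨j, rfl⟩ := T₀.box.surjective b
    rw [← hg T₀, ← hg T₀, ← opC_single, hC, opC_apply]
  · obtain ⟨j, rfl⟩ := T₀.box.surjective b
    rw [← hg T₀, ← hg T₀, ← opX_single, hX, opX_apply]
  · rw [← sub_eq_zero]
    refine LinearMap.ext fun z => ?_
    have : z ∈ LinearMap.ker (f - diagonal g) := mem_of_single_mem (fun T v => by
      rw [LinearMap.mem_ker, LinearMap.sub_apply, sub_eq_zero]
      refine (hsupp T v).ext (fun S hS => ?_) ?_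
      · rw [diagonal_apply, single_of_ne R hS, map_zero]
      · rw [diagonal_apply, single_same, hg]) z
    exact this

theorem mem_hom_zero {f : (model R).carrier →ₗ[F] (model R).carrier}
    (hR : WeightRep.IsUniversal.{u, 0, w, v'} R odd) (hf : f ∈ homOfParity (model R) (model R) 0) :
    ∃ r : F, f = r • LinearMap.id := by
  obtain ⟨h1, h2⟩ := mem_homOfParity_zero.1 hf
  obtain ⟨g, hg, hfg⟩ := exists_eq_diagonal (R := R) (f := f) fun a =>
    LinearMap.ext fun z => h2 a z
  have hP : R.P * g = g * R.P := by
    obtain ⟨T⟩ : Nonempty (StandardTableau lam) := inferInstance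
    refine LinearMap.ext fun v => ?_
    have h3 : ∀ z : (model R).carrier, (opP R (f z) : Space R) = f (opP R z) := fun z => by
      have := h1 z
      rwa [parityOp_model, parityOp_model] at this
    have h4 : opP R (diagonal g (single R T v)) = diagonal g (opP R (single R T v)) := by
      rw [← hfg]
      exact h3 _
    have h5 := congrFun h4 T
    rwa [opP_apply, diagonal_apply, diagonal_apply, opP_apply, single_same] at h5
  obtain ⟨r, rfl⟩ := hR.even_hom g hg hP
  exact ⟨r, hfg⟩

theorem mem_hom_one {f : (model R).carrier →ₗ[F] (model R).carrier}
    (hf : f ∈ homOfParity (model R) (model R) 1) :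
    ∃ g : Module.End F R.V, WeightRep.IsHom R R g ∧ R.P * g = -(g * R.P) ∧
      f = (diagonal g * opP R : Module.End F (Space R)) := by
  obtain ⟨h1, h2⟩ := mem_homOfParity_one'.1 hf
  let f' : Module.End F (Space R) := f
  obtain ⟨g, hg, hfg⟩ := exists_eq_diagonal (R := R) (f := f' * opP R) fun a =>
    LinearMap.ext fun (z : (model R).carrier) => by
      have := h2 a z
      rw [parityOp_model, parityOp_model] at this
      exact this
  have hPP := opP_mul_self R
  have hff : f' = diagonal g * opP R := by rw [← hfg, mul_assoc, hPP, mul_one]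
  refine ⟨g, hg, ?_, hff⟩
  obtain ⟨T⟩ : Nonempty (StandardTableau lam) := inferInstance
  refine LinearMap.ext fun v => ?_
  have h3 : ∀ z : (model R).carrier, (opP R (f (opP R z)) : Space R) = -f z := fun z => by
    have := h1 z
    rwa [parityOp_model, parityOp_model] at this
  have h4 : opP R ((f' * opP R) (single R T v)) = -f' (single R T v) := h3 _
  rw [hfg, hff] at h4
  have h5 := congrFun h4 T
  rw [opP_apply, Pi.neg_apply, Module.End.mul_apply, diagonal_apply, diagonal_apply, opP_apply,
    single_same] at h5
  exact h5

theorem id_mem_hom : LinearMap.id ∈ hom (model R) (model R) :=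
  Submodule.mem_sup_left (mem_homOfParity_zero.2 ⟨fun _ => rfl, fun _ _ => rfl⟩)

theorem isTypeM_model (hR : WeightRep.IsUniversal.{u, 0, w, v'} R odd) (hodd : ¬ odd) :
    (model R).IsTypeM := by
  have hnt := hR.nontrivial
  have hid : (LinearMap.id : Module.End F (Space R)) ≠ 0 := by
    obtain ⟨v, hv⟩ := exists_ne (0 : R.V)
    obtain ⟨T⟩ : Nonempty (StandardTableau lam) := inferInstance
    intro h
    have h1 := congrFun (LinearMap.congr_fun h (single R T v)) T
    rw [LinearMap.id_apply, single_same] at h1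
    exact hv h1
  have hspan : hom (model R) (model R) = Submodule.span F {LinearMap.id} := by
    apply le_antisymm
    · refine sup_le (fun f hf => ?_) fun f hf => ?_
      · obtain ⟨r, rfl⟩ := mem_hom_zero hR hf
        exact Submodule.smul_mem _ _ (Submodule.mem_span_singleton_self _)
      · obtain ⟨g, hg, hP, rfl⟩ := mem_hom_one hf
        rw [hR.odd_hom_eq_zero hodd g hg hP]
        have : (diagonal (0 : Module.End F R.V) * opP R : Module.End F (Space R)) = 0 := rfl
        rw [this]
        exact Submodule.zero_mem _
    · rw [Submodule.span_singleton_le_iff_mem]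
      exact id_mem_hom
  rw [IsTypeM, hspan]
  exact finrank_span_singleton hid

theorem isTypeQ_model (hR : WeightRep.IsUniversal.{u, 0, w, v'} R odd) (hodd : odd) :
    (model R).IsTypeQ := by
  have hnt := hR.nontrivial
  obtain ⟨η, hη0, hη, hηP, hall⟩ := hR.odd_hom hodd
  obtain ⟨T⟩ : Nonempty (StandardTableau lam) := inferInstance
  obtain ⟨v₀, hv₀⟩ := exists_ne (0 : R.V)
  obtain ⟨v, hv⟩ : ∃ v, η v ≠ 0 := by
    by_contra! h
    exact hη0 (LinearMap.ext h)
  have hPP : ∀ v, R.P (R.P v) = v := fun v => LinearMap.congr_fun R.P_mul_self v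
  -- The operator `η` commutes with the algebra without signs; the parity operator turns it into an
  -- odd homomorphism in the sense of supermodules.
  let e : Module.End F (Space R) := diagonal η * opP R
  have he : ∀ f, e f = diagonal η (opP R f) := fun _ => rfl
  have hemem : e ∈ homOfParity (model R) (model R) 1 := by
    refine mem_homOfParity_one'.2 ⟨fun z => ?_, fun a z => ?_⟩
    · rw [parityOp_model, parityOp_model]
      refine funext fun S => ?_
      have h1 := LinearMap.congr_fun hηP (R.P (R.P (z S)))
      rw [Module.End.mul_apply, LinearMap.neg_apply, Module.End.mul_apply] at h1
      refine h1.trans ?_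
      rw [hPP]
      rfl
    · rw [parityOp_model, parityOp_model]
      have h1 := LinearMap.congr_fun (diagonal_actionHom hη a) z
      have h2 : ∀ y : Space R, e (opP R y) = diagonal η y := fun y => by
        rw [he]
        exact congrArg _ (LinearMap.congr_fun (opP_mul_self R) y)
      refine (h2 _).trans (h1.trans ?_)
      exact congrArg (actionHom R a) (h2 z).symm
  let e' : (model R).carrier →ₗ[F] (model R).carrier := e
  have hspan : hom (model R) (model R) = Submodule.span F (Set.range ![LinearMap.id, e']) := by
    rw [Matrix.range_cons, Matrix.range_cons, Matrix.range_empty, Set.union_empty]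
    apply le_antisymm
    · refine sup_le (fun f hf => ?_) fun f hf => ?_
      · obtain ⟨r, rfl⟩ := mem_hom_zero hR hf
        exact Submodule.smul_mem _ _ (Submodule.subset_span (Or.inl rfl))
      · obtain ⟨g, hg, hP, rfl⟩ := mem_hom_one hf
        obtain ⟨r, rfl⟩ := hall g hg hP
        have : r • e' ∈ Submodule.span F ({LinearMap.id} ∪ {e'}) :=
          Submodule.smul_mem _ _ (Submodule.subset_span (Or.inr rfl))
        exact this
    · rw [Submodule.span_le]
      rintro _ (rfl | rfl)
      · exact id_mem_hom
      · exact Submodule.mem_sup_right hemem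
  have hli : LinearIndependent F ![LinearMap.id, e'] := by
    rw [LinearIndependent.pair_iff]
    intro s t hst'
    have hst : s • (LinearMap.id : Module.End F (Space R)) + t • e = 0 := hst'
    have key : ∀ v, s • v + t • η (R.P v) = 0 := fun v => by
      have h1 := congrFun (LinearMap.congr_fun hst (single R T v)) T
      rw [LinearMap.add_apply, LinearMap.smul_apply, LinearMap.smul_apply, LinearMap.id_apply, he,
        Pi.add_apply, Pi.smul_apply, Pi.smul_apply, diagonal_apply, opP_apply, single_same] at h1
      exact h1
    have h2 : (2 : F) ≠ 0 := two_ne_zero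
    -- Conjugation by the parity operator fixes the identity and negates the odd term, so adding the
    -- two relations isolates `s`.
    have hs : s = 0 := by
      have h1 := key v₀
      have h3 := congrArg R.P (key (R.P v₀))
      have h4 := LinearMap.congr_fun hηP (R.P (R.P v₀))
      simp only [map_add, map_smul, map_zero, hPP, Module.End.mul_apply,
        LinearMap.neg_apply] at h3 h4
      rw [h4, smul_neg] at h3
      have h5 : (2 * s) • v₀ = 0 := by
        calc (2 * s) • v₀ = (s • v₀ + t • η (R.P v₀)) + (s • v₀ + -(t • η (R.P v₀))) := by module
          _ = 0 := by rw [h1, h3, add_zero]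
      have := (smul_eq_zero.1 h5).resolve_right hv₀
      exact (mul_eq_zero.1 this).resolve_left h2
    refine ⟨hs, ?_⟩
    have h1 := key (R.P v)
    rw [hs, zero_smul, zero_add, hPP] at h1
    exact (smul_eq_zero.1 h1).resolve_right hv
  rw [IsTypeQ, hspan]
  exact (finrank_span_eq_card hli).trans (Fintype.card_fin 2)

end Endomorphisms

/-- The squares `L_j²` are even, hence commute with odd homomorphisms too. The image of a vector of
weight `c(T)` therefore has a nonzero component at a tableau with the same contents, and contents
determine the shape. -/
theorem eq_of_isomorphic (R : WeightRep.{u, 0, w} F lam.boxes (boxWeight F lam))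
    (R' : WeightRep.{u, 0, w'} F mu.boxes (boxWeight F mu)) [Nontrivial R.V]
    (h : (model R).Isomorphic (model R')) : lam = mu := by
  obtain ⟨f, hf, hbij⟩ := h
  obtain ⟨f₀, hf₀, f₁, hf₁, rfl⟩ := Submodule.mem_sup.1 hf
  have hcomm : ∀ (j : Fin n) z, (f₀ + f₁) ((jucysMurphy j ^ 2 : Y F n) • z) =
      (jucysMurphy j ^ 2 : Y F n) • (f₀ + f₁) z := fun j z => by
    rw [LinearMap.add_apply, (mem_homOfParity_zero.1 hf₀).2, (mem_homOfParity_one.1 hf₁).2,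
      map_pow, parity_jucysMurphy, ← smul_add]
    rfl
  obtain ⟨T⟩ : Nonempty (StandardTableau lam) := inferInstance
  obtain ⟨v, hv⟩ := exists_ne (0 : R.V)
  have hz0 : (f₀ + f₁) (single R T v) ≠ 0 := by
    intro h0
    have h1 := hbij.1 (h0.trans (map_zero (f₀ + f₁)).symm)
    have h2 := congrFun h1 T
    rw [single_same] at h2
    exact hv h2
  obtain ⟨S, hS⟩ : ∃ S : StandardTableau mu, ((f₀ + f₁) (single R T v) : Space R') S ≠ 0 := by
    by_contra! h
    exact hz0 (funext h)
  refine StandardTableau.shape_eq_of_content_eq (T := T) (S := S) (funext fun j => ?_)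
  have h1 := hcomm j (single R T v)
  rw [jucysMurphy_sq_smul_single, map_smul, jucysMurphy_sq_smul] at h1
  have h2 := (congrFun h1 S).trans (opX_opX_apply j _ S)
  by_contra hne
  have h3 : (q F (T.content j) - q F (S.content j)) • ((f₀ + f₁) (single R T v) : Space R') S = 0 := by
    rw [sub_smul, sub_eq_zero]
    exact h2
  exact hS ((smul_eq_zero.1 h3).resolve_left (sub_ne_zero.2 (q_ne hne)))

end SeminormalModel

/-! ### Weight spaces and intertwiners in completely splittable modules -/

set_option linter.unusedSectionVars false

namespace HeckeClifford

open SuperModule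

/-- The hypothesis says that (f - r)² kills `z`, and a semisimple operator has no nontrivial Jordan
blocks. -/
theorem _root_.Module.End.IsSemisimple.apply_eq_of_sub_sub {F : Type u} [Field F] {V : Type v}
    [AddCommGroup V] [Module F V] {f : Module.End F V} (hf : f.IsSemisimple) {r : F} {z : V}
    (h : f (f z - r • z) = r • (f z - r • z)) : f z = r • z := by
  have h1 : z ∈ f.maxGenEigenspace r := by
    rw [Module.End.mem_maxGenEigenspace]
    refine ⟨2, ?_⟩
    rw [sq, Module.End.mul_apply]
    simp only [LinearMap.sub_apply, LinearMap.smul_apply, Module.End.one_apply]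
    rw [h, sub_self]
  rw [hf.isFinitelySemisimple.maxGenEigenspace_eq_eigenspace] at h1
  exact Module.End.mem_eigenspace_iff.1 h1

section JointEigenspace

variable {F : Type u} [Field F] [NeZero (2 : F)] {n : ℕ} (M : YModule.{u, w} F n)
  {ι : Type v} (e : ι → Fin n) (a : ι → F)

/-- The joint eigenspace of the squares of the Jucys-Murphy elements. -/
def jointEigenspace : Submodule F M.carrier where
  carrier := {z | ∀ b, (jucysMurphy (e b) : Y F n) • (jucysMurphy (e b) : Y F n) • z = a b • z}
  add_mem' hy hz b := by rw [smul_add, smul_add, hy, hz, smul_add]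
  zero_mem' b := by rw [smul_zero, smul_zero, smul_zero]
  smul_mem' r z hz b := by
    rw [smul_comm _ r, smul_comm _ r, hz, smul_comm]

variable {M e a}

theorem parityOp_mem_jointEigenspace {z : M.carrier} (hz : z ∈ jointEigenspace M e a) :
    M.parityOp z ∈ jointEigenspace M e a := by
  intro b
  have h := parityOp_smul M (jucysMurphy (e b)) ((jucysMurphy (e b) : Y F n) • z)
  rw [hz b, parityOp_smul, parity_jucysMurphy, map_smul] at h
  exact h.symm

theorem c_smul_jucysMurphy_sq (j k : Fin n) (z : M.carrier) :
    (jucysMurphy k : Y F n) • (jucysMurphy k : Y F n) • (c j : Y F n) • z =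
      (c j : Y F n) • (jucysMurphy k : Y F n) • (jucysMurphy k : Y F n) • z := by
  simp only [← mul_smul]
  congr 1
  by_cases h : j = k
  · subst h
    rw [← mul_assoc (c j), c_mul_jucysMurphy_self, neg_mul, mul_assoc, c_mul_jucysMurphy_self,
      mul_neg, neg_neg]
  · rw [← mul_assoc (c j), c_mul_jucysMurphy_of_ne h, mul_assoc, c_mul_jucysMurphy_of_ne h]

theorem c_smul_mem_jointEigenspace {z : M.carrier} (hz : z ∈ jointEigenspace M e a) (j : Fin n) :
    (c j : Y F n) • z ∈ jointEigenspace M e a := by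
  intro b
  rw [c_smul_jucysMurphy_sq, hz b, smul_comm]

theorem jucysMurphy_smul_mem_jointEigenspace {z : M.carrier} (hz : z ∈ jointEigenspace M e a)
    (j : Fin n) : (jucysMurphy j : Y F n) • z ∈ jointEigenspace M e a := by
  intro b
  have h : ∀ y : M.carrier, (jucysMurphy (e b) : Y F n) • (jucysMurphy j : Y F n) • y =
      (jucysMurphy j : Y F n) • (jucysMurphy (e b) : Y F n) • y := fun y => by
    rw [← mul_smul, (jucysMurphy_commute (e b) j).eq, mul_smul]
  rw [h, h, hz b, smul_comm]

end JointEigenspace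

section WeightRep

variable {F : Type u} [Field F] [CharZero F] {n : ℕ} {M : YModule.{u, w} F n}
  (hM : IsCompletelySplittable M) {ι : Type v} (e : ι ≃ Fin n) (a : ι → F)
include hM

theorem jucysMurphy_smul_eq_zero {k : Fin n} {z : M.carrier}
    (h : (jucysMurphy k : Y F n) • (jucysMurphy k : Y F n) • z = 0) :
    (jucysMurphy k : Y F n) • z = 0 := by
  have := (hM k).apply_eq_of_sub_sub (r := 0) (z := z) (by
    rw [zero_smul, sub_zero, zero_smul]
    exact h)
  rwa [zero_smul] at this

/-- The joint eigenspaces as weight representations. -/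
noncomputable def weightRep : WeightRep.{u, v, w} F ι a where
  V := jointEigenspace M e a
  P := M.parityOp.restrict fun _ h => parityOp_mem_jointEigenspace h
  C b := (M.op (c (e b))).restrict fun _ h => c_smul_mem_jointEigenspace h _
  X b := (M.op (jucysMurphy (e b))).restrict fun _ h => jucysMurphy_smul_mem_jointEigenspace h _
  P_mul_self := LinearMap.ext fun z => Subtype.ext (parityOp_parityOp _)
  P_mul_C b := LinearMap.ext fun z => Subtype.ext (by
    refine (parityOp_smul M (c (e b)) z).trans ?_
    rw [parity_c, neg_smul]
    rfl)
  P_mul_X b := LinearMap.ext fun z => Subtype.ext (by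
    refine (parityOp_smul M (jucysMurphy (e b)) z).trans ?_
    rw [parity_jucysMurphy]
    rfl)
  C_mul_self b := LinearMap.ext fun z => Subtype.ext (by
    change (c (e b) : Y F n) • (c (e b) : Y F n) • (z : M.carrier) = z
    rw [← mul_smul, c_mul_self, one_smul])
  C_mul_C b b' h := LinearMap.ext fun z => Subtype.ext (by
    change (c (e b) : Y F n) • (c (e b') : Y F n) • (z : M.carrier) =
      -((c (e b') : Y F n) • (c (e b) : Y F n) • (z : M.carrier))
    rw [← mul_smul, c_mul_c _ _ (e.injective.ne h), neg_smul, mul_smul])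
  C_mul_X_self b := LinearMap.ext fun z => Subtype.ext (by
    change (c (e b) : Y F n) • (jucysMurphy (e b) : Y F n) • (z : M.carrier) =
      -((jucysMurphy (e b) : Y F n) • (c (e b) : Y F n) • (z : M.carrier))
    rw [← mul_smul, c_mul_jucysMurphy_self, neg_smul, mul_smul])
  C_mul_X b b' h := LinearMap.ext fun z => Subtype.ext (by
    change (c (e b) : Y F n) • (jucysMurphy (e b') : Y F n) • (z : M.carrier) =
      (jucysMurphy (e b') : Y F n) • (c (e b) : Y F n) • (z : M.carrier)
    rw [← mul_smul, c_mul_jucysMurphy_of_ne (e.injective.ne h), mul_smul])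
  X_mul_X b b' := LinearMap.ext fun z => Subtype.ext (by
    change (jucysMurphy (e b) : Y F n) • (jucysMurphy (e b') : Y F n) • (z : M.carrier) =
      (jucysMurphy (e b') : Y F n) • (jucysMurphy (e b) : Y F n) • (z : M.carrier)
    rw [← mul_smul, (jucysMurphy_commute (e b) (e b')).eq, mul_smul])
  X_mul_self b := LinearMap.ext fun z => Subtype.ext (z.2 b)
  -- Complete splittability is used here: on a vector killed by `L²`, a semisimple `L` vanishes.
  X_eq_zero b hb := LinearMap.ext fun z => Subtype.ext (jucysMurphy_smul_eq_zero hM (by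
    refine (z.2 b).trans ?_
    rw [hb, zero_smul]))

/-- The inclusion of a joint eigenspace. -/
def weightRepIncl : (weightRep hM e a).V →ₗ[F] M.carrier := (jointEigenspace M e a).subtype

variable {e a}

theorem weightRepIncl_injective : Function.Injective (weightRepIncl hM e a) :=
  Subtype.val_injective

theorem weightRepIncl_mem (v : (weightRep hM e a).V) :
    weightRepIncl hM e a v ∈ jointEigenspace M e a := v.2

theorem exists_weightRepIncl {z : M.carrier} (hz : z ∈ jointEigenspace M e a) :
    ∃ v, weightRepIncl hM e a v = z := ⟨⟨z, hz⟩, rfl⟩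

theorem weightRepIncl_C (b : ι) (v : (weightRep hM e a).V) :
    weightRepIncl hM e a ((weightRep hM e a).C b v) =
      (c (e b) : Y F n) • weightRepIncl hM e a v := rfl

theorem weightRepIncl_X (b : ι) (v : (weightRep hM e a).V) :
    weightRepIncl hM e a ((weightRep hM e a).X b v) =
      (jucysMurphy (e b) : Y F n) • weightRepIncl hM e a v := rfl

theorem weightRepIncl_P (v : (weightRep hM e a).V) :
    weightRepIncl hM e a ((weightRep hM e a).P v) = M.parityOp (weightRepIncl hM e a v) := rfl

end WeightRep

section Intertwiner

variable {F : Type u} [Field F] [CharZero F] {n : ℕ}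

/-- The numerator of `-Ξ_k`. -/
noncomputable def xiNum (k k' : Fin n) : Y F n :=
  jucysMurphy k + jucysMurphy k' + c k * (c k' * (jucysMurphy k - jucysMurphy k'))

/-- The intertwiner `s_k - Ξ_k` on a weight space, where `d` is the difference of the weights. -/
noncomputable def intertwiner (k k' : Fin n) (d : F) : Y F n :=
  transposition k k' + d⁻¹ • xiNum k k'

theorem xiNum_swap {k k' : Fin n} (h : k ≠ k') : (xiNum k' k : Y F n) = xiNum k k' := by
  simp only [xiNum, mul_sub, c_mul_c_mul_c k' k h.symm]
  abel

variable {M : YModule.{u, w} F n} (hM : IsCompletelySplittable M) {ι : Type v} {e : ι ≃ Fin n}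
  {a : ι → F}

theorem weightRepIncl_xiNum (b b' : ι) (v : (weightRep hM e a).V) :
    weightRepIncl hM e a ((weightRep hM e a).xiNum b b' v) =
      (xiNum (e b) (e b') : Y F n) • weightRepIncl hM e a v := by
  rw [xiNum, add_smul, add_smul, mul_smul, mul_smul, sub_smul]
  rfl

theorem weightRepIncl_xi (b b' : ι) (v : (weightRep hM e a).V) :
    weightRepIncl hM e a ((weightRep hM e a).xi b b' v) =
      -((a b - a b')⁻¹ • (xiNum (e b) (e b') : Y F n) • weightRepIncl hM e a v) := by
  rw [← weightRepIncl_xiNum, ← map_smul, ← map_neg]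
  rfl

theorem intertwiner_smul (b b' : ι) (v : (weightRep hM e a).V) :
    (intertwiner (e b) (e b') (a b - a b') : Y F n) • weightRepIncl hM e a v =
      (transposition (e b) (e b') : Y F n) • weightRepIncl hM e a v -
        weightRepIncl hM e a ((weightRep hM e a).xi b b' v) := by
  rw [weightRepIncl_xi, intertwiner, add_smul, smul_assoc, sub_neg_eq_add]

theorem xiNum_smul_xiNum_smul_weightRepIncl {b b' : ι} (h : b ≠ b')
    (v : (weightRep hM e a).V) :
    (xiNum (e b) (e b') : Y F n) • (xiNum (e b) (e b') : Y F n) • weightRepIncl hM e a v =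
      (2 * (a b + a b')) • weightRepIncl hM e a v := by
  have := LinearMap.congr_fun (WeightRep.xiNum_mul_self (R := weightRep hM e a) h) v
  rw [← weightRepIncl_xiNum, ← weightRepIncl_xiNum, ← map_smul]
  exact congrArg _ this

include hM in
theorem xiNum_smul_xiNum_smul {a : Fin n → F} {k k' : Fin n} (h : k ≠ k') {z : M.carrier}
    (hz : z ∈ jointEigenspace M id a) : (xiNum k k' : Y F n) • (xiNum k k' : Y F n) • z =
      (2 * (a k + a k')) • z := by
  obtain ⟨v, rfl⟩ := exists_weightRepIncl (e := Equiv.refl _) hM hz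
  exact xiNum_smul_xiNum_smul_weightRepIncl hM h v

end Intertwiner

theorem add_smul_add_smul {F : Type*} [Field F] {A : Type*} [Ring A] [Algebra F A] {V : Type*} [AddCommGroup V]
    [Module F V] [Module A V] [IsScalarTower F A V] {x y : A} {z : V} {r d : F}
    (hx : x • x • z = z) (hxy : y • x • z = x • y • z) (hy : y • y • z = r • z) :
    (x + (-d⁻¹) • y) • (x + d⁻¹ • y) • z = (1 - r / d ^ 2) • z := by
  simp only [add_smul, smul_add, smul_assoc, smul_comm x (_ : F), smul_comm y (_ : F), hx, hxy, hy]
  generalize x • y • z = p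
  module

section Adjacent

variable {F : Type u} [Field F] [CharZero F] {n : ℕ} {M : YModule.{u, w} F n}
  (hM : IsCompletelySplittable M) {a : Fin n → F} {k k' : Fin n} (hk : (k' : ℕ) = k + 1)

theorem intertwiner_smul' (v : (weightRep hM (Equiv.refl _) a).V) :
    (intertwiner k k' (a k - a k') : Y F n) • weightRepIncl hM _ a v =
      (transposition k k' : Y F n) • weightRepIncl hM _ a v -
        weightRepIncl hM _ a ((weightRep hM (Equiv.refl _) a).xi k k' v) :=
  intertwiner_smul hM k k' v

variable {z : M.carrier} (hz : z ∈ jointEigenspace M id a)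
include hM hk hz

theorem intertwiner_smul_c (j : Fin n) :
    (intertwiner k k' (a k - a k') : Y F n) • (c j : Y F n) • z =
      (c (Equiv.swap k k' j) : Y F n) • (intertwiner k k' (a k - a k') : Y F n) • z := by
  have hne := SeminormalModel.adjacent_ne hk
  obtain ⟨v, rfl⟩ := exists_weightRepIncl (e := Equiv.refl _) hM hz
  have hxi : (weightRep hM (Equiv.refl _) a).xi k k' ((weightRep hM (Equiv.refl _) a).C j v) =
      (weightRep hM (Equiv.refl _) a).C (Equiv.swap k k' j)
        ((weightRep hM (Equiv.refl _) a).xi k k' v) := by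
    by_cases h : j = k
    · rw [h, Equiv.swap_apply_left, WeightRep.xi_C_left hne]
    · by_cases h' : j = k'
      · rw [h', Equiv.swap_apply_right, WeightRep.xi_C_right hne]
      · rw [Equiv.swap_apply_of_ne_of_ne h h', WeightRep.xi_C h h']
  refine (intertwiner_smul' hM ((weightRep hM (Equiv.refl _) a).C j v)).trans ?_
  rw [hxi, intertwiner_smul', smul_sub, weightRepIncl_C, weightRepIncl_C]
  simp only [Equiv.refl_apply]
  rw [← mul_smul, transposition, perm_mul_c, mul_smul]

/-- The corrections in the commutation of `L_j` with the transposition and with `Ξ_k` are identical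
and cancel in the difference. -/
theorem intertwiner_smul_jucysMurphy (ha : a k ≠ a k') (j : Fin n) :
    (intertwiner k k' (a k - a k') : Y F n) • (jucysMurphy j : Y F n) • z =
      (jucysMurphy (Equiv.swap k k' j) : Y F n) •
        (intertwiner k k' (a k - a k') : Y F n) • z := by
  have hne := SeminormalModel.adjacent_ne hk
  obtain ⟨v, rfl⟩ := exists_weightRepIncl (e := Equiv.refl _) hM hz
  refine (intertwiner_smul' hM ((weightRep hM (Equiv.refl _) a).X j v)).trans ?_
  rw [intertwiner_smul', smul_sub, weightRepIncl_X]
  simp only [Equiv.refl_apply]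
  by_cases h : j = k
  · rw [h, Equiv.swap_apply_left, WeightRep.xi_X_left hne ha, ← mul_smul,
      transposition_mul_jucysMurphy hk, map_sub, map_add, weightRepIncl_X, weightRepIncl_C,
      weightRepIncl_C, sub_smul, add_smul, one_smul, mul_smul, mul_smul]
    simp only [Equiv.refl_apply]
    abel
  · by_cases h' : j = k'
    · rw [h', Equiv.swap_apply_right, WeightRep.xi_X_right hne ha, ← mul_smul,
        transposition_mul_jucysMurphy' hk, map_add, map_sub, weightRepIncl_X, weightRepIncl_C,
        weightRepIncl_C, add_smul, sub_smul, one_smul, mul_smul, mul_smul]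
      simp only [Equiv.refl_apply]
      abel
    · rw [Equiv.swap_apply_of_ne_of_ne h h', WeightRep.xi_X h h', ← mul_smul,
        transposition_mul_jucysMurphy_of_ne hk h h', weightRepIncl_X, mul_smul]
      rfl

theorem parityOp_intertwiner_smul :
    M.parityOp ((intertwiner k k' (a k - a k') : Y F n) • z) =
      (intertwiner k k' (a k - a k') : Y F n) • M.parityOp z := by
  obtain ⟨v, rfl⟩ := exists_weightRepIncl (e := Equiv.refl _) hM hz
  refine Eq.trans ?_ (intertwiner_smul' hM ((weightRep hM (Equiv.refl _) a).P v)).symm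
  rw [intertwiner_smul', map_sub, parityOp_smul, transposition, parity_perm, ← weightRepIncl_P,
    ← weightRepIncl_P, WeightRep.P_xi]

theorem intertwiner_smul_mem (ha : a k ≠ a k') :
    (intertwiner k k' (a k - a k') : Y F n) • z ∈
      jointEigenspace M id (a ∘ Equiv.swap k k') := by
  intro j
  have h1 := intertwiner_smul_jucysMurphy hM hk (jucysMurphy_smul_mem_jointEigenspace hz
    (Equiv.swap k k' j)) ha (Equiv.swap k k' j)
  rw [intertwiner_smul_jucysMurphy hM hk hz ha, Equiv.swap_apply_self,
    show (jucysMurphy (Equiv.swap k k' j) : Y F n) • (jucysMurphy (Equiv.swap k k' j) : Y F n) • z =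
      a (Equiv.swap k k' j) • z from hz _, smul_comm] at h1
  exact h1.symm

/-- On the weight space `N = xiNum k k'` commutes with the intertwiner, hence with the transposition
`s`. The exchange of the weights reverses the sign of the difference `d`, so the composite is (s -
N/d)(s + N/d) = 1 - N²/d². -/
theorem intertwiner_smul_intertwiner_smul (ha : a k ≠ a k') :
    (intertwiner k k' (a k' - a k) : Y F n) • (intertwiner k k' (a k - a k') : Y F n) • z =
      (1 - 2 * (a k + a k') / (a k - a k') ^ 2) • z := by
  have hne := SeminormalModel.adjacent_ne hk
  have hmem := intertwiner_smul_mem hM hk hz ha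
  obtain ⟨v, rfl⟩ := exists_weightRepIncl (e := Equiv.refl _) hM hz
  have hd : (a k' - a k)⁻¹ = -(a k - a k')⁻¹ := by rw [← neg_sub, inv_neg]
  have hN : (xiNum k k' : Y F n) • (intertwiner k k' (a k - a k') : Y F n) •
      weightRepIncl hM (Equiv.refl _) a v = (intertwiner k k' (a k - a k') : Y F n) •
        (xiNum k k' : Y F n) • weightRepIncl hM (Equiv.refl _) a v := by
    have hz' := weightRepIncl_mem hM v
    have hL := fun (j : Fin n) => intertwiner_smul_jucysMurphy hM hk hz' ha j
    have hC := fun (j l : Fin n) => intertwiner_smul_c hM hk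
      (jucysMurphy_smul_mem_jointEigenspace hz' j) l
    have hCC := fun (j l m : Fin n) => intertwiner_smul_c hM hk (c_smul_mem_jointEigenspace
      (jucysMurphy_smul_mem_jointEigenspace hz' j) l) m
    rw [← xiNum_swap hne]
    nth_rewrite 2 [xiNum_swap hne]
    simp only [xiNum, add_smul, mul_smul, sub_smul, smul_add, smul_sub, hL, hC, hCC,
      Equiv.swap_apply_left, Equiv.swap_apply_right]
  have hNt : (xiNum k k' : Y F n) • (transposition k k' : Y F n) •
      weightRepIncl hM (Equiv.refl _) a v = (transposition k k' : Y F n) •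
        (xiNum k k' : Y F n) • weightRepIncl hM (Equiv.refl _) a v := by
    simpa only [intertwiner, add_smul, smul_add, smul_assoc, smul_comm (xiNum k k' : Y F n)
      (a k - a k')⁻¹, add_left_inj] using hN
  have hNN := xiNum_smul_xiNum_smul hM hne (weightRepIncl_mem (e := Equiv.refl _) hM v)
  have htt : (transposition k k' : Y F n) • (transposition k k' : Y F n) •
      weightRepIncl hM (Equiv.refl _) a v = weightRepIncl hM (Equiv.refl _) a v := by
    rw [← mul_smul, transposition_mul_self, one_smul]
  rw [intertwiner, intertwiner, hd]
  exact add_smul_add_smul htt hNt hNN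

end Adjacent

end HeckeClifford

/-! ### Restrictions on consecutive weights -/

set_option linter.unusedSectionVars false

namespace HeckeClifford

open SuperModule

section EqualWeights

variable {F : Type u} [Field F] [CharZero F] {n : ℕ} {M : YModule.{u, w} F n}
  (hM : IsCompletelySplittable M) {a : Fin n → F} {k k' : Fin n}

theorem xiNum_smul_mem {z : M.carrier} (hz : z ∈ jointEigenspace M id a) :
    (xiNum k k' : Y F n) • z ∈ jointEigenspace M id a := by
  rw [xiNum, add_smul, add_smul, mul_smul, mul_smul, sub_smul]
  exact add_mem (add_mem (jucysMurphy_smul_mem_jointEigenspace hz k)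
    (jucysMurphy_smul_mem_jointEigenspace hz k')) (c_smul_mem_jointEigenspace
      (c_smul_mem_jointEigenspace (sub_mem (jucysMurphy_smul_mem_jointEigenspace hz k)
        (jucysMurphy_smul_mem_jointEigenspace hz k')) k') k)

variable (hk : (k' : ℕ) = k + 1)
include hk

theorem jucysMurphy_smul_transposition_smul (z : M.carrier) :
    (jucysMurphy k' : Y F n) • (transposition k k' : Y F n) • z =
      (transposition k k' : Y F n) • (jucysMurphy k : Y F n) • z +
        (z + (c k : Y F n) • (c k' : Y F n) • z) := by
  have h := congrArg (· • z) (transposition_mul_jucysMurphy (F := F) hk)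
  simp only [sub_smul, add_smul, one_smul, mul_smul] at h
  rw [h, sub_add_cancel]

theorem jucysMurphy_sq_smul_transposition_smul (z : M.carrier) :
    (jucysMurphy k' : Y F n) • (jucysMurphy k' : Y F n) • (transposition k k' : Y F n) • z =
      (transposition k k' : Y F n) • (jucysMurphy k : Y F n) • (jucysMurphy k : Y F n) • z +
        (xiNum k k' : Y F n) • z := by
  have hne := SeminormalModel.adjacent_ne hk
  have h1 : (jucysMurphy k' : Y F n) • (c k : Y F n) • (c k' : Y F n) • z =
      -((c k : Y F n) • (c k' : Y F n) • (jucysMurphy k' : Y F n) • z) := by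
    simp only [← mul_smul]
    rw [← mul_assoc (jucysMurphy k'), ← c_mul_jucysMurphy_of_ne hne, mul_assoc,
      c_mul_jucysMurphy_self, mul_neg, neg_smul, neg_neg]
  rw [jucysMurphy_smul_transposition_smul hk, smul_add, smul_add, h1,
    jucysMurphy_smul_transposition_smul hk, xiNum, add_smul, add_smul, mul_smul, mul_smul, sub_smul,
    smul_sub, smul_sub]
  abel

variable [Module.Finite F M.carrier] {z : M.carrier} (hz : z ∈ jointEigenspace M id a)
include hM hz

/-- For equal weights, `L_k'²` sends `s_k z` to `a k • s_k z` plus `xiNum k k' • z`, and the latter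
is again an eigenvector for `a k`. Semisimplicity forces it to vanish. Since `xiNum` squares to 4
a_k, this leaves only a_k = 0; then `L_k z` and `L_k' s_k z` both vanish, which gives z = -c_k c_k'
z. This is impossible for z ≠ 0, as (c_k c_k')² = -1. -/
theorem eq_zero_of_weight_eq (ha : a k = a k') : z = 0 := by
  have hne := SeminormalModel.adjacent_ne hk
  have hx : (jucysMurphy k : Y F n) • (jucysMurphy k : Y F n) • z = a k • z := hz k
  have hy := jucysMurphy_sq_smul_transposition_smul hk z
  rw [hx, smul_comm _ (a k)] at hy
  have hs : ((M.op (jucysMurphy k') : Module.End F M.carrier) ^ 2).IsSemisimple := (hM k').pow 2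
  have hN : (xiNum k k' : Y F n) • z = 0 := by
    have h1 := hs.apply_eq_of_sub_sub (r := a k) (z := (transposition k k' : Y F n) • z) (by
      rw [sq]
      change (jucysMurphy k' : Y F n) • (jucysMurphy k' : Y F n) •
        ((jucysMurphy k' : Y F n) • (jucysMurphy k' : Y F n) • (transposition k k' : Y F n) • z -
          a k • (transposition k k' : Y F n) • z) = a k • 
        ((jucysMurphy k' : Y F n) • (jucysMurphy k' : Y F n) • (transposition k k' : Y F n) • z -
          a k • (transposition k k' : Y F n) • z)
      rw [hy, add_sub_cancel_left, ha]
      exact xiNum_smul_mem hz k')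
    rw [sq] at h1
    exact left_eq_add.1 (h1.symm.trans hy)
  have h4 := xiNum_smul_xiNum_smul hM hne hz
  rw [hN, smul_zero, eq_comm, smul_eq_zero, ← ha] at h4
  refine h4.elim (fun h0 => ?_) id
  have h1 : a k = 0 := by linear_combination h0 / 4
  have hx0 : (jucysMurphy k : Y F n) • z = 0 :=
    jucysMurphy_smul_eq_zero hM (by rw [hx, h1, zero_smul])
  have hy0 := jucysMurphy_smul_eq_zero hM (hy.trans (by rw [h1, zero_smul, hN, add_zero]))
  have hc := jucysMurphy_smul_transposition_smul hk z
  rw [hy0, hx0, smul_zero, zero_add, eq_comm, add_eq_zero_iff_eq_neg'] at hc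
  have hcc : (c k : Y F n) • (c k' : Y F n) • (c k : Y F n) • (c k' : Y F n) • z = -z := by
    simp only [← mul_smul]
    rw [← mul_assoc (c k') (c k), c_mul_c k' k hne.symm, neg_mul, mul_assoc, c_mul_self, mul_one,
      mul_neg, c_mul_self, neg_smul, one_smul]
  rw [hc, smul_neg, smul_neg, hc, neg_neg] at hcc
  have h2 : (2 : F) • z = 0 := by rw [two_smul]; nth_rewrite 1 [hcc]; exact neg_add_cancel z
  exact (smul_eq_zero.1 h2).resolve_left two_ne_zero

end EqualWeights

theorem xiNum_smul_braid_weightRepIncl {F : Type u} [Field F] [CharZero F] {n : ℕ}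
    {M : YModule.{u, w} F n} (hM : IsCompletelySplittable M) {ι : Type v} {e : ι ≃ Fin n}
    {a : ι → F} {b₁ b₂ b₃ : ι} (h12 : b₁ ≠ b₂) (h13 : b₁ ≠ b₃) (h23 : b₂ ≠ b₃) (ha : a b₁ = a b₃)
    (v : (weightRep hM e a).V) :
    (xiNum (e b₁) (e b₂) : Y F n) • (xiNum (e b₂) (e b₃) : Y F n) • (xiNum (e b₁) (e b₂) : Y F n) •
      weightRepIncl hM e a v + (xiNum (e b₂) (e b₃) : Y F n) • (xiNum (e b₁) (e b₂) : Y F n) •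
        (xiNum (e b₂) (e b₃) : Y F n) • weightRepIncl hM e a v =
      (2 * a b₁ + 6 * a b₂) • (xiNum (e b₁) (e b₃) : Y F n) • weightRepIncl hM e a v := by
  have h := WeightRep.xiNum_braid (R := weightRep hM e a) h12 h13 h23 ha.symm
  rw [add_comm (WeightRep.X _ b₃)] at h
  simp only [← weightRepIncl_xiNum]
  rw [← map_smul, ← map_add]
  exact congrArg _ (LinearMap.congr_fun h v)

section Braid

variable {F : Type u} [Field F] [CharZero F] {n : ℕ} {M : YModule.{u, w} F n}
  (hM : IsCompletelySplittable M) {a : Fin n → F} {k k' k'' : Fin n} [Module.Finite F M.carrier]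
include hM

theorem xiNum_smul_braid (h12 : k ≠ k') (h13 : k ≠ k'') (h23 : k' ≠ k'') (ha : a k = a k'')
    {z : M.carrier} (hz : z ∈ jointEigenspace M id a) :
    (xiNum k k' : Y F n) • (xiNum k' k'' : Y F n) • (xiNum k k' : Y F n) • z +
      (xiNum k' k'' : Y F n) • (xiNum k k' : Y F n) • (xiNum k' k'' : Y F n) • z =
        (2 * a k + 6 * a k') • (xiNum k k'' : Y F n) • z := by
  obtain ⟨v, rfl⟩ := exists_weightRepIncl (e := Equiv.refl _) hM hz
  exact xiNum_smul_braid_weightRepIncl hM h12 h13 h23 ha v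

theorem intertwiner_smul_eq_zero (hk : (k' : ℕ) = k + 1) (ha : a k ≠ a k') {l l' : Fin n}
    (hl : (l' : ℕ) = l + 1) (hll : a (Equiv.swap k k' l) = a (Equiv.swap k k' l'))
    {z : M.carrier} (hz : z ∈ jointEigenspace M id a) :
    (intertwiner k k' (a k - a k') : Y F n) • z = 0 :=
  eq_zero_of_weight_eq hM hl (intertwiner_smul_mem hM hk hz ha) hll

/-- Either intertwiner would produce a weight with two equal neighbours, so both are zero and the
two transpositions act by `Ξ`. By the braid anomaly, the braid relation becomes (2 a_k + 6 a_k')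
`xiNum k k''` z = 0, while the square of `xiNum k k''` is 4 a_k. -/
theorem weight_eq_of_eq (hk : (k' : ℕ) = k + 1) (hk' : (k'' : ℕ) = k' + 1) (ha : a k = a k'')
    {z : M.carrier} (hz : z ∈ jointEigenspace M id a) (h0 : z ≠ 0) :
    a k = 0 ∨ a k + 3 * a k' = 0 := by
  have h12 := SeminormalModel.adjacent_ne hk
  have h23 := SeminormalModel.adjacent_ne hk'
  have h13 : k ≠ k'' := by rw [ne_eq, Fin.ext_iff]; omega
  have hne : a k ≠ a k' := fun h => h0 (eq_zero_of_weight_eq hM hk hz h)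
  have hs : ∀ y ∈ jointEigenspace M id a, (transposition k k' : Y F n) • y =
      (-(a k - a k')⁻¹) • (xiNum k k' : Y F n) • y := fun y hy => by
    have := intertwiner_smul_eq_zero hM hk hne hk' (by
      rw [Equiv.swap_apply_right, Equiv.swap_apply_of_ne_of_ne h13.symm h23.symm, ha]) hy
    rw [intertwiner, add_smul, smul_assoc] at this
    rw [neg_smul]
    exact eq_neg_of_add_eq_zero_left this
  have hs' : ∀ y ∈ jointEigenspace M id a, (transposition k' k'' : Y F n) • y =
      ((a k - a k')⁻¹) • (xiNum k' k'' : Y F n) • y := fun y hy => by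
    have := intertwiner_smul_eq_zero hM hk' (fun h => hne (ha.trans h.symm)) hk (by
      rw [Equiv.swap_apply_left, Equiv.swap_apply_of_ne_of_ne h12 h13, ha]) hy
    rw [intertwiner, add_smul, smul_assoc, ← ha, ← neg_sub, inv_neg, neg_smul] at this
    exact eq_of_sub_eq_zero (sub_eq_add_neg _ _ |>.trans this)
  have hN := fun y (hy : y ∈ jointEigenspace M id a) => xiNum_smul_mem (k := k) (k' := k') hy
  have hN' := fun y (hy : y ∈ jointEigenspace M id a) => xiNum_smul_mem (k := k') (k' := k'') hy
  have hb : (transposition k k' : Y F n) • (transposition k' k'' : Y F n) •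
      (transposition k k' : Y F n) • z = (transposition k' k'' : Y F n) •
        (transposition k k' : Y F n) • (transposition k' k'' : Y F n) • z := by
    simp only [← mul_smul, transposition, perm_mul]
    congr 2
    rw [← mul_assoc, ← mul_assoc, Equiv.swap_mul_swap_mul_swap h12 h13, Equiv.swap_comm k' k'',
      Equiv.swap_comm k k', Equiv.swap_mul_swap_mul_swap h23.symm h13.symm, Equiv.swap_comm]
  rw [hs _ hz, hs' _ hz] at hb
  simp only [smul_comm (transposition _ _ : Y F n) (_ : F), hs' _ (hN _ hz), hs _ (hN' _ (hN _ hz)),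
    hs _ (hN' _ hz), hs' _ (hN _ (hN' _ hz))] at hb
  have hd : (a k - a k')⁻¹ ≠ 0 := inv_ne_zero (sub_ne_zero.2 hne)
  -- The two transpositions carry opposite signs because `a k' - a k'' = -(a k - a k')`; so the
  -- braid relation becomes the vanishing of a sum.
  have hb' : (xiNum k k' : Y F n) • (xiNum k' k'' : Y F n) • (xiNum k k' : Y F n) • z +
      (xiNum k' k'' : Y F n) • (xiNum k k' : Y F n) • (xiNum k' k'' : Y F n) • z = 0 := by
    refine (smul_eq_zero.1 ?_).resolve_left (pow_ne_zero 3 hd)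
    generalize (xiNum k k' : Y F n) • (xiNum k' k'' : Y F n) • (xiNum k k' : Y F n) • z = p at hb ⊢
    generalize (xiNum k' k'' : Y F n) • (xiNum k k' : Y F n) • (xiNum k' k'' : Y F n) • z = r at hb ⊢
    rw [smul_add]
    refine Eq.trans ?_ (sub_eq_zero.2 hb)
    module
  have hx := xiNum_smul_braid hM h12 h13 h23 ha hz
  rw [hb'] at hx
  have h4 := xiNum_smul_xiNum_smul hM h13 hz
  rcases smul_eq_zero.1 hx.symm with h | h
  · right
    linear_combination h / 2
  · left
    rw [h, smul_zero, eq_comm, smul_eq_zero, ← ha] at h4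
    linear_combination (h4.resolve_right h0) / 4

end Braid

end HeckeClifford

/-! ### The weights are the content vectors of standard tableaux -/

set_option linter.unusedSectionVars false

namespace HeckeClifford

open SuperModule StrictPartition

/-- The squares of the Jucys-Murphy elements have joint eigenvalue `a` on `M`. -/
def IsWeight {F : Type u} [Field F] [NeZero (2 : F)] {n : ℕ} (M : YModule.{u, w} F n)
    (a : Fin n → F) : Prop := ∃ z ∈ jointEigenspace M id a, z ≠ 0

namespace IsWeight

variable {F : Type u} [Field F] [CharZero F] {n : ℕ} {M : YModule.{u, w} F n}
  {a : Fin n → F} {k k' k'' : Fin n}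

theorem eq_zero (ha : IsWeight M a) (hk : (k : ℕ) = 0) : a k = 0 := by
  obtain ⟨z, hz, h0⟩ := ha
  have h : (jucysMurphy k : Y F n) • (jucysMurphy k : Y F n) • z = a k • z := hz k
  rw [jucysMurphy_zero hk, zero_smul, eq_comm, smul_eq_zero] at h
  exact h.resolve_right h0

variable [Module.Finite F M.carrier] (hM : IsCompletelySplittable M)
include hM

theorem ne (ha : IsWeight M a) (hk : (k' : ℕ) = k + 1) : a k ≠ a k' := by
  obtain ⟨z, hz, h0⟩ := ha
  exact fun h => h0 (eq_zero_of_weight_eq hM hk hz h)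

theorem eq_zero_or (ha : IsWeight M a) (hk : (k' : ℕ) = k + 1) (hk' : (k'' : ℕ) = k' + 1)
    (h : a k = a k'') : a k = 0 ∨ a k + 3 * a k' = 0 := by
  obtain ⟨z, hz, h0⟩ := ha
  exact weight_eq_of_eq hM hk hk' h hz h0

theorem swap (ha : IsWeight M a) (hk : (k' : ℕ) = k + 1)
    (h : 1 - 2 * (a k + a k') / (a k - a k') ^ 2 ≠ 0) : IsWeight M (a ∘ Equiv.swap k k') := by
  have hne := ha.ne hM hk
  obtain ⟨z, hz, h0⟩ := ha
  refine ⟨_, intertwiner_smul_mem hM hk hz hne, fun h1 => ?_⟩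
  have h2 := intertwiner_smul_intertwiner_smul hM hk hz hne
  rw [h1, smul_zero, eq_comm, smul_eq_zero] at h2
  exact h2.elim h h0

variable [IsAlgClosed F]

/-- A removable box of content `j` is carried by admissible transpositions to the step just before
the last box, of content `i`, say. The weight then contains the contents j, i, j at consecutive
labels. This contradicts `eq_zero_or`, because `j ≠ 0` and q(j) + 3 q(i) is a positive integer. The
number `d` counts the labels strictly between `p` and `m`. -/
theorem not_isBoxSeq {j : ℕ} (hj : j ≠ 0) {m : ℕ} (hm : m + 1 < n) (d : ℕ) :
    ∀ (a : Fin n → F) (β : ℕ → ℕ × ℕ) (p : ℕ), IsWeight M a → p + d + 1 = m →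
      IsBoxSeq (m + 1) β →
      (∀ k : Fin n, (k : ℕ) < m + 1 → a k = q F (boxContent (β k))) →
      a ⟨m + 1, hm⟩ = q F j → boxContent (β p) = j →
      (∀ k < m, p < k → ¬ β p ≤ β k) → False := by
  induction d with
  | zero =>
    intro a β p ha hp hβ hab hj' hpj _
    have h1 : a ⟨p, by omega⟩ = q F j := by rw [hab _ (by simp only; omega), hpj]
    have h2 := hab ⟨m, by omega⟩ (Nat.lt_succ_self m)
    have := ha.eq_zero_or hM (k := ⟨p, by omega⟩) (k' := ⟨m, by omega⟩) (k'' := ⟨m + 1, hm⟩)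
      (by simp only; omega) rfl (h1.trans hj'.symm)
    rw [h1, h2, q_eq_zero] at this
    refine this.elim hj fun h => ?_
    rw [q, q] at h
    have h3 : j * (j + 1) + 3 * (boxContent (β m) *
        (boxContent (β m) + 1)) = 0 := by exact_mod_cast h
    have h4 : 0 < j * (j + 1) := by positivity
    omega
  | succ d ih =>
    intro a β p ha hp hβ hab hj' hpj hle
    have hle' := hle (p + 1) (by omega) (Nat.lt_succ_self p)
    have hk : ((⟨p + 1, by omega⟩ : Fin n) : ℕ) = (⟨p, by omega⟩ : Fin n) + 1 := rfl
    have hswap (k : Fin n) : ((Equiv.swap (⟨p, by omega⟩ : Fin n) ⟨p + 1, by omega⟩ k : Fin n) : ℕ)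
        = Equiv.swap p (p + 1) k := Fin.val_injective.map_swap _ _ _
    refine ih (a ∘ Equiv.swap ⟨p, by omega⟩ ⟨p + 1, by omega⟩) (β ∘ Equiv.swap p (p + 1)) (p + 1)
      (ha.swap hM hk ?_) (by omega) (hβ.swap (by omega) hle') ?_ ?_ ?_ ?_
    · rw [hab ⟨p, by omega⟩ (by simp only; omega), hab ⟨p + 1, by omega⟩ (by simp only; omega),
        ← omegaScalar_sq]
      refine pow_ne_zero 2 ?_
      have hp1 : p + 1 < m + 1 := by omega
      rw [ne_eq, omegaScalar_eq_zero (hβ.content_ne hp1), ← hβ.le_iff hp1]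
      exact hle'
    · intro k hkm
      rw [Function.comp_apply, Function.comp_apply, hab, hswap]
      rw [hswap, Equiv.swap_apply_def]
      split_ifs <;> omega
    · rw [Function.comp_apply, Equiv.swap_apply_of_ne_of_ne, hj'] <;> rw [ne_eq, Fin.ext_iff] <;>
        simp only <;> omega
    · rw [Function.comp_apply, Equiv.swap_apply_right, hpj]
    · intro k hkm hpk
      rw [Function.comp_apply, Function.comp_apply, Equiv.swap_apply_right,
        Equiv.swap_apply_of_ne_of_ne (by omega) (by omega)]
      exact hle k hkm (by omega)

/-- Induction on the number of labels, for all weights at once. If `Ω ≠ 0` for the last two labels,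
the exchanged weight occurs too; by induction it provides a box that was addable one step earlier,
and this box stays addable. If `Ω = 0`, the new content differs by one from the previous one, and
the box is addable unless a removable box of the same content is present, which `not_isBoxSeq`
excludes. -/
theorem exists_isBoxSeq (m : ℕ) (hm : m ≤ n) : ∀ a : Fin n → F, IsWeight M a →
    ∃ β, IsBoxSeq m β ∧
      ∀ k : Fin n, (k : ℕ) < m → a k = q F (boxContent (β k)) := by
  induction m with
  | zero => exact fun a _ => ⟨fun _ => (0, 0), fun k hk => by omega, fun k hk => by omega⟩
  | succ m ih =>
    intro a ha
    obtain ⟨β, hβ, hab⟩ := ih (by omega) a ha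
    have hsucc : ∀ r, IsAddable (β '' Set.Iio m) r →
        a ⟨m, hm⟩ = q F (boxContent r) →
        ∃ β, IsBoxSeq (m + 1) β ∧
          ∀ k : Fin n, (k : ℕ) < m + 1 → a k = q F (boxContent (β k)) := by
      intro r hr har
      refine ⟨_, hβ.succ hr, fun k hk => ?_⟩
      rcases Nat.lt_succ_iff_lt_or_eq.1 hk with hk | hk
      · rw [Function.update_of_ne hk.ne, hab k hk]
      · rw [hk, Function.update_self, ← har]
        exact congrArg a (Fin.ext hk)
    rcases m with _ | m
    · refine hsucc (0, 0) ⟨le_rfl, ?_, fun b h1 h2 h3 => ?_⟩ ?_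
      · rintro ⟨k, hk, -⟩
        exact absurd hk (by simp)
      · exact absurd (le_antisymm h2 ⟨by simp, by simp⟩) h3
      · rw [ha.eq_zero rfl]
        exact q_zero.symm
    · have hk : ((⟨m + 1, hm⟩ : Fin n) : ℕ) = (⟨m, by omega⟩ : Fin n) + 1 := rfl
      have hm' := hab ⟨m, by omega⟩ (Nat.lt_succ_self m)
      have hne := ha.ne hM hk
      by_cases h : 1 - 2 * (a ⟨m, by omega⟩ + a ⟨m + 1, hm⟩) /
          (a ⟨m, by omega⟩ - a ⟨m + 1, hm⟩) ^ 2 = 0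
      · generalize hb : a ⟨m + 1, hm⟩ = b at *
        simp only at hm'
        generalize hi : boxContent (β m) = i at *
        rw [hm'] at h hne
        rw [sub_eq_zero, eq_div_iff (pow_ne_zero 2 (sub_ne_zero.2 hne)), one_mul, ← sub_eq_zero] at h
        have hj : ∃ j, (j = i + 1 ∨ i = j + 1) ∧ b = q F j := by
          -- The vanishing of `Ω²` is a quadratic equation for `b` with the roots `q(i + 1)` and `(i
          -- - 1) i`. For `i = 0` the second root is `q(0)`, which `hne` rules out; otherwise it is
          -- `q(i - 1)`.
          have h1 : (b - q F (i + 1)) * (b - ((i : F) - 1) * i) = 0 := by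
            rw [← h, q, q]
            push_cast
            ring
          rcases mul_eq_zero.1 h1 with h1 | h1
          · exact ⟨i + 1, Or.inl rfl, sub_eq_zero.1 h1⟩
          · rcases i with _ | j
            · refine absurd ?_ hne
              rw [q_zero, sub_eq_zero.1 h1, Nat.cast_zero, mul_zero]
            · refine ⟨j, Or.inr rfl, ?_⟩
              rw [sub_eq_zero.1 h1, q]
              push_cast
              ring
        obtain ⟨j, hj, rfl⟩ := hj
        rw [← hi] at hj
        rcases hβ.exists_isAddable_or hj with ⟨r, hr, rfl⟩ | ⟨hj0, p, hp, hpj, hle⟩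
        · exact hsucc r hr rfl
        · exact (not_isBoxSeq hM hj0 (by omega) (m - p - 1) a β p ha (by omega) hβ hab hb hpj
            hle).elim
      · obtain ⟨γ, hγ, hag⟩ := ih (by omega) _ (ha.swap hM hk h)
        have hγβ : ∀ l < m, γ l = β l := by
          refine (hγ.mono (Nat.le_succ m)).eq_of_content_eq (hβ.mono (Nat.le_succ m)) fun l hl =>
            q_injective (F := F) ?_
          have h1 := hag ⟨l, by omega⟩ (by simp only; omega)
          have h2 := hab ⟨l, by omega⟩ (by simp only; omega)
          rw [Function.comp_apply, Equiv.swap_apply_of_ne_of_ne (by simp only [ne_eq, Fin.ext_iff]; omega)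
            (by simp only [ne_eq, Fin.ext_iff]; omega)] at h1
          exact h1.symm.trans h2
        have hgm : a ⟨m + 1, hm⟩ = q F (boxContent (γ m)) := by
          rw [← hag ⟨m, by omega⟩ (Nat.lt_succ_self m), Function.comp_apply, Equiv.swap_apply_left]
        refine hsucc (γ m) ?_ hgm
        rw [image_Iio_succ, ← Set.image_congr (fun l hl => hγβ l (Set.mem_Iio.1 hl))]
        refine (hγ m (Nat.lt_succ_self m)).insert_of_ne fun he => hne ?_
        rw [hm', hgm, ← he]

theorem exists_tableau (ha : IsWeight M a) :
    ∃ (lam : StrictPartition n) (T : StandardTableau lam), a = fun k => q F (T.content k) := by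
  obtain ⟨β, hβ, hab⟩ := ha.exists_isBoxSeq hM n le_rfl
  obtain ⟨lam, T, hT⟩ := StandardTableau.exists_of_isBoxSeq hβ
  refine ⟨lam, T, funext fun k => ?_⟩
  rw [T.content_eq, hT, hab k k.2]

end IsWeight

section NotAdmissible

variable {F : Type u} [Field F] [CharZero F] [IsAlgClosed F] {n : ℕ} {M : YModule.{u, w} F n}
  [Module.Finite F M.carrier] (hM : IsCompletelySplittable M) {lam : StrictPartition n}
  {k k' : Fin n} (hk : (k' : ℕ) = k + 1)
include hM hk

/-- That `Ω = 0` only shows the vanishing of the composite of two intertwiners. If the image itself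
were nonzero, its weight would come from a tableau `S` that agrees with `T` before `k`. The boxes of
`k` in `T` and in `S` would then be addable to the same diagram although their contents differ by
one. -/
theorem intertwiner_smul_of_not_admissible (T : StandardTableau lam)
    (h : ¬ Admissible T.content k k') {z : M.carrier}
    (hz : z ∈ jointEigenspace M id (fun k => q F (T.content k))) :
    (intertwiner k k' (q F (T.content k) - q F (T.content k')) : Y F n) • z = 0 := by
  by_contra h0
  have hz' := intertwiner_smul_mem hM hk hz (q_ne (T.content_ne hk))
  obtain ⟨mu, S, hS⟩ := IsWeight.exists_tableau hM ⟨_, hz', h0⟩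
  have hc (j : Fin n) : T.content (Equiv.swap k k' j) = S.content j :=
    q_injective (F := F) (congrFun hS j)
  have hlt : ∀ l < (k : ℕ), T.seq l = S.seq l := by
    refine (T.isBoxSeq_seq.mono k.2.le).eq_of_content_eq (S.isBoxSeq_seq.mono k.2.le) fun l hl => ?_
    have h1 := T.seq_val ⟨l, hl.trans k.2⟩
    have h2 := S.seq_val ⟨l, hl.trans k.2⟩
    simp only at h1 h2
    rw [h1, h2, ← T.content_eq, ← S.content_eq, ← hc, Equiv.swap_apply_of_ne_of_ne] <;>
      simp only [ne_eq, Fin.ext_iff] <;> omega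
  have hT := T.isBoxSeq_seq k k.2
  have hS := S.isBoxSeq_seq k k.2
  rw [← Set.image_congr (fun l hl => hlt l (Set.mem_Iio.1 hl))] at hS
  have h1 := hT.content_ne_succ hS
  have h2 := hS.content_ne_succ hT
  rw [T.seq_val, S.seq_val, ← T.content_eq, ← S.content_eq, ← hc, Equiv.swap_apply_left] at h1 h2
  exact h ⟨h1, h2⟩

end NotAdmissible

end HeckeClifford

/-! ### Leading terms of permutations on weight vectors -/

set_option linter.unusedSectionVars false

namespace HeckeClifford

open SuperModule

section Finite

variable {F : Type u} [Field F] [NeZero (2 : F)] {n : ℕ} {M : YModule.{u, w} F n}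

/-- A nonzero vector and its image under parity generate a graded submodule, which is a quotient of
two copies of the finite dimensional algebra. -/
theorem finite_of_isIrreducible (hM : M.IsIrreducible) : Module.Finite F M.carrier := by
  obtain ⟨-, -, hne, hirr⟩ := hM
  obtain ⟨z, -, hz⟩ := (Submodule.ne_bot_iff _).1 hne
  let g : Y F n →ₗ[F] M.carrier := (LinearMap.toSpanSingleton (Y F n) M.carrier z).restrictScalars F
  let g' : Y F n →ₗ[F] M.carrier :=
    (LinearMap.toSpanSingleton (Y F n) M.carrier (M.parityOp z)).restrictScalars F
  have hN : LinearMap.range g ⊔ LinearMap.range g' = ⊤ := by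
    refine (hirr _ le_top ?_ ?_).resolve_left fun h => hz ?_
    · rw [isGraded_iff]
      intro y hy
      obtain ⟨_, ⟨a, rfl⟩, _, ⟨b, rfl⟩, rfl⟩ := Submodule.mem_sup.1 hy
      rw [map_add, add_comm]
      refine Submodule.add_mem_sup ⟨parity F n b, ?_⟩ ⟨parity F n a, ?_⟩
      · exact ((parityOp_smul M b _).trans (by rw [parityOp_parityOp]; rfl)).symm
      · exact (parityOp_smul M a z).symm
    · rintro x - y hy
      obtain ⟨_, ⟨a, rfl⟩, _, ⟨b, rfl⟩, rfl⟩ := Submodule.mem_sup.1 hy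
      rw [smul_add]
      exact Submodule.add_mem_sup ⟨x * a, mul_smul x a z⟩ ⟨x * b, mul_smul x b _⟩
    · have h1 : z ∈ LinearMap.range g ⊔ LinearMap.range g' :=
        Submodule.mem_sup_left ⟨1, one_smul _ z⟩
      rw [h] at h1
      exact (Submodule.mem_bot F).1 h1
  have : Module.Finite F (⊤ : Submodule F M.carrier) := by
    rw [← hN]
    infer_instance
  exact Module.finite_def.2 (Module.Finite.iff_fg.1 this)

/-- The commuting operators `L_k²` have a common generalized eigenvector over an algebraically
closed field, and semisimplicity makes it an eigenvector. -/
theorem exists_isWeight {F : Type u} [Field F] [IsAlgClosed F] [CharZero F] {n : ℕ}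
    {M : YModule.{u, w} F n} [Module.Finite F M.carrier] [Nontrivial M.carrier]
    (hM : IsCompletelySplittable M) : ∃ a, IsWeight M a := by
  let f : Fin n → Module.End F M.carrier := fun k => M.op (jucysMurphy k) ^ 2
  have hf (k : Fin n) : (f k).IsSemisimple := (hM k).pow 2
  have hcomm : Pairwise fun i j => Commute (f i) (f j) := fun i j _ =>
    ((jucysMurphy_commute i j).map (Algebra.lsmul F F M.carrier : Y F n →ₐ[F] _)).pow_pow 2 2
  have h := Module.End.iSup_iInf_maxGenEigenspace_eq_top_of_iSup_maxGenEigenspace_eq_top_of_commute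
    f hcomm fun k => Module.End.iSup_maxGenEigenspace_eq_top (f k)
  obtain ⟨a, ha⟩ : ∃ a : Fin n → F, (⨅ k, (f k).maxGenEigenspace (a k)) ≠ ⊥ := by
    by_contra! hcon
    rw [iSup_congr hcon, iSup_bot] at h
    exact bot_ne_top h
  obtain ⟨z, hz, h0⟩ := (Submodule.ne_bot_iff _).1 ha
  refine ⟨a, z, fun k => ?_, h0⟩
  have h1 := (Submodule.mem_iInf _).1 hz k
  rw [(hf k).isFinitelySemisimple.maxGenEigenspace_eq_eigenspace] at h1
  exact Module.End.mem_eigenspace_iff.1 h1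

end Finite

section Leading

variable {F : Type u} [Field F] [CharZero F] {n : ℕ} {lam : StrictPartition n}

/-- The joint eigenspace of the squares of the Jucys-Murphy elements that belongs to a standard
tableau. -/
noncomputable abbrev tableauSpace (M : YModule.{u, w} F n) (T : StandardTableau lam) : Submodule F M.carrier :=
  jointEigenspace M id fun k => q F (T.content k)

/-- The intertwiner on the weight space of `T`. -/
noncomputable def tableauIntertwiner (F : Type u) [Field F] (T : StandardTableau lam)
    (k k' : Fin n) : Y F n :=
  intertwiner k k' (q F (T.content k) - q F (T.content k'))

theorem transposition_smul_eq {V : Type w} [AddCommGroup V] [Module F V] [Module (Y F n) V]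
    [IsScalarTower F (Y F n) V] (T : StandardTableau lam) (k k' : Fin n) (z : V) :
    (transposition k k' : Y F n) • z = tableauIntertwiner F T k k' • z -
      (q F (T.content k) - q F (T.content k'))⁻¹ • (xiNum k k' : Y F n) • z := by
  rw [tableauIntertwiner, intertwiner, add_smul, smul_assoc, add_sub_cancel_right]

variable {M : YModule.{u, w} F n} {T : StandardTableau lam}

theorem jucysMurphy_pow_smul {z : M.carrier} (hz : z ∈ tableauSpace M T) (k : Fin n) :
    (jucysMurphy k ^ 2 : Y F n) • z = q F (T.content k) • z := by
  rw [sq, mul_smul]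
  exact hz k

theorem weightIdempotent_smul_tableauSpace {z : M.carrier} (hz : z ∈ tableauSpace M T) :
    weightIdempotent F T • z = z :=
  weightIdempotent_smul_self (jucysMurphy_pow_smul hz)

theorem weightIdempotent_smul_tableauSpace_of_ne {S : StandardTableau lam} (hTS : T ≠ S)
    {z : M.carrier} (hz : z ∈ tableauSpace M T) : weightIdempotent F S • z = 0 :=
  weightIdempotent_smul_of_ne hTS (jucysMurphy_pow_smul hz)

variable [IsAlgClosed F] [Module.Finite F M.carrier] (hM : IsCompletelySplittable M)
  {k k' : Fin n} (hk : (k' : ℕ) = k + 1)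
include hM

include hk in
theorem tableauIntertwiner_smul_mem {z : M.carrier} (hz : z ∈ tableauSpace M T) :
    tableauIntertwiner F T k k' • z ∈ tableauSpace M (T.move hk) := by
  by_cases h : Admissible T.content k k'
  · have h1 := intertwiner_smul_mem hM hk hz (q_ne (T.content_ne hk))
    intro j
    simp only [T.content_move hk h]
    exact h1 j
  · rw [tableauIntertwiner, intertwiner_smul_of_not_admissible hM hk T h hz]
    exact zero_mem _

include hk in
theorem tableauIntertwiner_smul_tableauIntertwiner_smul {z : M.carrier}
    (hz : z ∈ tableauSpace M T) :
    tableauIntertwiner F (T.move hk) k k' • tableauIntertwiner F T k k' • z =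
      omegaScalar F (T.content k) (T.content k') ^ 2 • z := by
  by_cases h : Admissible T.content k k'
  · rw [omegaScalar_sq, tableauIntertwiner, T.content_move hk h, T.content_move hk h,
      Equiv.swap_apply_left, Equiv.swap_apply_right]
    exact intertwiner_smul_intertwiner_smul hM hk hz (q_ne (T.content_ne hk))
  · rw [SeminormalModel.omegaScalar_of_not hk T h, tableauIntertwiner, tableauIntertwiner,
      intertwiner_smul_of_not_admissible hM hk T h hz, smul_zero, sq, zero_mul, zero_smul]

variable (M T)

/-- The sum of the weight spaces of the tableaux of length less than `m` with respect to `T`. -/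
noncomputable def lowerSpace (m : ℕ) : Submodule F M.carrier :=
  ⨆ S : {S : StandardTableau lam // invCount (T.transition S) < m}, tableauSpace M S.1

variable {M T}
omit hM

theorem mem_lowerSpace {m : ℕ} {S : StandardTableau lam} (h : invCount (T.transition S) < m)
    {z : M.carrier} (hz : z ∈ tableauSpace M S) : z ∈ lowerSpace M T m :=
  (le_iSup (fun S : {S : StandardTableau lam // invCount (T.transition S) < m} =>
    tableauSpace M S.1) ⟨S, h⟩) hz

theorem weightIdempotent_smul_lowerSpace {m : ℕ} {S : StandardTableau lam}
    (h : m ≤ invCount (T.transition S)) {z : M.carrier} (hz : z ∈ lowerSpace M T m) :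
    weightIdempotent F S • z = 0 := by
  refine Submodule.iSup_induction _ (motive := fun z => weightIdempotent F S • z = 0) hz
    (fun S' y hy => ?_) (smul_zero _) fun y y' h1 h2 => by rw [smul_add, h1, h2, add_zero]
  refine weightIdempotent_smul_tableauSpace_of_ne ?_ hy
  rintro rfl
  exact absurd S'.2 (by omega)

include hM hk in
theorem transposition_smul_lowerSpace {m : ℕ} {z : M.carrier} (hz : z ∈ lowerSpace M T m) :
    (transposition k k' : Y F n) • z ∈ lowerSpace M T (m + 1) := by
  refine Submodule.iSup_induction _
    (motive := fun z => (transposition k k' : Y F n) • z ∈ lowerSpace M T (m + 1)) hz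
    (fun S y hy => ?_) (by rw [smul_zero]; exact zero_mem _) fun y y' h1 h2 => by
      rw [smul_add]; exact add_mem h1 h2
  have hS := S.2
  rw [transposition_smul_eq S.1]
  refine sub_mem (mem_lowerSpace ?_ (tableauIntertwiner_smul_mem hM hk hy))
    (Submodule.smul_mem _ _ (mem_lowerSpace (by omega) (xiNum_smul_mem hy)))
  by_cases h : Admissible S.1.content k k'
  · have := T.invCount_move hk S.1 h
    omega
  · rw [S.1.move_of_not hk h]
    omega

/-- The leading term at `S` of the permutation that carries `T` to `S`. -/
noncomputable def leading (F : Type u) [Field F] (T S : StandardTableau lam) : Y F n :=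
  weightIdempotent F S * perm (T.transition S)

theorem leading_smul_self {z : M.carrier} (hz : z ∈ tableauSpace M T) :
    leading F T T • z = z := by
  rw [leading, T.transition_self, perm_one, mul_one, weightIdempotent_smul_tableauSpace hz]

theorem leading_smul_eq {S : StandardTableau lam} {y z : M.carrier} (hy : y ∈ tableauSpace M S)
    (h : (perm (T.transition S) : Y F n) • z - y ∈
      lowerSpace M T (invCount (T.transition S))) : leading F T S • z = y := by
  have h1 := weightIdempotent_smul_lowerSpace le_rfl h
  rw [smul_sub, weightIdempotent_smul_tableauSpace hy, sub_eq_zero] at h1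
  rw [leading, mul_smul, h1]

include hM in
-- Each transposition is an intertwiner plus `Ξ_k`, and `Ξ_k` preserves weight spaces. So a reduced
-- word applied to `z` is the product of the intertwiners modulo weight spaces of shorter tableaux.
-- As the left side depends on the permutation only, so does this product, and no braid relations
-- between intertwiners have to be checked.
theorem exists_sub_mem_lowerSpace {z : M.carrier} (hz : z ∈ tableauSpace M T)
    (S : StandardTableau lam) : ∃ y ∈ tableauSpace M S,
      (perm (T.transition S) : Y F n) • z - y ∈ lowerSpace M T (invCount (T.transition S)) ∧
      ∀ (k k' : Fin n) (hk : (k' : ℕ) = k + 1), Admissible S.content k k' →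
        invCount (T.transition (S.move hk)) = invCount (T.transition S) + 1 →
          (perm (T.transition (S.move hk)) : Y F n) • z - tableauIntertwiner F S k k' • y ∈
            lowerSpace M T (invCount (T.transition (S.move hk))) := by
  have key : ∀ S : StandardTableau lam, ∀ y ∈ tableauSpace M S,
      (perm (T.transition S) : Y F n) • z - y ∈ lowerSpace M T (invCount (T.transition S)) →
      ∀ (k k' : Fin n) (hk : (k' : ℕ) = k + 1), Admissible S.content k k' →
        invCount (T.transition (S.move hk)) = invCount (T.transition S) + 1 →
          (perm (T.transition (S.move hk)) : Y F n) • z - tableauIntertwiner F S k k' • y ∈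
            lowerSpace M T (invCount (T.transition (S.move hk))) := by
    intro S y hy h k k' hk hadm hlen
    have h1 := transposition_smul_lowerSpace hM hk h
    have h2 := Submodule.smul_mem _ (q F (S.content k) - q F (S.content k'))⁻¹
      (mem_lowerSpace (Nat.lt_succ_self (invCount (T.transition S)))
        (xiNum_smul_mem (k := k) (k' := k') hy))
    have h3 := sub_mem h1 h2
    rw [smul_sub, transposition_smul_eq S k k' y, ← mul_smul, transposition, perm_mul,
      ← T.transition_move hk S hadm, sub_sub, sub_add_cancel] at h3
    rw [hlen]
    exact h3
  have h : ∃ y ∈ tableauSpace M S,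
      (perm (T.transition S) : Y F n) • z - y ∈ lowerSpace M T (invCount (T.transition S)) := by
    refine T.induction_move (fun S => ∃ y ∈ tableauSpace M S, (perm (T.transition S) : Y F n) • z -
      y ∈ lowerSpace M T (invCount (T.transition S))) ⟨z, hz, ?_⟩ ?_ S
    · rw [T.transition_self, perm_one, one_smul, sub_self]
      exact zero_mem _
    · rintro S k k' hk hadm hlen ⟨y, hy, h⟩
      exact ⟨_, tableauIntertwiner_smul_mem hM hk hy, key S y hy h k k' hk hadm hlen⟩
  obtain ⟨y, hy, h⟩ := h
  exact ⟨y, hy, h, key S y hy h⟩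

include hM in
theorem leading_smul_mem {z : M.carrier} (hz : z ∈ tableauSpace M T) (S : StandardTableau lam) :
    leading F T S • z ∈ tableauSpace M S := by
  obtain ⟨y, hy, h, -⟩ := exists_sub_mem_lowerSpace hM hz S
  rwa [leading_smul_eq hy h]

include hM in
theorem leading_move_smul {z : M.carrier} (hz : z ∈ tableauSpace M T) {S : StandardTableau lam}
    (hadm : Admissible S.content k k')
    (hlen : invCount (T.transition (S.move hk)) = invCount (T.transition S) + 1) :
    leading F T (S.move hk) • z = tableauIntertwiner F S k k' • leading F T S • z := by
  obtain ⟨y, hy, h, h'⟩ := exists_sub_mem_lowerSpace hM hz S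
  rw [leading_smul_eq hy h]
  exact leading_smul_eq (tableauIntertwiner_smul_mem hM hk hy) (h' k k' hk hadm hlen)

end Leading

end HeckeClifford

/-! ### Identification of irreducible modules with the model -/

set_option linter.unusedSectionVars false

namespace SeminormalModel

open HeckeClifford SuperModule

variable {F : Type u} [Field F] [IsAlgClosed F] [CharZero F] {n : ℕ} {lam : StrictPartition n}
  (R : WeightRep.{u, 0, w'} F lam.boxes (boxWeight F lam))

/-- The inclusion of the summand of `T` into the module. -/
noncomputable def incl (T : StandardTableau lam) : R.V →ₗ[F] (model R).carrier := single R T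

variable {R} {T : StandardTableau lam} (v : R.V)

theorem incl_mem : incl R T v ∈ tableauSpace (model R) T := fun j => by
  have h := jucysMurphy_sq_smul_single R T j v
  rw [sq, mul_smul] at h
  exact h

theorem c_smul_incl (j : Fin n) :
    (c j : Y F n) • incl R T v = incl R T (R.C (T.box j) v) :=
  (c_smul R j _).trans (opC_single T j v)

theorem jucysMurphy_smul_incl (j : Fin n) :
    (jucysMurphy j : Y F n) • incl R T v = incl R T (R.X (T.box j) v) :=
  (jucysMurphy_smul R j _).trans (opX_single T j v)

theorem parityOp_incl : (model R).parityOp (incl R T v) = incl R T (R.P v) :=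
  (parityOp_model R _).trans (opP_single T v)

theorem incl_injective : Function.Injective (incl R T) := fun v v' h => by
  rw [← single_same R T v, ← single_same R T v']
  exact congrFun h T

theorem linearMap_eq_of_incl {V : Type v} [AddCommGroup V] [Module F V]
    {f g : (model R).carrier →ₗ[F] V} (h : ∀ T v, f (incl R T v) = g (incl R T v)) : f = g := by
  let N : Submodule F (Space R) := LinearMap.eqLocus f g
  exact LinearMap.ext fun z => mem_of_single_mem (N := N) h z

theorem xiNum_smul_incl (k k' : Fin n) :
    (xiNum k k' : Y F n) • incl R T v = incl R T (R.xiNum (T.box k) (T.box k') v) := by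
  simp only [xiNum, add_smul, mul_smul, sub_smul, jucysMurphy_smul_incl, c_smul_incl, ← map_sub,
    ← map_add]
  rfl

theorem transposition_smul_incl {k k' : Fin n} (hk : (k' : ℕ) = k + 1) :
    (transposition k k' : Y F n) • incl R T v = incl R T (R.xi (T.box k) (T.box k') v) +
      omegaScalar F (T.content k) (T.content k') • incl R (T.move hk) v :=
  (transposition_smul R hk _).trans (opS_single T hk v)

theorem tableauIntertwiner_smul_incl {k k' : Fin n} (hk : (k' : ℕ) = k + 1) :
    tableauIntertwiner F T k k' • incl R T v =
      omegaScalar F (T.content k) (T.content k') • incl R (T.move hk) v := by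
  have h := transposition_smul_eq (F := F) T k k' (incl R T v)
  rw [transposition_smul_incl v hk, xiNum_smul_incl, eq_sub_iff_add_eq] at h
  rw [← h, add_right_comm, add_eq_right, ← map_smul, ← map_add]
  refine (congrArg (incl R T) ?_).trans (map_zero _)
  exact neg_add_cancel ((q F (T.content k) - q F (T.content k'))⁻¹ •
    R.xiNum (T.box k) (T.box k') v)

variable (R T) [Module.Finite F R.V] [Nontrivial R.V]

include R in
-- In the model itself the leading term at `S` is multiplication by a scalar, the product of the `Ω`
-- along any path of increasing length from `T` to `S`. Its independence of the path comes for free,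
-- since `leading` is defined through the permutation.
theorem exists_leadingScalar : ∃ ω : StandardTableau lam → F, (∀ S, ω S ≠ 0) ∧ ω T = 1 ∧
    ∀ (S : StandardTableau lam) (k k' : Fin n) (hk : (k' : ℕ) = k + 1),
      Admissible S.content k k' →
      invCount (T.transition (S.move hk)) = invCount (T.transition S) + 1 →
      ω (S.move hk) = omegaScalar F (S.content k) (S.content k') * ω S := by
  have hfin := finite_model R
  have hM := isCompletelySplittable_model R
  have h : ∀ S : StandardTableau lam, ∃ ω : F, ω ≠ 0 ∧
      ∀ v, leading F T S • incl R T v = ω • incl R S v := by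
    refine T.induction_move _ ⟨1, one_ne_zero, fun v => ?_⟩ ?_
    · rw [leading_smul_self (incl_mem v), one_smul]
    · rintro S k k' hk hadm hlen ⟨ω, h0, hω⟩
      refine ⟨ω * omegaScalar F (S.content k) (S.content k'),
        mul_ne_zero h0 (omegaScalar_ne_zero hk S hadm), fun v => ?_⟩
      rw [leading_move_smul hM hk (incl_mem v) hadm hlen, hω, smul_comm,
        tableauIntertwiner_smul_incl v hk, smul_smul]
  choose ω h0 hω using h
  obtain ⟨v, hv⟩ := exists_ne (0 : R.V)
  have hinj : ∀ (S : StandardTableau lam) (r s : F), r • incl R S v = s • incl R S v → r = s :=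
    fun S r s h => by
      rw [← map_smul, ← map_smul] at h
      exact smul_left_injective F hv (incl_injective h)
  refine ⟨ω, h0, hinj T _ _ ?_, fun S k k' hk hadm hlen => hinj (S.move hk) _ _ ?_⟩
  · rw [← hω, leading_smul_self (incl_mem v), one_smul]
  · rw [← hω, leading_move_smul hM hk (incl_mem v) hadm hlen, hω, smul_comm,
      tableauIntertwiner_smul_incl v hk, smul_smul, mul_comm]

end SeminormalModel

namespace HeckeClifford

open SuperModule SeminormalModel

variable {F : Type u} [Field F] [IsAlgClosed F] [CharZero F] {n : ℕ} {lam : StrictPartition n}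
  {R : WeightRep.{u, 0, w'} F lam.boxes (boxWeight F lam)} {M : YModule.{u, w} F n}

/-- The maps `θ S` add up to a map from the model to `M` that respects the generators. Its kernel
and range are graded submodules, so it is bijective by irreducibility; the sign `ε` records whether
it preserves or reverses parity. -/
theorem isomorphic_model_of_family (hM : M.IsIrreducible) (hR : (model R).IsIrreducible)
    {θ : StandardTableau lam → R.V →ₗ[F] M.carrier} {ε : F} (hε : ε = 1 ∨ ε = -1)
    (h0 : ∃ T, θ T ≠ 0) (hP : ∀ S v, M.parityOp (θ S v) = ε • θ S (R.P v))
    (hC : ∀ S j v, θ S (R.C (S.box j) v) = (c j : Y F n) • θ S v)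
    (hS : ∀ (S : StandardTableau lam) (k k' : Fin n) (hk : (k' : ℕ) = k + 1) (v),
      (transposition k k' : Y F n) • θ S v = θ S (R.xi (S.box k) (S.box k') v) +
        omegaScalar F (S.content k) (S.content k') • θ (S.move hk) v) :
    M.Isomorphic (model R) := by
  classical
  cases nonempty_fintype (StandardTableau lam)
  let Φ : (model R).carrier →ₗ[F] M.carrier := LinearMap.lsum F (fun _ => R.V) F θ
  have hΦ (S : StandardTableau lam) (v : R.V) : Φ (incl R S v) = θ S v := by
    refine (LinearMap.lsum_piSingle F (fun _ => R.V) F θ S v)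
  have hmul : ∀ (a : Y F n) z, Φ (a • z) = a • Φ z := by
    have hperm : ∀ s : Equiv.Perm (Fin n), ∀ z, Φ ((perm s : Y F n) • z) = (perm s : Y F n) • Φ z := by
      intro s
      induction s using perm_induction with
      | one => intro z; rw [perm_one, one_smul, one_smul]
      | swap k k' hk =>
        have h : Φ ∘ₗ (model R).op (transposition k k') = M.op (transposition k k') ∘ₗ Φ :=
          linearMap_eq_of_incl fun S v => by
            change Φ ((transposition k k' : Y F n) • incl R S v) =
              (transposition k k' : Y F n) • Φ (incl R S v)
            rw [transposition_smul_incl v hk, map_add, map_smul, hΦ, hΦ, hΦ, hS]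
        exact LinearMap.congr_fun h
      | mul s t hs ht => intro z; rw [← perm_mul, mul_smul, mul_smul, hs, ht]
    intro a
    induction a using induction_on with
    | hr r => intro z; rw [algebraMap_smul, algebraMap_smul, map_smul]
    | hc j =>
      have h : Φ ∘ₗ (model R).op (c j) = M.op (c j) ∘ₗ Φ := linearMap_eq_of_incl fun S v => by
        change Φ ((c j : Y F n) • incl R S v) = (c j : Y F n) • Φ (incl R S v)
        rw [c_smul_incl, hΦ, hΦ, hC]
      exact LinearMap.congr_fun h
    | hs s => exact hperm s
    | hadd a b ha hb => intro z; rw [add_smul, add_smul, map_add, ha, hb]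
    | hmul a b ha hb => intro z; rw [mul_smul, mul_smul, ha, hb]
  have hpar : ∀ z, M.parityOp (Φ z) = ε • Φ ((model R).parityOp z) := by
    have h : M.parityOp ∘ₗ Φ = ε • (Φ ∘ₗ (model R).parityOp) := linearMap_eq_of_incl fun S v => by
      change M.parityOp (Φ (incl R S v)) = ε • Φ ((model R).parityOp (incl R S v))
      rw [parityOp_incl, hΦ, hΦ, hP]
    exact LinearMap.congr_fun h
  have hεε : ε * ε = 1 := by rcases hε with rfl | rfl <;> norm_num
  have hpar' : ∀ z, Φ ((model R).parityOp z) = ε • M.parityOp (Φ z) := fun z => by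
    rw [hpar, smul_smul, hεε, one_smul]
  have hΦ0 : Φ ≠ 0 := by
    obtain ⟨T, hT⟩ := h0
    rintro h
    refine hT (LinearMap.ext fun v => ?_)
    rw [← hΦ, h]
    rfl
  have hker : LinearMap.ker Φ = ⊥ := by
    refine (hR.2.2.2 _ le_top ?_ ?_).resolve_right fun h => hΦ0 (LinearMap.ker_eq_top.1 h)
    · rw [isGraded_iff]
      intro z hz
      rw [LinearMap.mem_ker] at hz ⊢
      rw [hpar', hz, map_zero, smul_zero]
    · intro a _ z hz
      rw [LinearMap.mem_ker] at hz ⊢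
      rw [hmul, hz, smul_zero]
  have hrange : LinearMap.range Φ = ⊤ := by
    refine (hM.2.2.2 _ le_top ?_ ?_).resolve_left fun h => hΦ0 (LinearMap.range_eq_bot.1 h)
    · rw [isGraded_iff]
      rintro _ ⟨z, rfl⟩
      exact ⟨ε • (model R).parityOp z, by rw [map_smul, ← hpar]⟩
    · rintro a - _ ⟨z, rfl⟩
      exact ⟨a • z, hmul a z⟩
  let e := LinearEquiv.ofBijective Φ ⟨LinearMap.ker_eq_bot.1 hker, LinearMap.range_eq_top.1 hrange⟩
  have he : ∀ z, Φ (e.symm z) = z := e.apply_symm_apply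
  have hinj : Function.Injective Φ := LinearMap.ker_eq_bot.1 hker
  refine isomorphic_of_bijective (f := e.symm.toLinearMap) hε e.symm.bijective (fun z => hinj ?_)
    fun a z => hinj ?_
  · rw [LinearEquiv.coe_coe, hpar', he, map_smul, he]
  · rw [LinearEquiv.coe_coe, hmul, he, he]

/-- The universal property of `R` gives a nonzero map into the weight space of `T`. Leading terms,
divided by the scalars that they have in the model, transport it to the other weight spaces in such
a way that every intertwiner acts by `Ω`. -/
theorem exists_family {odd : Prop} (hR : WeightRep.IsUniversal.{u, 0, w', w} R odd)
    [Module.Finite F R.V] [Module.Finite F M.carrier] (hM : IsCompletelySplittable M)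
    (T : StandardTableau lam) (hT : IsWeight M fun k => q F (T.content k)) :
    ∃ θ : StandardTableau lam → R.V →ₗ[F] M.carrier, ∃ ε : F, (ε = 1 ∨ ε = -1) ∧ θ T ≠ 0 ∧
      (∀ S v, M.parityOp (θ S v) = ε • θ S (R.P v)) ∧
      (∀ S j v, θ S (R.C (S.box j) v) = (c j : Y F n) • θ S v) ∧
      ∀ (S : StandardTableau lam) (k k' : Fin n) (_ : (k' : ℕ) = k + 1) (v),
        (transposition k k' : Y F n) • θ S v = θ S (R.xi (S.box k) (S.box k') v) +
          omegaScalar F (S.content k) (S.content k') • θ (S.move ‹_›) v := by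
  have hnt := hR.nontrivial
  obtain ⟨ω, hω0, hωT, hω⟩ := exists_leadingScalar R T
  obtain ⟨z, hz, hz0⟩ := hT
  -- The weight space of `T` is indexed by boxes instead of labels, so that it becomes comparable
  -- with `R`.
  let U := weightRep hM T.box.symm (boxWeight F lam)
  have hmem : ∀ z, z ∈ jointEigenspace M T.box.symm (boxWeight F lam) ↔ z ∈ tableauSpace M T := by
    intro z
    constructor
    · intro h k
      have := h (T.box k)
      rwa [Equiv.symm_apply_apply] at this
    · intro h b
      have := h (T.box.symm b)
      simp only [StandardTableau.content_eq, Equiv.apply_symm_apply] at this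
      exact this
  obtain ⟨u, hu⟩ := exists_weightRepIncl hM ((hmem z).2 hz)
  have hU : Nontrivial U.V := ⟨u, 0, fun h => hz0 (by rw [← hu, h, map_zero])⟩
  obtain ⟨f, hf0, hf, ε, hε, hfP⟩ := hR.exists_hom U hU
  let β : R.V →ₗ[F] M.carrier := weightRepIncl hM _ _ ∘ₗ f
  have hβ : ∀ v, β v ∈ tableauSpace M T := fun v => (hmem _).1 (weightRepIncl_mem hM (f v))
  have hβ0 : β ≠ 0 := fun h => hf0 (LinearMap.ext fun v =>
    weightRepIncl_injective hM ((LinearMap.congr_fun h v).trans (map_zero _).symm))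
  have hβC : ∀ j v, β (R.C (T.box j) v) = (c j : Y F n) • β v := fun j v => by
    refine (congrArg (weightRepIncl hM _ _) (hf.C (T.box j) v)).trans ?_
    rw [weightRepIncl_C, Equiv.symm_apply_apply]
    rfl
  have hβX : ∀ j v, β (R.X (T.box j) v) = (jucysMurphy j : Y F n) • β v := fun j v => by
    refine (congrArg (weightRepIncl hM _ _) (hf.X (T.box j) v)).trans ?_
    rw [weightRepIncl_X, Equiv.symm_apply_apply]
    rfl
  have hβP : ∀ v, M.parityOp (β v) = ε • β (R.P v) := fun v => by
    refine (congrArg (weightRepIncl hM _ _) (hfP v)).trans ?_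
    rw [map_smul]
    rfl
  let θ : StandardTableau lam → R.V →ₗ[F] M.carrier := fun S =>
    (ω S)⁻¹ • (M.op (leading F T S) ∘ₗ β)
  have hθ (S v) : θ S v = (ω S)⁻¹ • leading F T S • β v := rfl
  have hθT (v) : θ T v = β v := by rw [hθ, hωT, inv_one, one_smul, leading_smul_self (hβ v)]
  have hθmem (S v) : θ S v ∈ tableauSpace M S :=
    Submodule.smul_mem _ _ (leading_smul_mem hM (hβ v) S)
  have hup : ∀ (S : StandardTableau lam) (k k' : Fin n) (hk : (k' : ℕ) = k + 1),
      Admissible S.content k k' →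
      invCount (T.transition (S.move hk)) = invCount (T.transition S) + 1 → ∀ v,
      tableauIntertwiner F S k k' • θ S v =
        omegaScalar F (S.content k) (S.content k') • θ (S.move hk) v := by
    intro S k k' hk hadm hlen v
    have hΩ := omegaScalar_ne_zero (F := F) hk S hadm
    rw [hθ, hθ, leading_move_smul hM hk (hβ v) hadm hlen, smul_comm _ (_ : F),
      hω S k k' hk hadm hlen, mul_inv, mul_smul (omegaScalar F _ _)⁻¹, smul_inv_smul₀ hΩ]
  have hφ : ∀ (S : StandardTableau lam) (k k' : Fin n) (hk : (k' : ℕ) = k + 1) (v),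
      tableauIntertwiner F S k k' • θ S v =
        omegaScalar F (S.content k) (S.content k') • θ (S.move hk) v := by
    intro S k k' hk v
    by_cases hadm : Admissible S.content k k'
    · rcases T.invCount_move hk S hadm with hlen | hlen
      · exact hup S k k' hk hadm hlen v
      -- For a step that decreases the length, the formula follows from the increasing step, because
      -- the two intertwiners compose to `Ω²`.
      · have hΩ := omegaScalar_ne_zero (F := F) hk S hadm
        have h1 := hup (S.move hk) k k' hk (S.admissible_move hk hadm) (by rw [S.move_move, hlen]) v
        have h2 := tableauIntertwiner_smul_tableauIntertwiner_smul hM hk (hθmem (S.move hk) v)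
        rw [h1, omegaScalar_move, smul_comm _ (_ : F), S.move_move, sq, mul_smul] at h2
        exact smul_right_injective _ hΩ h2
    · rw [omegaScalar_of_not hk S hadm, zero_smul]
      exact intertwiner_smul_of_not_admissible hM hk S hadm (hθmem S v)
  -- Compatibility with parity and with the operators of the boxes is passed on by the intertwiner.
  -- It exchanges the labels `k` and `k'` just as `move` exchanges their boxes.
  have hprop : ∀ S : StandardTableau lam,
      (∀ v, M.parityOp (θ S v) = ε • θ S (R.P v)) ∧
      (∀ j v, θ S (R.C (S.box j) v) = (c j : Y F n) • θ S v) ∧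
      ∀ j v, θ S (R.X (S.box j) v) = (jucysMurphy j : Y F n) • θ S v := by
    refine T.induction_move _ ⟨fun v => ?_, fun j v => ?_, fun j v => ?_⟩ ?_
    · rw [hθT, hθT, hβP]
    · rw [hθT, hθT, hβC]
    · rw [hθT, hθT, hβX]
    · rintro S k k' hk hadm - ⟨ihP, ihC, ihX⟩
      have hΩ := omegaScalar_ne_zero (F := F) hk S hadm
      refine ⟨fun v => smul_right_injective _ hΩ ?_, fun j v => smul_right_injective _ hΩ ?_,
        fun j v => smul_right_injective _ hΩ ?_⟩
      · simp only
        rw [← map_smul, ← hφ, smul_comm _ ε, ← hφ]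
        refine (parityOp_intertwiner_smul hM hk (hθmem S v)).trans ?_
        rw [ihP, smul_comm _ ε]
        rfl
      · simp only
        rw [← hφ, smul_comm _ (c j : Y F n), ← hφ, S.box_move hk hadm, ihC]
        refine (intertwiner_smul_c hM hk (hθmem S v) _).trans ?_
        rw [Equiv.swap_apply_self]
        rfl
      · simp only
        rw [← hφ, smul_comm _ (jucysMurphy j : Y F n), ← hφ, S.box_move hk hadm, ihX]
        refine (intertwiner_smul_jucysMurphy hM hk (hθmem S v) (q_ne (S.content_ne hk)) _).trans ?_
        rw [Equiv.swap_apply_self]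
        rfl
  refine ⟨θ, ε, hε, ?_, fun S => (hprop S).1, fun S => (hprop S).2.1, fun S k k' hk v => ?_⟩
  · exact fun h => hβ0 (LinearMap.ext fun v => by rw [← hθT, h])
  · have hxi : θ S (R.xi (S.box k) (S.box k') v) =
        -((q F (S.content k) - q F (S.content k'))⁻¹ • (xiNum k k' : Y F n) • θ S v) := by
      have h1 : θ S (R.xiNum (S.box k) (S.box k') v) = (xiNum k k' : Y F n) • θ S v := by
        simp only [xiNum, add_smul, mul_smul, sub_smul, ← (hprop S).2.1, ← (hprop S).2.2, ← map_sub,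
          ← map_add]
        rfl
      rw [← h1, ← map_smul, ← map_neg]
      rfl
    rw [transposition_smul_eq S, hφ S k k' hk, hxi]
    abel

/-- A completely splittable irreducible module is isomorphic to a seminormal one. -/
theorem isomorphic_model {odd : Prop} (hR : WeightRep.IsUniversal.{u, 0, w', w} R odd)
    [Module.Finite F R.V] (hM : M.IsIrreducible) (hM' : IsCompletelySplittable M)
    (T : StandardTableau lam) (hT : IsWeight M fun k => q F (T.content k)) :
    M.Isomorphic (model R) := by
  have hfin := finite_of_isIrreducible hM
  obtain ⟨θ, ε, hε, h0, hP, hC, hS⟩ := exists_family hR hM' T hT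
  exact isomorphic_model_of_family hM (isIrreducible_model hR) hε ⟨T, h0⟩ hP hC hS

end HeckeClifford

theorem mainTheorem6 {F : Type u} [Field F] [IsAlgClosed F] [CharZero F] (n : ℕ) :
    ∃ D : StrictPartition n → HeckeClifford.YModule.{u, u} F n,
      (∀ lam : StrictPartition n,
        (D lam).IsIrreducible ∧
        HeckeClifford.IsCompletelySplittable (D lam) ∧
        Module.Finite F (D lam).carrier ∧
        Module.finrank F (D lam).carrier =
          2 ^ (n - lam.length / 2) * numStandardTableaux lam ∧
        (Even lam.length → (D lam).IsTypeM) ∧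
        (Odd lam.length → (D lam).IsTypeQ) ∧
        HeckeClifford.IsSeminormal lam (D lam)) ∧
      (∀ lam mu : StrictPartition n, (D lam).Isomorphic (D mu) → lam = mu) ∧
      (∀ M : HeckeClifford.YModule.{u, w} F n,
        M.IsIrreducible → HeckeClifford.IsCompletelySplittable M →
          ∃ lam : StrictPartition n, M.Isomorphic (D lam)) := by
  choose R hfin hrank hR using fun lam : StrictPartition n =>
    WeightRep.exists_isUniversal.{u, w} (boxWeight F lam)
  -- The vanishing weights belong to the diagonal boxes; this turns the exponent and the parity
  -- condition of `exists_isUniversal` into expressions in the number of parts.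
  have hcard (lam : StrictPartition n) : Nat.card {b // boxWeight F lam b = 0} = lam.length :=
    lam.card_diagonal _ fun b => HeckeClifford.q_eq_zero
  simp only [hcard, StrictPartition.card_boxes] at hrank hR
  refine ⟨fun lam => SeminormalModel.model (R lam), fun lam => ⟨?_, ?_, ?_, ?_, fun h => ?_,
    fun h => ?_, ?_⟩, fun lam mu h => ?_, fun M hM hM' => ?_⟩
  · exact SeminormalModel.isIrreducible_model (hR lam)
  · exact SeminormalModel.isCompletelySplittable_model (R lam)
  · exact SeminormalModel.finite_model (R lam)
  · rw [SeminormalModel.finrank_model, hrank]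
  · exact SeminormalModel.isTypeM_model (hR lam) (Nat.not_odd_iff_even.2 h)
  · exact SeminormalModel.isTypeQ_model (hR lam) h
  · exact SeminormalModel.isSeminormal_model (R lam) (hR lam)
  · have := (hR lam).nontrivial
    exact SeminormalModel.eq_of_isomorphic (R lam) (R mu) h
  · have := HeckeClifford.finite_of_isIrreducible hM
    have : Nontrivial M.carrier := by
      obtain ⟨z, -, hz⟩ := (Submodule.ne_bot_iff _).1 hM.2.2.1
      exact ⟨z, 0, hz⟩
    obtain ⟨a, ha⟩ := HeckeClifford.exists_isWeight hM'
    obtain ⟨lam, T, rfl⟩ := ha.exists_tableau hM'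
    exact ⟨lam, HeckeClifford.isomorphic_model (hR lam) hM hM' T ha⟩
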